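/- Let $V$ and $W$ be finite-dimensional real vector spaces, $d=\dim V$, and fix a Lebesgue (Haar) measure $dv$ on $V$. Let $X:V\to W$ be a (jointly measurable) centred stationary Gaussian random field with continuous covariance function $\Omega$, given by $\Omega(u-v)(\ell,m)=\mathbb E[\ell(X(u))\,m(X(v))]$ for $\ell,m\in W^*$, such that the law $\eta$ of $X(0)$ is non-degenerate. Let $f\in L^2(\eta)$, and let $\phi:V\to\mathbb R$ be in $L^1\cap L^2(V)$ with $\|\phi\|_2=1$. For $\lambda>0$ put $$Z_\lambda(\phi)=\frac1{\lambda^{d/2}}\int_V\phi\Big(\frac v\lambda\Big)f(X(v))\,dv,\qquad Z^{(q)}_\lambda(\phi)=\frac1{\lambda^{d/2}}\int_V\phi\Big(\frac v\lambda\Big)\pi_q(f)(X(v))\,dv .$$ Here $\langle\cdot,\cdot\rangle$ is the scalar product on $W^*$ given by the covariance of $\eta$, transported to $W$ by duality and extended to $q$-linear forms on $W$ by $\langle \ell_1\otimes\dots\otimes\ell_q,m_1\otimes\dots\otimes m_q\rangle=\prod_k\langle\ell_k,m_k\rangle$; the Hermite forms are $H^q_x=(-1)^q e^{\|x\|^2/2}D^q_x[e^{-\|\cdot\|^2/2}]$;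 and $f_q=\int_W f(x)H^q_x\,d\eta(x)$, $\pi_q(f)(x)=\frac1{q!}\langle f_q,H^q_x\rangle$. A positive Hermitian measure over a complex vector space $U$ is a map $\mu$ from Borel sets to Hermitian forms on $U$ such that $\mu(w):E\mapsto\mu(E)(w,w)$ is a finite non-negative measure for every $w\in U$. There is a unique positive Hermitian measure $\mu$ on $V^*$ over the complexification $W^*_{\mathbb C}$ of $W^*$, the spectral measure of $X$, such that $\Omega(v)(\ell,\ell)=\int_{V^*}e^{2i\pi\xi(v)}\,d\mu(\ell)(\xi)$ for all $v\in V$ and $\ell\in W_{\mathbb C}^*$ ($\Omega(v)$ being extended sesquilinearly). For each $q\ge1$ there is a unique positive Hermitian measure $\mu^{*q}$ on $V^*$ over the space $(W_{\mathbb C}^*)^{\otimes q}$ of $q$-linear forms such that $\mu^{*q}(\ell_1\otimes\dots\otimes\ell_q)=\mu(\ell_1)*\dots*\mu(\ell_q)$ for all $\ell_1,\dots,\ell_q\in W^*_{\mathbb C}$. Put $\hat\phi(\xi)=\int_V e^{-2i\pi\xi(v)}\phi(v)\,dv$, $\gamma=|\hat\phi|^2$ and $\gamma_\lambda(\xi)=\lambda^d\gamma(\lambda\xi)$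 on $V^*$. Then for every $\lambda>0$ the integrals defining $Z_\lambda(\phi)$ and $Z^{(q)}_\lambda(\phi)$, $q\ge 0$, converge absolutely almost surely and define square-integrable random variables, and $$\operatorname{Var}(Z_\lambda(\phi))=\sum_{q=1}^{\infty}\operatorname{Var}(Z^{(q)}_\lambda(\phi)).$$ Moreover, for every $q\ge1$, the function $\gamma_\lambda$ is integrable with respect to the finite non-negative measure $\mu^{*q}(f_q)$, and $$\operatorname{Var}(Z^{(q)}_\lambda(\phi))=\frac1{q!}\int_{V^*}\gamma_\lambda(\xi)\,d\mu^{*q}(f_q)(\xi).$$ -/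

import Mathlib

open MeasureTheory ProbabilityTheory

noncomputable section

/-! ### Scalar products attached to a centred non-degenerate Gaussian measure -/

section GaussianForms

variable {W : Type*} [NormedAddCommGroup W] [NormedSpace ℝ W] [MeasurableSpace W]

/-- The map `W* → W`, `ℓ ↦ ∫ ℓ(x) x dη(x)`, induced by the covariance of a centred measure `η`:
`m (covVec η ℓ) = ∫ ℓ(x) m(x) dη(x)` is the scalar product `⟨ℓ, m⟩` on `W*`. -/
def covVec (η : Measure W) (ℓ : W →L[ℝ] ℝ) : W := ∫ x, ℓ x • x ∂η

/-- The linear form `w* = ⟨w, ·⟩` of a vector `w`. It is the inverse of `covVec η`, which is a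
bijection when `η` is a non-degenerate Gaussian measure on a finite dimensional space. -/
def dualForm (η : Measure W) (w : W) : W →L[ℝ] ℝ := Function.invFun (covVec η) w

/-- The scalar product on `W`, transported from the covariance scalar product on `W*`. -/
def scalarProd (η : Measure W) (x y : W) : ℝ := dualForm η x y

/-- The Hermite `q`-form `H_x^q = (-1)^q exp(‖x‖²/2) D_x^q[exp(-‖·‖²/2)]`, where `‖·‖` is the
norm associated with `scalarProd η`. -/
def hermiteForm (η : Measure W) (q : ℕ) (x : W) : W [×q]→L[ℝ] ℝ :=
  ((-1 : ℝ) ^ q * Real.exp (scalarProd η x x / 2)) •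
    iteratedFDeriv ℝ q (fun y : W => Real.exp (-(scalarProd η y y) / 2)) x

/-- The scalar product on `q`-linear forms on `W` induced by the centred Gaussian measure `η`,
written as `⟨F, G⟩ = E[F(Y₁, …, Y_q) G(Y₁, …, Y_q)]` with `Y₁, …, Y_q` independent of law `η`.
By `formInner_tensor` it is the bilinear form with
`⟨ℓ₁ ⊗ … ⊗ ℓ_q, m₁ ⊗ … ⊗ m_q⟩ = ∏ ⟨ℓ_k, m_k⟩`. -/
def formInner (η : Measure W) {q : ℕ} (F G : W [×q]→L[ℝ] ℝ) : ℝ :=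
  ∫ y : Fin q → W, F y * G y ∂(Measure.pi fun _ => η)

/-- The tensor product `ℓ₁ ⊗ … ⊗ ℓ_q : (w₁, …, w_q) ↦ ∏ ℓ_k(w_k)` of `ℝ`-linear forms. -/
def tensorForm {A : Type*} [NormedCommRing A] [NormedAlgebra ℝ A] {q : ℕ}
    (ℓ : Fin q → (W →L[ℝ] A)) : W [×q]→L[ℝ] A :=
  (ContinuousMultilinearMap.mkPiAlgebra ℝ (Fin q) A).compContinuousLinearMap ℓ

theorem formInner_tensor (η : Measure W) [SigmaFinite η] {q : ℕ} (ℓ m : Fin q → (W →L[ℝ] ℝ)) :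
    formInner η (tensorForm ℓ) (tensorForm m) = ∏ k, ∫ x, ℓ k x * m k x ∂η := by
  simp only [formInner, tensorForm, ContinuousMultilinearMap.compContinuousLinearMap_apply,
    ContinuousMultilinearMap.mkPiAlgebra_apply, ← Finset.prod_mul_distrib]
  exact integral_fintype_prod_eq_prod (fun k x => ℓ k x * m k x)

/-- The chaotic coefficient `f_q = ∫ f(x) H_x^q dη(x)`. -/
def chaosCoeff (η : Measure W) (f : W → ℝ) (q : ℕ) : W [×q]→L[ℝ] ℝ :=
  ∫ x, f x • hermiteForm η q x ∂η

/-- The Hermite projection `π_q(f) : x ↦ ⟨f_q, H_x^q⟩ / q!`. -/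
def chaosProj (η : Measure W) (f : W → ℝ) (q : ℕ) (x : W) : ℝ :=
  (1 / (q.factorial : ℝ)) * formInner η (chaosCoeff η f q) (hermiteForm η q x)

/-- A real `q`-linear form on `W`, seen as an element of the complexification of the space of
`q`-linear forms, which is the space of `ℝ`-multilinear maps `W^q → ℂ`. -/
def complexify {q : ℕ} (F : W [×q]→L[ℝ] ℝ) : W [×q]→L[ℝ] ℂ :=
  Complex.ofRealCLM.compContinuousMultilinearMap F

end GaussianForms

/-! ### Positive Hermitian measures -/

/-- A positive Hermitian measure on `E`, with values in the positive semi-definite Hermitian forms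
on the complex vector space `U`. It is given by its diagonal evaluations `μ_u : s ↦ μ(s)(u, u)`,
which are finite non-negative measures, such that for each measurable `s` the map
`u ↦ μ(s)(u, u)` is the diagonal of a sesquilinear form `μ(s)`. By polarization this form is
unique, and it is Hermitian because its diagonal is real. -/
structure PosHermitianMeasure (E : Type*) [MeasurableSpace E] (U : Type*) [AddCommGroup U]
    [Module ℂ U] where
  diag : U → Measure E
  finite : ∀ u, IsFiniteMeasure (diag u)
  sesq : ∀ s, MeasurableSet s →
    ∃ B : U →ₗ[ℂ] U →ₗ⋆[ℂ] ℂ, ∀ u, B u u = (((diag u).real s : ℝ) : ℂ)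

section Spectral

variable {V W S : Type*} [NormedAddCommGroup V] [NormedSpace ℝ V]
  [NormedAddCommGroup W] [NormedSpace ℝ W] [MeasurableSpace S]

/-- `μ` is the spectral measure of the centred stationary field `X`: for every `ℓ` in the
complexification of `W*` (the space of `ℝ`-linear maps `W → ℂ`),
`E[ℓ(X(u)) conj(ℓ(X(v)))] = ∫ exp(2iπ ξ(u - v)) dμ_ℓ(ξ)`. The left-hand side is
`Ω(u - v)(ℓ, ℓ)`, with the covariance function `Ω` extended sesquilinearly. -/
def IsSpectralMeasure (P : Measure S) (X : V → S → W)
    (μ : PosHermitianMeasure (V →L[ℝ] ℝ) (W →L[ℝ] ℂ)) : Prop :=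
  ∀ (ℓ : W →L[ℝ] ℂ) (u v : V),
    ∫ ω, ℓ (X u ω) * (starRingEnd ℂ) (ℓ (X v ω)) ∂P =
      ∫ ξ : V →L[ℝ] ℝ, Complex.exp (2 * Real.pi * Complex.I * (ξ (u - v) : ℝ)) ∂(μ.diag ℓ)

/-- `M` is the `q`-fold convolution `μ^{*q}`: a positive Hermitian measure over the `q`-fold tensor
power, with `μ^{*q}(ℓ₁ ⊗ … ⊗ ℓ_q) = μ(ℓ₁) * … * μ(ℓ_q)`, the convolution of finite measures being
the image of their product measure under addition. -/
def IsConvPow (q : ℕ) (μ : PosHermitianMeasure (V →L[ℝ] ℝ) (W →L[ℝ] ℂ))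
    (M : PosHermitianMeasure (V →L[ℝ] ℝ) (W [×q]→L[ℝ] ℂ)) : Prop :=
  ∀ ℓ : Fin q → (W →L[ℝ] ℂ),
    M.diag (tensorForm ℓ) =
      (Measure.pi fun k => μ.diag (ℓ k)).map fun ξ : Fin q → (V →L[ℝ] ℝ) => ∑ k, ξ k

variable [MeasurableSpace V]

/-- `Z_λ(φ) = λ^{-d/2} ∫ φ(v/λ) g(X(v)) dv`, where `d = dim V`. -/
def rescaledIntegral (vol : Measure V) (X : V → S → W) (g : W → ℝ) (φ : V → ℝ) (lam : ℝ)
    (ω : S) : ℝ :=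
  (1 / lam ^ ((Module.finrank ℝ V : ℝ) / 2)) * ∫ v, φ (lam⁻¹ • v) * g (X v ω) ∂vol

/-- `γ = |φ̂|²` on `V*`, where `φ̂(ξ) = ∫ exp(-2iπ ξ(v)) φ(v) dv`. -/
def gammaFun (vol : Measure V) (φ : V → ℝ) (ξ : V →L[ℝ] ℝ) : ℝ :=
  ‖∫ v, Complex.exp (-(2 * Real.pi * Complex.I * (ξ v : ℝ))) * (φ v : ℂ) ∂vol‖ ^ 2

/-- `γ_λ(ξ) = λ^d γ(λ ξ)`. -/
def gammaScaled (vol : Measure V) (φ : V → ℝ) (lam : ℝ) (ξ : V →L[ℝ] ℝ) : ℝ :=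
  lam ^ Module.finrank ℝ V * gammaFun vol φ (lam • ξ)

end Spectral

end

/-! By Fubini, the variance of `rescaledIntegral` for a function `g` is `λ^{-d}` times the double
integral of `φ(u/λ) φ(v/λ) Cov(g(X u), g(X v))` (`variance_rescaledIntegral`). Both assertions thus
reduce to facts about two-point covariances.

Chaos side. Pairing `ℓ ⊗ … ⊗ ℓ` with the Hermite form at `x` gives the one-variable Hermite
polynomial of variance `E[ℓ²]` at `ℓ(x)` (`formInner_power_hermiteForm`). The coefficient `f_q` is
symmetric, hence a combination of such powers (`mem_powerSpan_of_symmetric`), so every covariance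
follows by bilinearity from the one for a Gaussian pair of real variables
(`integral_hermitePoly_mul`), itself a consequence of Gaussian integration by parts. Different
orders are uncorrelated even at different points. In order `q` the covariance is `1/q!` times
`E[f_q(X¹_u, …, X^q_u) f_q(X¹_v, …, X^q_v)]` over independent copies of the field
(`integral_chaosProj_mul`). Completeness of the Hermite polynomials gives the expansion of `f` in
`L²(η)` (`hasSum_chaosProj`), and the bound by `‖π_q f‖²`, uniform in `u` and `v`, permits
integrating it term by term.

Spectral side. For every `q`-linear form `T`, the field `v ↦ T(X¹_v, …, X^q_v)` is stationary with
continuous covariance, so Bochner's theorem gives it a spectral measure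
(`IsStationaryField.exists_measure`). Injectivity of the Fourier transform carries sesquilinearity
in `T` from covariances to measures (`exists_of_kernel`). On a decomposable `T` the covariance
factors over the copies, and the measure is the convolution of the spectral measures of the factors.
This realizes `μ^{*q}` as the spectral measure of a field, so its positivity off decomposable
tensors is automatic (`exists_isConvPow`); polarization gives uniqueness (`ext_tensorForm`). A last
Fubini turns the double integral of the characters into `γ_λ` (`integral_weighted_fourier`). -/

noncomputable section

/-! ### Multilinear forms: polarization and powers of linear forms -/

section MultilinearForms

/-- Polarization: the symmetrization of a multilinear map is a combination of its diagonal
values. -/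
theorem MultilinearMap.sum_perm_eq_sum_diagonal {R E E' : Type*} [CommRing R] [AddCommGroup E]
    [Module R E] [AddCommGroup E'] [Module R E'] {q : ℕ}
    (M : MultilinearMap R (fun _ : Fin q => E) E') (w : Fin q → E) :
    ∑ σ : Equiv.Perm (Fin q), M (w ∘ σ) =
      ∑ B : Finset (Fin q), (-1 : ℤ) ^ B.card • M fun _ => ∑ i ∈ Bᶜ, w i := by
  -- The sum of the `w i` over the complement of `B` expands over all maps `r` whose image avoids
  -- `B`.
  classical
  have h1 : ∀ B : Finset (Fin q), (M fun _ => ∑ i ∈ Bᶜ, w i) =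
      ∑ r : Fin q → Fin q, if B ⊆ (Finset.univ.image r)ᶜ then M (w ∘ r) else 0 := by
    intro B
    rw [MultilinearMap.map_sum_finset M (fun _ i => w i) (fun _ => Bᶜ), ← Finset.sum_filter]
    refine Finset.sum_congr ?_ fun r _ => rfl
    ext r
    simp only [Fintype.mem_piFinset, Finset.mem_compl, Finset.mem_filter, Finset.mem_univ,
      true_and, Finset.subset_iff, Finset.mem_image, not_exists]
    exact ⟨fun h i hi k hk => h k (hk ▸ hi), fun h k hk => h hk k rfl⟩
  simp only [h1, Finset.smul_sum, smul_ite, smul_zero]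
  rw [Finset.sum_comm]
  -- Inclusion-exclusion: the alternating sum over the subsets of the complement of the image of `r`
  -- vanishes unless that complement is empty, i.e. unless `r` is a permutation.
  have h2 : ∀ r : Fin q → Fin q,
      (∑ B : Finset (Fin q), if B ⊆ (Finset.univ.image r)ᶜ then (-1 : ℤ) ^ B.card • M (w ∘ r)
        else 0) = if Function.Bijective r then M (w ∘ r) else 0 := by
    intro r
    rw [← Finset.sum_filter, ← Finset.sum_smul]
    have : (Finset.univ.filter fun B : Finset (Fin q) => B ⊆ (Finset.univ.image r)ᶜ) =
        ((Finset.univ.image r)ᶜ).powerset := by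
      ext B; simp
    rw [this, Finset.sum_powerset_neg_one_pow_card]
    have h3 : (Finset.univ.image r)ᶜ = ∅ ↔ Function.Bijective r := by
      rw [Finset.compl_eq_empty_iff, ← Finite.injective_iff_bijective,
        Finite.injective_iff_surjective, Finset.eq_univ_iff_forall]
      simp [Function.Surjective]
    simp only [h3]
    split_ifs <;> simp
  simp only [h2]
  rw [← Finset.sum_filter]
  refine Finset.sum_bij' (fun σ _ => (σ : Fin q → Fin q))
    (fun r hr => Equiv.ofBijective r (Finset.mem_filter.1 hr).2) ?_ ?_ ?_ ?_ ?_
  · intro σ _; exact Finset.mem_filter.2 ⟨Finset.mem_univ _, σ.bijective⟩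
  · intro r _; exact Finset.mem_univ _
  · intro σ _; ext; simp
  · intro r _; rfl
  · intro σ _; rfl

variable {W : Type*} [NormedAddCommGroup W] [NormedSpace ℝ W]

theorem tensorForm_apply {A : Type*} [NormedCommRing A] [NormedAlgebra ℝ A] {q : ℕ}
    (ℓ : Fin q → (W →L[ℝ] A)) (w : Fin q → W) : tensorForm ℓ w = ∏ k, ℓ k (w k) := by
  simp [tensorForm]

variable [FiniteDimensional ℝ W] {ι : Type*} [Fintype ι]

/-- The coordinate forms of a basis, as continuous linear forms. -/
def coordForm (b : Module.Basis ι ℝ W) (i : ι) : W →L[ℝ] ℝ :=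
  LinearMap.toContinuousLinearMap (b.coord i)

theorem form_expand {A : Type*} [NormedAddCommGroup A] [NormedSpace ℝ A] {q : ℕ}
    (b : Module.Basis ι ℝ W) (F : W [×q]→L[ℝ] A) (w : Fin q → W) :
    F w = ∑ i : Fin q → ι, (∏ k, coordForm b (i k) (w k)) • F fun k => b (i k) := by
  classical
  have h : w = fun k => ∑ j, coordForm b j (w k) • b j := by
    funext k
    exact (b.sum_repr (w k)).symm
  conv_lhs => rw [h]
  rw [ContinuousMultilinearMap.map_sum]
  refine Finset.sum_congr rfl fun i _ => ?_
  exact F.map_smul_univ (fun k => coordForm b (i k) (w k)) fun k => b (i k)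

theorem form_eq_sum_tensorForm {q : ℕ} (b : Module.Basis ι ℝ W) (F : W [×q]→L[ℝ] ℝ) :
    F = ∑ i : Fin q → ι, (F fun k => b (i k)) • tensorForm fun k => coordForm b (i k) := by
  ext w
  rw [form_expand b F w, sum_apply]
  refine Finset.sum_congr rfl fun i _ => ?_
  simp [tensorForm_apply, mul_comm]

theorem complexForm_eq_sum_tensorForm {q : ℕ} (b : Module.Basis ι ℝ W) (F : W [×q]→L[ℝ] ℂ) :
    F = ∑ i : Fin q → ι, (F fun k => b (i k)) •
      tensorForm fun k => Complex.ofRealCLM ∘L coordForm b (i k) := by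
  ext w
  rw [form_expand b F w, sum_apply]
  refine Finset.sum_congr rfl fun i _ => ?_
  simp [tensorForm_apply, mul_comm]

/-- The span of the powers `ℓ ⊗ … ⊗ ℓ`. -/
def powerSpan (W : Type*) [NormedAddCommGroup W] [NormedSpace ℝ W] (q : ℕ) :
    Submodule ℝ (W [×q]→L[ℝ] ℝ) :=
  Submodule.span ℝ (Set.range fun ℓ : W →L[ℝ] ℝ => tensorForm fun _ : Fin q => ℓ)

theorem tensorForm_const_mem_powerSpan {W : Type*} [NormedAddCommGroup W] [NormedSpace ℝ W] {q : ℕ}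
    (ℓ : W →L[ℝ] ℝ) : (tensorForm fun _ : Fin q => ℓ) ∈ powerSpan W q :=
  Submodule.subset_span ⟨ℓ, rfl⟩

/-- `tensorForm` as a multilinear map. -/
def tensorFormMultilinear (W : Type*) [NormedAddCommGroup W] [NormedSpace ℝ W] (q : ℕ) :
    MultilinearMap ℝ (fun _ : Fin q => W →L[ℝ] ℝ) (W [×q]→L[ℝ] ℝ) where
  toFun := tensorForm
  map_update_add' m i x y := by
    ext w
    simp only [tensorForm_apply, add_apply]
    exact MultilinearMap.map_update_add
      ((MultilinearMap.mkPiAlgebra ℝ (Fin q) ℝ).compLinearMap fun k =>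
        (ContinuousLinearMap.apply ℝ ℝ (w k)).toLinearMap) m i x y
  map_update_smul' m i c x := by
    ext w
    simp only [tensorForm_apply, smul_apply]
    exact MultilinearMap.map_update_smul
      ((MultilinearMap.mkPiAlgebra ℝ (Fin q) ℝ).compLinearMap fun k =>
        (ContinuousLinearMap.apply ℝ ℝ (w k)).toLinearMap) m i c x

/-- A symmetric form is a combination of powers of linear forms. -/
theorem mem_powerSpan_of_symmetric {q : ℕ} (F : W [×q]→L[ℝ] ℝ)
    (hF : ∀ (σ : Equiv.Perm (Fin q)) (w : Fin q → W), F (w ∘ σ) = F w) : F ∈ powerSpan W q := by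
  classical
  let b := Module.finBasis ℝ W
  have hsum : ∀ σ : Equiv.Perm (Fin q), F = ∑ i : Fin q → Fin (Module.finrank ℝ W),
      (F fun k => b (i k)) • tensorForm ((fun k => coordForm b (i k)) ∘ σ) := by
    intro σ
    conv_lhs => rw [form_eq_sum_tensorForm b F]
    refine Fintype.sum_equiv (Equiv.arrowCongr σ (Equiv.refl _)) _ _ fun i => ?_
    have h1 : (fun k => b ((Equiv.arrowCongr σ (Equiv.refl _)) i k)) =
        (fun k => b (i k)) ∘ σ.symm := by
      ext k; simp
    rw [h1, hF]
    congr 2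
    funext k
    simp
  -- Summing the coordinate expansion over all permutations symmetrizes each tensor, and
  -- polarization writes a symmetrized tensor through powers.
  have hmem : (q.factorial : ℝ) • F ∈ powerSpan W q := by
    have h2 : (q.factorial : ℝ) • F = ∑ i : Fin q → Fin (Module.finrank ℝ W),
        (F fun k => b (i k)) • ∑ σ : Equiv.Perm (Fin q),
          tensorFormMultilinear W q ((fun k => coordForm b (i k)) ∘ σ) := by
      simp only [Finset.smul_sum]
      rw [Finset.sum_comm]
      calc (q.factorial : ℝ) • F = ∑ _σ : Equiv.Perm (Fin q), F := by
            simp [Fintype.card_perm, ← Nat.cast_smul_eq_nsmul ℝ]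
        _ = _ := Finset.sum_congr rfl fun σ _ => hsum σ
    rw [h2]
    refine Submodule.sum_mem _ fun i _ => Submodule.smul_mem _ _ ?_
    rw [MultilinearMap.sum_perm_eq_sum_diagonal]
    refine Submodule.sum_mem _ fun B _ => ?_
    exact zsmul_mem (tensorForm_const_mem_powerSpan _) _
  have := Submodule.smul_mem _ (q.factorial : ℝ)⁻¹ hmem
  rwa [smul_smul, inv_mul_cancel₀ (by positivity), one_smul] at this

end MultilinearForms

/-! ### Hermite polynomials of variance `a` -/

section HermitePolynomials

open Polynomial

/-- The Hermite polynomials associated with the centred Gaussian law of variance `a`. -/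
def hermitePoly (a : ℝ) : ℕ → ℝ[X]
  | 0 => 1
  | n + 1 => X * hermitePoly a n - C a * derivative (hermitePoly a n)

theorem derivative_hermitePoly_succ (a : ℝ) (n : ℕ) :
    derivative (hermitePoly a (n + 1)) = C ((n : ℝ) + 1) * hermitePoly a n := by
  induction n with
  | zero => simp [hermitePoly]
  | succ n ih =>
    rw [hermitePoly, derivative_sub, derivative_mul, derivative_X, one_mul, derivative_C_mul, ih,
      derivative_C_mul]
    conv_rhs => rw [hermitePoly]
    simp only [hermitePoly, map_add, map_one, Nat.cast_add, Nat.cast_one]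
    ring

/-- The span is stable under multiplication by `X`: the recursion gives `X H_k = H_{k+1} + a H_k'`,
and `H_k'` is a multiple of the preceding polynomial. -/
theorem X_pow_mem_span_hermitePoly (a : ℝ) (n : ℕ) :
    (X ^ n : ℝ[X]) ∈ Submodule.span ℝ (Set.range (hermitePoly a)) := by
  have hmul : ∀ p ∈ Submodule.span ℝ (Set.range (hermitePoly a)),
      X * p ∈ Submodule.span ℝ (Set.range (hermitePoly a)) := by
    intro p hp
    induction hp using Submodule.span_induction with
    | mem x hx =>
      obtain ⟨k, rfl⟩ := hx
      have h : X * hermitePoly a k = hermitePoly a (k + 1) +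
          C a * derivative (hermitePoly a k) := by
        rw [hermitePoly]; ring
      rw [h]
      refine Submodule.add_mem _ (Submodule.subset_span ⟨_, rfl⟩) ?_
      rw [← smul_eq_C_mul]
      refine Submodule.smul_mem _ _ ?_
      cases k with
      | zero => simp [hermitePoly]
      | succ k =>
        rw [derivative_hermitePoly_succ, ← smul_eq_C_mul]
        exact Submodule.smul_mem _ _ (Submodule.subset_span ⟨_, rfl⟩)
    | zero => simp
    | add x y _ _ hx hy => rw [mul_add]; exact Submodule.add_mem _ hx hy
    | smul c x _ hx => rw [mul_smul_comm]; exact Submodule.smul_mem _ _ hx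
  induction n with
  | zero => rw [pow_zero]; exact Submodule.subset_span ⟨0, rfl⟩
  | succ n ih => rw [pow_succ']; exact hmul _ ih

end HermitePolynomials

/-! ### Gaussian integration by parts and covariances of Hermite polynomials -/

section SteinIdentity

open Polynomial

variable {S : Type*} [MeasurableSpace S] {P : Measure S}

theorem memLp_polynomial_eval [IsFiniteMeasure P] {A : S → ℝ}
    (hA : ∀ r : NNReal, MemLp A r P) (p : ℝ[X]) (r : NNReal) :
    MemLp (fun ω => p.eval (A ω)) r P := by
  induction p using Polynomial.induction_on' generalizing r with
  | add p q hp hq =>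
    simp only [eval_add]
    exact (hp r).add (hq r)
  | monomial n c =>
    simp only [eval_monomial]
    refine MemLp.const_mul ?_ c
    induction n generalizing r with
    | zero => simpa using memLp_const (1 : ℝ)
    | succ n ih =>
      simp only [pow_succ']
      -- Hölder with exponents `2r, 2r`: each further power of `A` costs a doubling of the exponent,
      -- harmless since all moments are finite.
      have : ENNReal.HolderTriple ((2 * r : NNReal) : ENNReal) ((2 * r : NNReal) : ENNReal) r := by
        constructor
        rcases eq_or_ne r 0 with rfl | hr
        · simp
        have h2 : ((2 * r : NNReal) : ENNReal) = 2 * (r : ENNReal) := by push_cast; rfl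
        rw [h2, ENNReal.mul_inv (by simp) (by simp), ← add_mul, ENNReal.inv_two_add_inv_two,
          one_mul]
      exact MemLp.mul' (ih (2 * r)) (hA (2 * r))

theorem memLp_two_polynomial_eval [IsFiniteMeasure P] {A : S → ℝ}
    (hA : ∀ r : NNReal, MemLp A r P) (p : ℝ[X]) : MemLp (fun ω => p.eval (A ω)) 2 P := by
  simpa only [ENNReal.coe_ofNat] using memLp_polynomial_eval hA p 2

theorem integrable_polynomial_eval_mul [IsFiniteMeasure P] {A B : S → ℝ}
    (hA : ∀ r : NNReal, MemLp A r P) (hB : ∀ r : NNReal, MemLp B r P) (p q : ℝ[X]) :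
    Integrable (fun ω => p.eval (A ω) * q.eval (B ω)) P :=
  (memLp_two_polynomial_eval hA p).integrable_mul (memLp_two_polynomial_eval hB q)

theorem memLp_polynomial_eval_gaussianReal (v : NNReal) (p : ℝ[X]) (r : NNReal) :
    MemLp (fun x => p.eval x) r (gaussianReal 0 v) :=
  memLp_polynomial_eval (A := id) (fun r => memLp_id_gaussianReal r) p r

/-- The density has logarithmic derivative `-x/v`, and the derivative of density times polynomial
has total integral zero. -/
theorem integral_mul_polynomial_gaussianReal (v : NNReal) (p : ℝ[X]) :
    ∫ x, x * p.eval x ∂(gaussianReal 0 v) =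
      v * ∫ x, (derivative p).eval x ∂(gaussianReal 0 v) := by
  rcases eq_or_ne v 0 with rfl | hv
  · simp
  have hint : ∀ p : ℝ[X], Integrable (fun x => gaussianPDFReal 0 v x * p.eval x) := by
    intro p
    have h := memLp_one_iff_integrable.1 (memLp_polynomial_eval_gaussianReal v p 1)
    rw [gaussianReal_of_var_ne_zero 0 hv, integrable_withDensity_iff_integrable_smul'
      (measurable_gaussianPDF 0 v) (Filter.Eventually.of_forall fun x => gaussianPDF_lt_top)] at h
    simpa using h
  have hv' : (v : ℝ) ≠ 0 := by exact_mod_cast hv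
  have hpdf : ∀ x, HasDerivAt (gaussianPDFReal 0 v) (gaussianPDFReal 0 v x * (-x / v)) x := by
    intro x
    rw [gaussianPDFReal_def]
    have h1 : HasDerivAt (fun x : ℝ => -(x - 0) ^ 2 / (2 * v)) (-x / v) x := by
      have := (((hasDerivAt_id x).sub_const 0).pow 2).neg.div_const (2 * (v : ℝ))
      refine this.congr_deriv ?_
      simp
      field_simp
    exact (h1.exp.const_mul _).congr_deriv (by ring)
  have hzero := integral_eq_zero_of_hasDerivAt_of_integrable
    (f := fun x => gaussianPDFReal 0 v x * p.eval x)
    (f' := fun x => gaussianPDFReal 0 v x * (-x / v) * p.eval x +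
      gaussianPDFReal 0 v x * (derivative p).eval x)
    (fun x => (hpdf x).mul (p.hasDerivAt x)) ?_ (hint p)
  · rw [integral_gaussianReal_eq_integral_smul hv, integral_gaussianReal_eq_integral_smul hv]
    have h2 : ∀ x, gaussianPDFReal 0 v x * (-x / v) * p.eval x =
        (-(v : ℝ)⁻¹) * (gaussianPDFReal 0 v x * (X * p).eval x) := by
      intro x; simp; field_simp
    rw [integral_add, integral_congr_ae (Filter.Eventually.of_forall h2), integral_const_mul] at hzero
    · simp only [eval_mul, eval_X, smul_eq_mul, ← mul_assoc] at hzero ⊢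
      field_simp at hzero
      linarith
    · exact ((hint (X * p)).const_mul (-(v : ℝ)⁻¹)).congr
        (Filter.Eventually.of_forall fun x => (h2 x).symm)
    · exact hint _
  · refine Integrable.add ?_ (hint _)
    refine ((hint (X * p)).const_mul (-(v : ℝ)⁻¹)).congr (Filter.Eventually.of_forall fun x => ?_)
    simp; field_simp

/-- Gaussian integration by parts, for polynomials of a centred Gaussian pair. -/
theorem ProbabilityTheory.HasGaussianLaw.integral_mul_polynomial {A B : S → ℝ}
    (hAB : HasGaussianLaw (fun ω => (A ω, B ω)) P)
    (hA : ∫ ω, A ω ∂P = 0) (p q : ℝ[X]) :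
    ∫ ω, A ω * (p.eval (A ω) * q.eval (B ω)) ∂P =
      (∫ ω, A ω ^ 2 ∂P) * (∫ ω, (derivative p).eval (A ω) * q.eval (B ω) ∂P) +
      (∫ ω, A ω * B ω ∂P) * (∫ ω, p.eval (A ω) * (derivative q).eval (B ω) ∂P) := by
  have hP : IsProbabilityMeasure P := hAB.isProbabilityMeasure
  have hmemA : ∀ r : NNReal, MemLp A r P := fun r => hAB.fst.memLp (by simp)
  have hmemB : ∀ r : NNReal, MemLp B r P := fun r => hAB.snd.memLp (by simp)
  have hint : ∀ p q : ℝ[X], Integrable (fun ω => p.eval (A ω) * q.eval (B ω)) P := fun p q =>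
    integrable_polynomial_eval_mul hmemA hmemB p q
  set a := ∫ ω, A ω ^ 2 ∂P with ha
  set c := ∫ ω, A ω * B ω ∂P with hc
  have hmemA2 : MemLp A 2 P := hAB.fst.memLp_two
  have hmemB2 : MemLp B 2 P := hAB.snd.memLp_two
  have hA2 : Integrable (fun ω => A ω ^ 2) P := hmemA2.integrable_sq
  have hAB2 : Integrable (fun ω => A ω * B ω) P := hmemA2.integrable_mul hmemB2
  -- If `A` has variance zero it vanishes almost surely, and the regression coefficient `c / a`
  -- below is not available.
  rcases eq_or_ne a 0 with ha0 | ha0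
  · have hA0 : A =ᵐ[P] 0 := by
      have := (integral_eq_zero_iff_of_nonneg (fun ω => sq_nonneg (A ω)) hA2).1 (ha ▸ ha0)
      filter_upwards [this] with ω h
      simpa using h
    have hc0 : c = 0 := by
      rw [hc, integral_eq_zero_of_ae]
      filter_upwards [hA0] with ω h
      simp [h]
    rw [ha0, hc0, zero_mul, zero_mul, add_zero, integral_eq_zero_of_ae]
    filter_upwards [hA0] with ω h
    simp [h]
  have hapos : 0 < a := lt_of_le_of_ne (integral_nonneg fun ω => sq_nonneg _) ha0.symm
  set κ := c / a with hκ
  -- The residual of the regression of `B` on `A`: uncorrelated with `A`, hence independent of it by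
  -- joint normality.
  let B' : S → ℝ := fun ω => B ω - κ * A ω
  have hAB' : HasGaussianLaw (fun ω => (A ω, B' ω)) P := by
    have := hAB.map_fun ((ContinuousLinearMap.fst ℝ ℝ ℝ).prod
      (ContinuousLinearMap.snd ℝ ℝ ℝ - κ • ContinuousLinearMap.fst ℝ ℝ ℝ))
    simpa [B'] using this
  have hAm : AEMeasurable A P := hAB'.fst.aemeasurable
  have hBm : AEMeasurable B' P := hAB'.snd.aemeasurable
  have hindep : IndepFun A B' P := by
    refine hAB'.indepFun_of_covariance_eq_zero ?_
    rw [covariance_eq_sub (Y := B') hmemA2 (hmemB2.sub (hmemA2.const_mul κ)), hA, zero_mul,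
      sub_zero]
    have : ∀ ω, (A * B') ω = A ω * B ω - κ * A ω ^ 2 := by intro ω; simp [B']; ring
    simp only [this]
    rw [integral_sub hAB2 (hA2.const_mul κ), integral_const_mul, ← hc, ← ha, hκ]
    field_simp
    simp
  have hlaw : P.map A = gaussianReal 0 a.toNNReal := by
    rw [hAB'.fst.map_eq_gaussianReal, hA, variance_eq_sub hmemA2, hA]
    simp [ha]
  have hprod := (indepFun_iff_map_prod_eq_prod_map_map hAm hBm).1 hindep
  have hmeas : ∀ p q : ℝ[X], Measurable fun z : ℝ × ℝ => p.eval z.1 * q.eval (κ * z.1 + z.2) :=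
    fun p q => ((p.continuous.comp continuous_fst).mul
      (q.continuous.comp (by fun_prop : Continuous fun z : ℝ × ℝ => κ * z.1 + z.2))).measurable
  have hback : ∀ ω, κ * A ω + B' ω = B ω := fun ω => by simp [B']
  have hintprod : ∀ p q : ℝ[X], Integrable (fun z : ℝ × ℝ => p.eval z.1 * q.eval (κ * z.1 + z.2))
      ((P.map A).prod (P.map B')) := by
    intro p q
    rw [← hprod, integrable_map_measure (hmeas p q).aestronglyMeasurable (hAm.prodMk hBm)]
    simpa only [Function.comp_def, hback] using hint p q
  have : IsProbabilityMeasure (P.map A) := Measure.isProbabilityMeasure_map hAm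
  have : IsProbabilityMeasure (P.map B') := Measure.isProbabilityMeasure_map hBm
  have hval : ∀ p q : ℝ[X], ∫ ω, p.eval (A ω) * q.eval (B ω) ∂P =
      ∫ y, ∫ x, p.eval x * q.eval (κ * x + y) ∂(P.map A) ∂(P.map B') := by
    intro p q
    rw [← integral_prod_symm _ (hintprod p q), ← hprod,
      integral_map (hAm.prodMk hBm) (hmeas p q).aestronglyMeasurable]
    simp only [hback]
  -- With the residual frozen at `y`, the integrand is a polynomial in `A` alone. The chain rule
  -- produces the factor `κ`, and `a κ = c`.
  have hstein : ∀ y, ∫ x, (X * p).eval x * q.eval (κ * x + y) ∂(P.map A) =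
      a * ∫ x, (derivative p).eval x * q.eval (κ * x + y) ∂(P.map A) +
      c * ∫ x, p.eval x * (derivative q).eval (κ * x + y) ∂(P.map A) := by
    intro y
    rw [hlaw]
    have hint1 : ∀ p q : ℝ[X], Integrable (fun x => p.eval x * q.eval (κ * x + y))
        (gaussianReal 0 a.toNNReal) := by
      intro p q
      have := memLp_one_iff_integrable.1
        (memLp_polynomial_eval_gaussianReal a.toNNReal (p * q.comp (C κ * X + C y)) 1)
      simpa using this
    have h := integral_mul_polynomial_gaussianReal a.toNNReal (p * q.comp (C κ * X + C y))
    rw [Real.coe_toNNReal a hapos.le] at h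
    simp only [eval_mul, eval_comp, eval_add, eval_C, eval_X, derivative_mul, derivative_comp,
      derivative_add, derivative_C, derivative_X, ← mul_assoc, zero_mul, zero_add, add_zero,
      mul_one] at h ⊢
    rw [h, integral_add (hint1 _ _)]
    · have : ∀ x : ℝ, p.eval x * κ * (derivative q).eval (κ * x + y) =
          κ * (p.eval x * (derivative q).eval (κ * x + y)) := fun x => by ring
      simp only [this]
      rw [integral_const_mul, mul_add, ← mul_assoc, hκ, mul_div_cancel₀ _ ha0]
    · refine ((hint1 p (derivative q)).const_mul κ).congr
        (Filter.Eventually.of_forall fun x => ?_)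
      simp only; ring
  have hL := hval (X * p) q
  simp only [hstein] at hL
  rw [integral_add ((hintprod _ _).integral_prod_right.const_mul a)
    ((hintprod _ _).integral_prod_right.const_mul c), integral_const_mul, integral_const_mul,
    ← hval, ← hval] at hL
  rw [← hL]
  refine integral_congr_ae (Filter.Eventually.of_forall fun ω => ?_)
  simp only [eval_mul, eval_X]; ring

/-- The covariances of the Hermite polynomials of a centred Gaussian pair. -/
theorem ProbabilityTheory.HasGaussianLaw.integral_hermitePoly_mul {A B : S → ℝ}
    (hAB : HasGaussianLaw (fun ω => (A ω, B ω)) P)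
    (hA : ∫ ω, A ω ∂P = 0) (hB : ∫ ω, B ω ∂P = 0) (p q : ℕ) :
    ∫ ω, (hermitePoly (∫ ω, A ω ^ 2 ∂P) p).eval (A ω) *
        (hermitePoly (∫ ω, B ω ^ 2 ∂P) q).eval (B ω) ∂P =
      if p = q then q.factorial * (∫ ω, A ω * B ω ∂P) ^ q else 0 := by
  have hP : IsProbabilityMeasure P := hAB.isProbabilityMeasure
  have hmemA : ∀ r : NNReal, MemLp A r P := fun r => hAB.fst.memLp (by simp)
  have hmemB : ∀ r : NNReal, MemLp B r P := fun r => hAB.snd.memLp (by simp)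
  have hint : ∀ p q : ℝ[X], Integrable (fun ω => p.eval (A ω) * q.eval (B ω)) P := fun p q =>
    integrable_polynomial_eval_mul hmemA hmemB p q
  -- The term `-a H_n'` of the recursion cancels the first term of the integration by parts; only
  -- the cross-covariance term survives.
  have hstep : ∀ (n : ℕ) (g : ℝ[X]),
      ∫ ω, (hermitePoly (∫ ω, A ω ^ 2 ∂P) (n + 1)).eval (A ω) * g.eval (B ω) ∂P =
      (∫ ω, A ω * B ω ∂P) *
        ∫ ω, (hermitePoly (∫ ω, A ω ^ 2 ∂P) n).eval (A ω) * (derivative g).eval (B ω) ∂P := by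
    intro n g
    have h := hAB.integral_mul_polynomial hA (hermitePoly (∫ ω, A ω ^ 2 ∂P) n) g
    have h2 : ∀ ω, (hermitePoly (∫ ω, A ω ^ 2 ∂P) (n + 1)).eval (A ω) * g.eval (B ω) =
        A ω * ((hermitePoly (∫ ω, A ω ^ 2 ∂P) n).eval (A ω) * g.eval (B ω)) -
        (∫ ω, A ω ^ 2 ∂P) *
          ((derivative (hermitePoly (∫ ω, A ω ^ 2 ∂P) n)).eval (A ω) * g.eval (B ω)) := by
      intro ω
      rw [hermitePoly]
      simp only [eval_sub, eval_mul, eval_X, eval_C]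
      ring
    simp only [h2]
    rw [integral_sub, integral_const_mul, h]
    · ring
    · refine (hint (X * hermitePoly (∫ ω, A ω ^ 2 ∂P) n) g).congr
        (Filter.Eventually.of_forall fun ω => ?_)
      simp only [eval_mul, eval_X]; ring
    · exact (hint _ _).const_mul _
  induction q generalizing p with
  | zero =>
    cases p with
    | zero => simp [hermitePoly]
    | succ p => rw [hstep]; simp [hermitePoly]
  | succ q ih =>
    cases p with
    | zero =>
      -- Here the left factor is constant, so the parts are integrated in `B` instead: a Hermite
      -- polynomial of positive degree has mean zero.
      have hBA : HasGaussianLaw (fun ω => (B ω, A ω)) P := by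
        have := hAB.map_fun ((ContinuousLinearMap.snd ℝ ℝ ℝ).prod (ContinuousLinearMap.fst ℝ ℝ ℝ))
        simpa using this
      have h := hBA.integral_mul_polynomial hB (hermitePoly (∫ ω, B ω ^ 2 ∂P) q) 1
      have hint' : ∀ p : ℝ[X], Integrable (fun ω => p.eval (B ω)) P := fun p => by
        simpa using hint 1 p
      simp only [eval_one, mul_one, derivative_one, eval_zero, mul_zero, integral_zero,
        add_zero] at h
      simp only [hermitePoly, eval_one, one_mul, eval_sub, eval_mul, eval_X, eval_C]
      rw [integral_sub, integral_const_mul, h]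
      · simp
      · exact (hint' (X * hermitePoly (∫ ω, B ω ^ 2 ∂P) q)).congr
          (Filter.Eventually.of_forall fun ω => by simp)
      · exact (hint' _).const_mul _
    | succ p =>
      rw [hstep, derivative_hermitePoly_succ]
      have : ∀ ω, (hermitePoly (∫ ω, A ω ^ 2 ∂P) p).eval (A ω) *
          (C ((q : ℝ) + 1) * hermitePoly (∫ ω, B ω ^ 2 ∂P) q).eval (B ω) =
          ((q : ℝ) + 1) * ((hermitePoly (∫ ω, A ω ^ 2 ∂P) p).eval (A ω) *
          (hermitePoly (∫ ω, B ω ^ 2 ∂P) q).eval (B ω)) := by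
        intro ω; simp; ring
      simp only [this]
      rw [integral_const_mul, ih p]
      by_cases hpq : p = q
      · simp [hpq, Nat.factorial_succ, pow_succ]; ring
      · simp [hpq]

end SteinIdentity

/-! ### Moments of multilinear forms over independent copies -/

section FormMoments

variable {W : Type*} [NormedAddCommGroup W] [NormedSpace ℝ W] [FiniteDimensional ℝ W]
  {S : Type*} [MeasurableSpace S] {P : Measure S} [IsProbabilityMeasure P]
  {𝕜 : Type*} [RCLike 𝕜] {q : ℕ} {X Y : S → W} {ι : Type*} [Fintype ι]

theorem form_mul_form_expand (b : Module.Basis ι ℝ W) (F G : W [×q]→L[ℝ] 𝕜) (w z : Fin q → W) :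
    F w * G z = ∑ i : Fin q → ι, ∑ j : Fin q → ι,
      (∏ k, coordForm b (i k) (w k) * coordForm b (j k) (z k)) •
        ((F fun k => b (i k)) * (G fun k => b (j k))) := by
  rw [form_expand b F w, form_expand b G z, Finset.sum_mul_sum]
  refine Finset.sum_congr rfl fun i _ => Finset.sum_congr rfl fun j _ => ?_
  rw [smul_mul_smul_comm, Finset.prod_mul_distrib]

theorem integrable_form_mul (hX : ∀ ℓ : W →L[ℝ] ℝ, MemLp (fun ω => ℓ (X ω)) 2 P)
    (hY : ∀ ℓ : W →L[ℝ] ℝ, MemLp (fun ω => ℓ (Y ω)) 2 P) (F G : W [×q]→L[ℝ] 𝕜) :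
    Integrable (fun ω : Fin q → S => F (fun k => X (ω k)) * G (fun k => Y (ω k)))
      (Measure.pi fun _ => P) := by
  simp_rw [fun ω : Fin q → S => form_mul_form_expand (Module.finBasis ℝ W) F G
    (fun k => X (ω k)) fun k => Y (ω k)]
  refine integrable_finsetSum _ fun i _ => integrable_finsetSum _ fun j _ => ?_
  refine Integrable.smul_const ?_ _
  exact Integrable.fintype_prod (f := fun k ω => coordForm (Module.finBasis ℝ W) (i k) (X ω) *
    coordForm (Module.finBasis ℝ W) (j k) (Y ω)) fun k => (hX _).integrable_mul (hY _)

/-- Independence of the copies factors each monomial, so the moment is a polynomial in the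
coordinate covariances. Stationarity and continuity of covariances therefore pass to multilinear
forms. -/
theorem integral_form_mul (hX : ∀ ℓ : W →L[ℝ] ℝ, MemLp (fun ω => ℓ (X ω)) 2 P)
    (hY : ∀ ℓ : W →L[ℝ] ℝ, MemLp (fun ω => ℓ (Y ω)) 2 P) (b : Module.Basis ι ℝ W)
    (F G : W [×q]→L[ℝ] 𝕜) :
    ∫ ω : Fin q → S, F (fun k => X (ω k)) * G (fun k => Y (ω k)) ∂(Measure.pi fun _ => P) =
      ∑ i : Fin q → ι, ∑ j : Fin q → ι,
        (∏ k, ∫ ω, coordForm b (i k) (X ω) * coordForm b (j k) (Y ω) ∂P) •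
          ((F fun k => b (i k)) * (G fun k => b (j k))) := by
  have hi : ∀ i j : Fin q → ι, Integrable (fun ω : Fin q → S =>
      ∏ k, coordForm b (i k) (X (ω k)) * coordForm b (j k) (Y (ω k)))
      (Measure.pi fun _ => P) := fun i j =>
    Integrable.fintype_prod (f := fun k ω => coordForm b (i k) (X ω) *
      coordForm b (j k) (Y ω)) fun k => (hX _).integrable_mul (hY _)
  simp_rw [fun ω : Fin q → S => form_mul_form_expand b F G
    (fun k => X (ω k)) fun k => Y (ω k)]
  rw [integral_finsetSum _ fun i _ => integrable_finsetSum _ fun j _ => (hi i j).smul_const _]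
  refine Finset.sum_congr rfl fun i _ => ?_
  rw [integral_finsetSum _ fun j _ => (hi i j).smul_const _]
  refine Finset.sum_congr rfl fun j _ => ?_
  rw [integral_smul_const]
  congr 1
  exact integral_fintype_prod_eq_prod (fun k ω => coordForm b (i k) (X ω) *
    coordForm b (j k) (Y ω))

omit [FiniteDimensional ℝ W] in
theorem integral_tensorForm_mul {q : ℕ} (ℓ m : Fin q → (W →L[ℝ] 𝕜)) :
    ∫ ω : Fin q → S, tensorForm ℓ (fun k => X (ω k)) * tensorForm m (fun k => Y (ω k))
      ∂(Measure.pi fun _ => P) = ∏ k, ∫ ω, ℓ k (X ω) * m k (Y ω) ∂P := by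
  simp only [tensorForm_apply, ← Finset.prod_mul_distrib]
  exact integral_fintype_prod_eq_prod (fun k ω => ℓ k (X ω) * m k (Y ω))

end FormMoments

theorem memLp_smul_const {α E : Type*} [MeasurableSpace α] [NormedAddCommGroup E] [NormedSpace ℝ E]
    {μ : Measure α} {p : ENNReal} {g : α → ℝ} (hg : MemLp g p μ) (c : E) :
    MemLp (fun x => g x • c) p μ := by
  have := (ContinuousLinearMap.toSpanSingleton ℝ c).comp_memLp' hg
  simpa [Function.comp_def] using this

theorem memLp_sum_smul_const {α E ι : Type*} [MeasurableSpace α] [NormedAddCommGroup E]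
    [NormedSpace ℝ E] {μ : Measure α} {p : ENNReal} [Fintype ι] {g : ι → α → ℝ}
    (hg : ∀ i, MemLp (g i) p μ) (c : ι → E) : MemLp (fun x => ∑ i, g i x • c i) p μ :=
  memLp_finsetSum _ fun i _ => memLp_smul_const (hg i) _

/-! ### Hermite forms of a non-degenerate Gaussian measure -/

section GaussianHermite

variable {W : Type*} [NormedAddCommGroup W] [NormedSpace ℝ W] [FiniteDimensional ℝ W]
  [MeasurableSpace W] [BorelSpace W]

/-- A centred non-degenerate Gaussian measure. -/
structure IsCentredGaussian (η : Measure W) : Prop where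
  gaussian : IsGaussian η
  centred : ∀ ℓ : W →L[ℝ] ℝ, ∫ x, ℓ x ∂η = 0
  nondeg : ∀ ℓ : W →L[ℝ] ℝ, ℓ ≠ 0 → 0 < ∫ x, ℓ x ^ 2 ∂η

namespace IsCentredGaussian

variable {η : Measure W} (h : IsCentredGaussian η)

include h

omit [FiniteDimensional ℝ W] [BorelSpace W] in
theorem isProbabilityMeasure : IsProbabilityMeasure η := h.gaussian.toIsProbabilityMeasure

omit [FiniteDimensional ℝ W] in
theorem memLp (ℓ : W →L[ℝ] ℝ) (r : NNReal) : MemLp (fun x => ℓ x) r η := by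
  have := h.gaussian
  exact IsGaussian.memLp_dual η ℓ r (by simp)

omit [FiniteDimensional ℝ W] in
theorem memLp_two (ℓ : W →L[ℝ] ℝ) : MemLp (fun x => ℓ x) 2 η := by
  simpa only [ENNReal.coe_ofNat] using h.memLp ℓ 2

theorem integrable_smul (ℓ : W →L[ℝ] ℝ) : Integrable (fun x => ℓ x • x) η := by
  have : (fun x => ℓ x • x) = fun x => ∑ i, (ℓ x * coordForm (Module.finBasis ℝ W) i x) •
      Module.finBasis ℝ W i := by
    funext x
    conv_lhs => rw [← (Module.finBasis ℝ W).sum_repr x, Finset.smul_sum]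
    simp [coordForm, smul_smul]
  rw [this]
  exact integrable_finsetSum _ fun i _ =>
    ((h.memLp_two ℓ).integrable_mul (h.memLp_two _)).smul_const _

theorem apply_covVec (ℓ m : W →L[ℝ] ℝ) : m (covVec η ℓ) = ∫ x, ℓ x * m x ∂η := by
  rw [covVec, ← ContinuousLinearMap.integral_comp_comm _ (h.integrable_smul ℓ)]
  simp

/-- `covVec` as a linear equivalence. -/
def covEquiv : (W →L[ℝ] ℝ) ≃ₗ[ℝ] W :=
  LinearEquiv.ofInjectiveOfFinrankEq
    { toFun := covVec η
      map_add' := fun ℓ m => by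
        simp only [covVec, add_apply, add_smul]
        exact integral_add (h.integrable_smul ℓ) (h.integrable_smul m)
      map_smul' := fun c ℓ => by
        rw [covVec, covVec, RingHom.id_apply, ← integral_smul]
        simp only [smul_apply, smul_eq_mul, mul_smul] }
    (by
      -- Injectivity is non-degeneracy, because `ℓ (covVec η ℓ)` is the variance of `ℓ`.
      rw [← LinearMap.ker_eq_bot, LinearMap.ker_eq_bot']
      intro ℓ hℓ
      by_contra hne
      have h1 := h.nondeg ℓ hne
      have h2 := h.apply_covVec ℓ ℓ
      have h3 : covVec η ℓ = 0 := hℓ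
      rw [h3, map_zero] at h2
      simp only [← pow_two] at h2
      exact absurd h2 h1.ne)
    (by
      rw [← (LinearMap.toContinuousLinearMap (𝕜 := ℝ) (E := W) (F' := ℝ)).finrank_eq]
      exact Subspace.dual_finrank_eq)

theorem covEquiv_apply (ℓ : W →L[ℝ] ℝ) : h.covEquiv ℓ = covVec η ℓ := rfl

theorem covVec_surjective (w : W) : ∃ ℓ, covVec η ℓ = w := h.covEquiv.surjective w

theorem dualForm_covVec (ℓ : W →L[ℝ] ℝ) : dualForm η (covVec η ℓ) = ℓ :=
  Function.leftInverse_invFun (fun _ _ hab => h.covEquiv.injective hab) ℓ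

theorem dualForm_eq (w : W) : dualForm η w = h.covEquiv.symm w := by
  obtain ⟨ℓ, rfl⟩ := h.covVec_surjective w
  rw [h.dualForm_covVec, ← h.covEquiv_apply, LinearEquiv.symm_apply_apply]

theorem scalarProd_covVec_left (ℓ : W →L[ℝ] ℝ) (w : W) : scalarProd η (covVec η ℓ) w = ℓ w := by
  rw [scalarProd, h.dualForm_covVec]

theorem scalarProd_comm (w z : W) : scalarProd η w z = scalarProd η z w := by
  obtain ⟨ℓ, rfl⟩ := h.covVec_surjective w
  obtain ⟨m, rfl⟩ := h.covVec_surjective z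
  rw [h.scalarProd_covVec_left, h.scalarProd_covVec_left, h.apply_covVec, h.apply_covVec]
  simp only [mul_comm]

/-- `scalarProd` as a continuous bilinear map. -/
def scalarProdCLM : W →L[ℝ] W →L[ℝ] ℝ :=
  LinearMap.toContinuousLinearMap h.covEquiv.symm.toLinearMap

theorem scalarProdCLM_apply (w z : W) : h.scalarProdCLM w z = scalarProd η w z := by
  rw [scalarProd, h.dualForm_eq]; rfl

theorem contDiff_gaussian (n : WithTop ℕ∞) :
    ContDiff ℝ n fun y : W => Real.exp (-(scalarProd η y y) / 2) := by
  simp only [← h.scalarProdCLM_apply]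
  have : ContDiff ℝ n fun y : W => h.scalarProdCLM y y :=
    h.scalarProdCLM.contDiff.clm_apply contDiff_id
  exact (this.neg.div_const 2).exp

theorem hermiteForm_symm (q : ℕ) (x : W) (σ : Equiv.Perm (Fin q)) (w : Fin q → W) :
    hermiteForm η q x (w ∘ σ) = hermiteForm η q x w := by
  simp only [hermiteForm, smul_apply]
  rw [(h.contDiff_gaussian _).contDiffAt.iteratedFDeriv_comp_perm]

omit h in
theorem _root_.iteratedFDeriv_diagonal {E F : Type*} [NormedAddCommGroup E] [NormedSpace ℝ E]
    [NormedAddCommGroup F] [NormedSpace ℝ F] {g : E → F} {q : ℕ} (hg : ContDiff ℝ q g) (x w : E) :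
    iteratedFDeriv ℝ q g x (fun _ => w) = iteratedDeriv q (fun t : ℝ => g (x + t • w)) 0 := by
  have hg' : ContDiff ℝ q fun z => g (z + x) := hg.comp (contDiff_id.add contDiff_const)
  have h1 := (ContinuousLinearMap.toSpanSingleton ℝ w).iteratedFDeriv_comp_right hg' 0 (i := q)
    le_rfl
  have h2 : (fun z => g (z + x)) ∘ (ContinuousLinearMap.toSpanSingleton ℝ w) =
      fun t : ℝ => g (x + t • w) := by
    funext t
    simp [add_comm]
  rw [h2] at h1
  rw [iteratedDeriv_eq_iteratedFDeriv, h1, iteratedFDeriv_comp_add_right]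
  simp

-- The recursion of `hermitePoly` is the product rule for this exponential. In the application `α =
-- ‖x‖²`, `u = ⟨x, w⟩` and `a = ‖w‖²`, so the exponent is `-‖x + t w‖²/2`.
omit h in
theorem _root_.iteratedDeriv_exp_quadratic (α u a : ℝ) (q : ℕ) :
    iteratedDeriv q (fun t : ℝ => Real.exp (-(α + 2 * t * u + t ^ 2 * a) / 2)) =
      fun t => (-1) ^ q * ((hermitePoly a q).eval (u + t * a) *
        Real.exp (-(α + 2 * t * u + t ^ 2 * a) / 2)) := by
  induction q with
  | zero => simp [hermitePoly]
  | succ q ih =>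
    rw [iteratedDeriv_succ, ih]
    funext t
    have h1 : HasDerivAt (fun t : ℝ => -(α + 2 * t * u + t ^ 2 * a) / 2) (-(u + t * a)) t := by
      have := (((((hasDerivAt_id t).const_mul 2).mul_const u).const_add α).add
        (((hasDerivAt_id t).pow 2).mul_const a)).neg.div_const 2
      refine this.congr_deriv ?_
      simp; ring
    have h2 : HasDerivAt (fun t : ℝ => (hermitePoly a q).eval (u + t * a))
        ((Polynomial.derivative (hermitePoly a q)).eval (u + t * a) * a) t := by
      have h3 : HasDerivAt (fun t : ℝ => u + t * a) a t := by
        simpa using ((hasDerivAt_id t).mul_const a).const_add u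
      exact ((hermitePoly a q).hasDerivAt _).comp t h3
    refine (((h2.mul h1.exp).const_mul ((-1 : ℝ) ^ q)).deriv).trans ?_
    rw [hermitePoly]
    simp only [Polynomial.eval_sub, Polynomial.eval_mul, Polynomial.eval_X, Polynomial.eval_C]
    ring

/-- Differentiate the Gaussian along the line through `x` directed by the vector dual to `ℓ`; at `t
= 0` the signs and the exponential prefactors cancel. -/
theorem hermiteForm_diagonal (q : ℕ) (x : W) (ℓ : W →L[ℝ] ℝ) :
    hermiteForm η q x (fun _ => covVec η ℓ) =
      (hermitePoly (∫ y, ℓ y ^ 2 ∂η) q).eval (ℓ x) := by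
  simp only [hermiteForm, smul_apply]
  rw [iteratedFDeriv_diagonal (h.contDiff_gaussian q)]
  have h1 : ∀ t : ℝ, scalarProd η (x + t • covVec η ℓ) (x + t • covVec η ℓ) =
      scalarProd η x x + 2 * t * ℓ x + t ^ 2 * ∫ y, ℓ y ^ 2 ∂η := by
    intro t
    have h2 : scalarProd η (covVec η ℓ) (covVec η ℓ) = ∫ y, ℓ y ^ 2 ∂η := by
      rw [h.scalarProd_covVec_left, h.apply_covVec]; simp only [pow_two]
    rw [← h2, ← h.scalarProd_covVec_left ℓ x, ← h.scalarProdCLM_apply, ← h.scalarProdCLM_apply,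
      ← h.scalarProdCLM_apply, ← h.scalarProdCLM_apply]
    have h3 : h.scalarProdCLM x (covVec η ℓ) = h.scalarProdCLM (covVec η ℓ) x := by
      rw [h.scalarProdCLM_apply, h.scalarProd_comm, h.scalarProdCLM_apply]
    simp only [map_add, map_smul, add_apply, smul_apply, smul_eq_mul, h3]
    ring
  simp only [h1]
  rw [iteratedDeriv_exp_quadratic]
  simp only [smul_eq_mul, zero_mul, mul_zero, add_zero, ne_eq, OfNat.ofNat_ne_zero,
    not_false_eq_true, zero_pow]
  have h4 : Real.exp (scalarProd η x x / 2) * Real.exp (-(scalarProd η x x) / 2) = 1 := by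
    rw [← Real.exp_add]; simp; ring
  have h5 : ((-1 : ℝ) ^ q) * (-1) ^ q = 1 := by rw [← mul_pow]; simp
  linear_combination ((hermitePoly (∫ y, ℓ y ^ 2 ∂η) q).eval (ℓ x)) * h5 * 1 +
    ((hermitePoly (∫ y, ℓ y ^ 2 ∂η) q).eval (ℓ x)) * ((-1 : ℝ) ^ q) * (-1) ^ q * h4

theorem memLp_hermiteForm_diagonal (q : ℕ) (w : W) :
    MemLp (fun x => hermiteForm η q x fun _ => w) 2 η := by
  have := h.isProbabilityMeasure
  obtain ⟨ℓ, rfl⟩ := h.covVec_surjective w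
  simp only [h.hermiteForm_diagonal]
  exact memLp_two_polynomial_eval (h.memLp ℓ) _

/-- Polarization of a symmetric form. Integrability, known on the diagonal through Hermite
polynomials, extends by it to all arguments. -/
theorem hermiteForm_eq_sum_diagonal (q : ℕ) (x : W) (w : Fin q → W) :
    hermiteForm η q x w = (q.factorial : ℝ)⁻¹ * ∑ B : Finset (Fin q),
      (-1 : ℝ) ^ B.card * hermiteForm η q x fun _ => ∑ i ∈ Bᶜ, w i := by
  have h3 := MultilinearMap.sum_perm_eq_sum_diagonal (hermiteForm η q x).toMultilinearMap w
  have h4 : ∀ σ : Equiv.Perm (Fin q), (hermiteForm η q x).toMultilinearMap (w ∘ σ) =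
    hermiteForm η q x w := fun σ => h.hermiteForm_symm q x σ w
  simp only [h4, Finset.sum_const, Finset.card_univ, Fintype.card_perm, Fintype.card_fin,
    nsmul_eq_mul, zsmul_eq_mul] at h3
  rw [eq_inv_mul_iff_mul_eq₀ (by positivity), h3]
  simp

theorem memLp_hermiteForm_apply (q : ℕ) (w : Fin q → W) :
    MemLp (fun x => hermiteForm η q x w) 2 η := by
  simp only [h.hermiteForm_eq_sum_diagonal q _ w]
  exact (memLp_finsetSum _ fun B _ => (h.memLp_hermiteForm_diagonal q _).const_mul _).const_mul _

omit h [BorelSpace W] in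
theorem _root_.memLp_form_of_apply {q : ℕ} {H : W → W [×q]→L[ℝ] ℝ}
    (hH : ∀ w, MemLp (fun x => H x w) 2 η) : MemLp H 2 η := by
  have h1 : (fun x => ∑ i : Fin q → Fin (Module.finrank ℝ W),
      (fun (i : Fin q → Fin (Module.finrank ℝ W)) x =>
        H x fun k => Module.finBasis ℝ W (i k)) i x •
      (fun i : Fin q → Fin (Module.finrank ℝ W) =>
        (tensorForm fun k => coordForm (Module.finBasis ℝ W) (i k) : W [×q]→L[ℝ] ℝ)) i) = H := by
    funext x
    exact (form_eq_sum_tensorForm (Module.finBasis ℝ W) (H x)).symm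
  exact h1 ▸ memLp_sum_smul_const (fun i => hH _) _

theorem memLp_hermiteForm (q : ℕ) : MemLp (hermiteForm η q) 2 η :=
  memLp_form_of_apply (h.memLp_hermiteForm_apply q)

theorem integrable_formInner {q : ℕ} (F G : W [×q]→L[ℝ] ℝ) :
    Integrable (fun y : Fin q → W => F y * G y) (Measure.pi fun _ => η) :=
  have := h.isProbabilityMeasure
  integrable_form_mul (X := id) (Y := id) h.memLp_two h.memLp_two F G

/-- `formInner` as a bilinear map. -/
def formInnerBilin (q : ℕ) : (W [×q]→L[ℝ] ℝ) →ₗ[ℝ] (W [×q]→L[ℝ] ℝ) →ₗ[ℝ] ℝ :=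
  LinearMap.mk₂ ℝ (formInner η)
    (fun F F' G => by
      simp only [formInner, add_apply, add_mul]
      exact integral_add (h.integrable_formInner F G) (h.integrable_formInner F' G))
    (fun c F G => by
      simp only [formInner, smul_apply, smul_eq_mul, mul_assoc]
      exact integral_const_mul c _)
    (fun F G G' => by
      simp only [formInner, add_apply, mul_add]
      exact integral_add (h.integrable_formInner F G) (h.integrable_formInner F G'))
    (fun c F G => by
      simp only [formInner, smul_apply, smul_eq_mul, mul_left_comm _ c]
      exact integral_const_mul c _)

theorem formInnerBilin_apply {q : ℕ} (F G : W [×q]→L[ℝ] ℝ) :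
    h.formInnerBilin q F G = formInner η F G := rfl

/-- Expand `G` in coordinate tensors: every slot contributes `E[ℓ m] = m (covVec η ℓ)`, so the
pairing is an evaluation. -/
theorem formInner_tensorForm_const {q : ℕ} (ℓ : W →L[ℝ] ℝ) (G : W [×q]→L[ℝ] ℝ) :
    formInner η (tensorForm fun _ => ℓ) G = G fun _ => covVec η ℓ := by
  have := h.isProbabilityMeasure
  conv_lhs => rw [form_eq_sum_tensorForm (Module.finBasis ℝ W) G, ← h.formInnerBilin_apply, map_sum]
  rw [form_expand (Module.finBasis ℝ W) G]
  refine Finset.sum_congr rfl fun i _ => ?_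
  rw [map_smul, h.formInnerBilin_apply, formInner_tensor, smul_eq_mul, smul_eq_mul, mul_comm]
  simp only [h.apply_covVec]

theorem formInner_power_hermiteForm (q : ℕ) (ℓ : W →L[ℝ] ℝ) (x : W) :
    formInner η (tensorForm fun _ => ℓ) (hermiteForm η q x) =
      (hermitePoly (∫ y, ℓ y ^ 2 ∂η) q).eval (ℓ x) := by
  rw [h.formInner_tensorForm_const, h.hermiteForm_diagonal]

end IsCentredGaussian

end GaussianHermite

/-! ### Characters separate integrable functions -/

section CharacterDensity

variable {W : Type*} [NormedAddCommGroup W] [NormedSpace ℝ W] [FiniteDimensional ℝ W]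
  [MeasurableSpace W] [BorelSpace W]

/-- An integrable function is determined by the integrals of the characters against it. -/
theorem ae_eq_zero_of_integral_exp_eq_zero {η : Measure W} [IsFiniteMeasure η] {g : W → ℝ}
    (hg : Integrable g η)
    (h : ∀ ℓ : W →L[ℝ] ℝ, ∫ x, (g x : ℂ) * Complex.exp ((ℓ x : ℝ) * Complex.I) ∂η = 0) :
    g =ᵐ[η] 0 := by
  have : SecondCountableTopology W := by
    have := FiniteDimensional.proper ℝ W
    infer_instance
  have : CompleteSpace W := FiniteDimensional.complete ℝ W
  have hfin : ∀ g : W → ℝ, Integrable g η →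
      ∫⁻ x, ENNReal.ofReal (g x) ∂η ≠ ⊤ := fun g hg => hg.lintegral_lt_top.ne
  have h1 : IsFiniteMeasure (η.withDensity fun x => ENNReal.ofReal (g x)) :=
    isFiniteMeasure_withDensity (hfin _ hg)
  have h2 : IsFiniteMeasure (η.withDensity fun x => ENNReal.ofReal (-g x)) :=
    isFiniteMeasure_withDensity (hfin _ hg.neg)
  have hval : ∀ (g : W → ℝ), Integrable g η → ∀ ℓ : W →L[ℝ] ℝ,
      charFunDual (η.withDensity fun x => ENNReal.ofReal (g x)) ℓ =
        ∫ x, ((max (g x) 0 : ℝ) : ℂ) * Complex.exp ((ℓ x : ℝ) * Complex.I) ∂η := by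
    intro g hg ℓ
    rw [charFunDual_apply, integral_withDensity_eq_integral_toReal_smul₀
      hg.aemeasurable.ennreal_ofReal (Filter.Eventually.of_forall fun x => by simp)]
    refine integral_congr_ae (Filter.Eventually.of_forall fun x => ?_)
    simp [ENNReal.toReal_ofReal']
  have hint : ∀ (g : W → ℝ), Integrable g η → ∀ ℓ : W →L[ℝ] ℝ, Integrable
      (fun x => ((max (g x) 0 : ℝ) : ℂ) * Complex.exp ((ℓ x : ℝ) * Complex.I)) η := by
    intro g hg ℓ
    refine (hg.pos_part.ofReal (𝕜 := ℂ)).mul_bdd (c := 1) (by fun_prop)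
      (Filter.Eventually.of_forall fun x => ?_)
    rw [Complex.norm_exp_ofReal_mul_I]
  -- The measures with densities the positive and negative parts of `g` have the same characteristic
  -- function, hence coincide.
  have heq : (η.withDensity fun x => ENNReal.ofReal (g x)) =
      η.withDensity fun x => ENNReal.ofReal (-g x) := by
    refine Measure.ext_of_charFunDual ?_
    funext ℓ
    rw [hval g hg, hval (fun x => -g x) hg.neg, ← sub_eq_zero,
      ← integral_sub (hint g hg ℓ) (hint (fun x => -g x) hg.neg ℓ), ← h ℓ]
    refine integral_congr_ae (Filter.Eventually.of_forall fun x => ?_)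
    simp only
    rw [← sub_mul, ← Complex.ofReal_sub]
    congr 2
    rcases le_total (g x) 0 with hx | hx
    · rw [max_eq_right hx, max_eq_left (by linarith)]; ring
    · rw [max_eq_left hx, max_eq_right (by linarith)]; ring
  have hae := (withDensity_eq_iff (g := fun x => ENNReal.ofReal (-g x))
    hg.aemeasurable.ennreal_ofReal hg.neg.aemeasurable.ennreal_ofReal (hfin _ hg)).1 heq
  filter_upwards [hae] with x hx
  simp only [Pi.zero_apply]
  rcases le_total (g x) 0 with h0 | h0
  · rw [ENNReal.ofReal_of_nonpos h0] at hx
    have := ENNReal.ofReal_eq_zero.1 hx.symm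
    linarith
  · rw [ENNReal.ofReal_of_nonpos (by linarith : -g x ≤ 0)] at hx
    have := ENNReal.ofReal_eq_zero.1 hx
    linarith

end CharacterDensity

/-! ### Completeness and covariances of the chaoses -/

section Chaos

variable {W : Type*} [NormedAddCommGroup W] [NormedSpace ℝ W] [FiniteDimensional ℝ W]
  [MeasurableSpace W] [BorelSpace W]

namespace IsCentredGaussian

variable {η : Measure W} (h : IsCentredGaussian η)

include h

-- Exponential moments of a Gaussian variable supply the dominating function for the power series of
-- the characters in the completeness proof.
omit [FiniteDimensional ℝ W] in
theorem memLp_exp_abs (ℓ : W →L[ℝ] ℝ) : MemLp (fun x => Real.exp |ℓ x|) 2 η := by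
  have := h.gaussian
  have h1 : ∀ t : ℝ, Integrable (fun x => Real.exp (t * ℓ x)) η := by
    intro t
    have h2 : Integrable (fun y : ℝ => Real.exp (t * y)) (η.map ℓ) := by
      rw [IsGaussian.map_eq_gaussianReal ℓ]
      exact integrable_exp_mul_gaussianReal t
    exact (integrable_map_measure (g := fun y : ℝ => Real.exp (t * y)) (by fun_prop)
      (by fun_prop)).1 h2
  rw [memLp_two_iff_integrable_sq (by fun_prop)]
  have h3 : ∀ x, Real.exp |ℓ x| ^ 2 = Real.exp (2 * |ℓ x|) := by
    intro x; rw [← Real.exp_nat_mul]; norm_num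
  simp only [h3]
  exact integrable_exp_mul_abs (h1 2) (h1 (-2))

/-- Completeness of the Hermite polynomials. -/
theorem ae_eq_zero_of_orthogonal_hermitePoly {g : W → ℝ} (hg : MemLp g 2 η)
    (horth : ∀ (q : ℕ) (ℓ : W →L[ℝ] ℝ),
      ∫ x, g x * (hermitePoly (∫ y, ℓ y ^ 2 ∂η) q).eval (ℓ x) ∂η = 0) : g =ᵐ[η] 0 := by
  have := h.isProbabilityMeasure
  refine ae_eq_zero_of_integral_exp_eq_zero (hg.integrable (by norm_num)) fun ℓ => ?_
  have hint : ∀ p : Polynomial ℝ, Integrable (fun x => g x * p.eval (ℓ x)) η := fun p =>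
    hg.integrable_mul (memLp_two_polynomial_eval (h.memLp ℓ) p)
  have hpoly : ∀ p ∈ Submodule.span ℝ (Set.range (hermitePoly (∫ y, ℓ y ^ 2 ∂η))),
      ∫ x, g x * p.eval (ℓ x) ∂η = 0 := by
    intro p hp
    induction hp using Submodule.span_induction with
    | mem x hx => obtain ⟨k, rfl⟩ := hx; exact horth k ℓ
    | zero => simp
    | add x y _ _ hx hy =>
      simp only [Polynomial.eval_add, mul_add]
      rw [integral_add (hint x) (hint y), hx, hy, add_zero]
    | smul c x _ hx =>
      simp only [Polynomial.eval_smul, smul_eq_mul, mul_left_comm _ c]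
      rw [integral_const_mul, hx, mul_zero]
  have hpow : ∀ n : ℕ, ∫ x, g x * ℓ x ^ n ∂η = 0 := by
    intro n
    simpa using hpoly _ (X_pow_mem_span_hermitePoly _ n)
  -- The exponential series is integrated against `g` term by term. Its partial sums are dominated
  -- by `|g| exp |ℓ|`, integrable by Cauchy-Schwarz, and each term is a vanishing moment.
  have hsum := hasSum_integral_of_dominated_convergence (μ := η)
    (F := fun (n : ℕ) x => (g x : ℂ) * (((ℓ x : ℝ) * Complex.I) ^ n / (n.factorial : ℂ)))
    (f := fun x => (g x : ℂ) * Complex.exp ((ℓ x : ℝ) * Complex.I))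
    (fun n x => |g x| * (|ℓ x| ^ n / n.factorial)) ?_ ?_ ?_ ?_ ?_
  · refine hsum.unique ?_
    convert! hasSum_zero with n
    have h2 : ∀ x, (g x : ℂ) * (((ℓ x : ℝ) * Complex.I) ^ n / (n.factorial : ℂ)) =
        (Complex.I ^ n / (n.factorial : ℂ)) * ((g x * ℓ x ^ n : ℝ) : ℂ) := by
      intro x; push_cast; ring
    simp only [h2]
    rw [integral_const_mul, integral_complex_ofReal, hpow]
    simp
  · intro n
    have h1 : AEStronglyMeasurable (fun x => (g x : ℂ)) η :=
      Complex.continuous_ofReal.comp_aestronglyMeasurable hg.aestronglyMeasurable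
    exact h1.mul (by fun_prop)
  · intro n
    refine Filter.Eventually.of_forall fun x => ?_
    simp
  · refine Filter.Eventually.of_forall fun x => ?_
    exact (Real.summable_pow_div_factorial _).mul_left _
  · have h2 : ∀ x, ∑' n : ℕ, |g x| * (|ℓ x| ^ n / n.factorial) = |g x| * Real.exp |ℓ x| := by
      intro x
      rw [tsum_mul_left, Real.exp_eq_exp_ℝ, NormedSpace.exp_eq_tsum_div]
    simp only [h2]
    exact hg.abs.integrable_mul (h.memLp_exp_abs ℓ)
  · refine Filter.Eventually.of_forall fun x => ?_
    refine HasSum.mul_left _ ?_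
    rw [Complex.exp_eq_exp_ℂ]
    exact NormedSpace.expSeries_div_hasSum_exp _

theorem memLp_formInner_hermiteForm {q : ℕ} {F : W [×q]→L[ℝ] ℝ} (hF : F ∈ powerSpan W q) :
    MemLp (fun x => formInner η F (hermiteForm η q x)) 2 η := by
  have := h.isProbabilityMeasure
  induction hF using Submodule.span_induction with
  | mem F hF =>
    obtain ⟨ℓ, rfl⟩ := hF
    simp only [h.formInner_power_hermiteForm]
    exact memLp_two_polynomial_eval (h.memLp ℓ) _
  | zero => simp [← h.formInnerBilin_apply]
  | add F G _ _ hF hG =>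
    simp only [← h.formInnerBilin_apply, map_add, LinearMap.add_apply] at hF hG ⊢
    exact hF.add hG
  | smul c F _ hF =>
    simp only [← h.formInnerBilin_apply, map_smul, LinearMap.smul_apply, smul_eq_mul] at hF ⊢
    exact hF.const_mul c

variable {f : W → ℝ}

theorem integrable_smul_hermiteForm (hf : MemLp f 2 η) (q : ℕ) :
    Integrable (fun x => f x • hermiteForm η q x) η :=
  memLp_one_iff_integrable.1 ((h.memLp_hermiteForm q).smul hf)

theorem chaosCoeff_apply (hf : MemLp f 2 η) (q : ℕ) (w : Fin q → W) :
    chaosCoeff η f q w = ∫ x, f x * hermiteForm η q x w ∂η := by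
  have h1 := (ContinuousMultilinearMap.apply ℝ (fun _ : Fin q => W) ℝ w).integral_comp_comm
    (h.integrable_smul_hermiteForm hf q)
  rw [chaosCoeff]
  refine (h1.symm.trans ?_ : _)
  rfl

/-- Symmetry of the Hermite forms survives integration. Identities linear in the coefficient then
need checking on powers of linear forms only. -/
theorem chaosCoeff_mem_powerSpan (hf : MemLp f 2 η) (q : ℕ) :
    chaosCoeff η f q ∈ powerSpan W q := by
  refine mem_powerSpan_of_symmetric _ fun σ w => ?_
  simp only [h.chaosCoeff_apply hf, h.hermiteForm_symm]

theorem memLp_chaosProj (hf : MemLp f 2 η) (q : ℕ) : MemLp (chaosProj η f q) 2 η :=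
  (h.memLp_formInner_hermiteForm (h.chaosCoeff_mem_powerSpan hf q)).const_mul _

/-- For a power of a linear form the pairing is evaluation at a vector, which commutes with the
integral defining the coefficient. -/
theorem formInner_chaosCoeff (hf : MemLp f 2 η) {q : ℕ} {G : W [×q]→L[ℝ] ℝ}
    (hG : G ∈ powerSpan W q) :
    formInner η G (chaosCoeff η f q) = ∫ x, f x * formInner η G (hermiteForm η q x) ∂η := by
  induction hG using Submodule.span_induction with
  | mem F hF =>
    obtain ⟨ℓ, rfl⟩ := hF
    simp only [h.formInner_tensorForm_const, h.chaosCoeff_apply hf]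
  | zero => simp [← h.formInnerBilin_apply]
  | add F G hF' hG' hF hG =>
    simp only [← h.formInnerBilin_apply, map_add, LinearMap.add_apply, mul_add] at hF hG ⊢
    rw [hF, hG, integral_add]
    · exact hf.integrable_mul (h.memLp_formInner_hermiteForm hF')
    · exact hf.integrable_mul (h.memLp_formInner_hermiteForm hG')
  | smul c F _ hF =>
    simp only [← h.formInnerBilin_apply, map_smul, LinearMap.smul_apply, smul_eq_mul,
      mul_left_comm _ c] at hF ⊢
    rw [hF, integral_const_mul]

variable {S : Type*} [MeasurableSpace S] {P : Measure S} {X Y : S → W}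

/-- Both sides are bilinear, so agreement on powers of linear forms suffices. The target `T` is left
free in order to serve both the orthogonality of distinct orders and the covariance within one
order. -/
theorem integral_formInner_hermiteForm_mul
    (hX : MeasurePreserving X P η) (hY : MeasurePreserving Y P η) {p q : ℕ}
    (T : (W [×p]→L[ℝ] ℝ) →ₗ[ℝ] (W [×q]→L[ℝ] ℝ) →ₗ[ℝ] ℝ)
    (hT : ∀ ℓ m : W →L[ℝ] ℝ, ∫ ω, (hermitePoly (∫ y, ℓ y ^ 2 ∂η) p).eval (ℓ (X ω)) *
      (hermitePoly (∫ y, m y ^ 2 ∂η) q).eval (m (Y ω)) ∂P =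
        T (tensorForm fun _ => ℓ) (tensorForm fun _ => m))
    {F : W [×p]→L[ℝ] ℝ} (hF : F ∈ powerSpan W p) {G : W [×q]→L[ℝ] ℝ} (hG : G ∈ powerSpan W q) :
    ∫ ω, formInner η F (hermiteForm η p (X ω)) * formInner η G (hermiteForm η q (Y ω)) ∂P =
      T F G := by
  have hint : ∀ {F : W [×p]→L[ℝ] ℝ} (_ : F ∈ powerSpan W p) {G : W [×q]→L[ℝ] ℝ}
      (_ : G ∈ powerSpan W q), Integrable (fun ω => formInner η F (hermiteForm η p (X ω)) *
        formInner η G (hermiteForm η q (Y ω))) P := fun hF _ hG =>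
    ((h.memLp_formInner_hermiteForm hF).comp_measurePreserving hX).integrable_mul
      ((h.memLp_formInner_hermiteForm hG).comp_measurePreserving hY)
  induction hF using Submodule.span_induction with
  | mem F hF =>
    obtain ⟨ℓ, rfl⟩ := hF
    have hℓ := tensorForm_const_mem_powerSpan (q := p) ℓ
    induction hG using Submodule.span_induction with
    | mem G hG =>
      obtain ⟨m, rfl⟩ := hG
      simp only [h.formInner_power_hermiteForm]
      exact hT ℓ m
    | zero => simp [← h.formInnerBilin_apply]
    | add G G' hG hG' h1 h2 =>
      have i1 := hint hℓ hG
      have i2 := hint hℓ hG'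
      simp only [← h.formInnerBilin_apply, map_add, LinearMap.add_apply, mul_add]
        at h1 h2 i1 i2 ⊢
      rw [integral_add i1 i2, h1, h2]
    | smul c G _ h1 =>
      simp only [← h.formInnerBilin_apply, map_smul, LinearMap.smul_apply, smul_eq_mul,
        mul_left_comm _ c] at h1 ⊢
      rw [integral_const_mul, h1]
  | zero => simp [← h.formInnerBilin_apply]
  | add F F' hF hF' h1 h2 =>
    have i1 := hint hF hG
    have i2 := hint hF' hG
    simp only [← h.formInnerBilin_apply, map_add, LinearMap.add_apply, add_mul] at h1 h2 i1 i2 ⊢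
    rw [integral_add i1 i2, h1, h2]
  | smul c F _ h1 =>
    simp only [← h.formInnerBilin_apply, map_smul, LinearMap.smul_apply, smul_eq_mul,
      mul_assoc c] at h1 ⊢
    rw [integral_const_mul, h1]

theorem integral_hermitePoly_mul (hXY : HasGaussianLaw (fun ω => (X ω, Y ω)) P)
    (hX : MeasurePreserving X P η) (hY : MeasurePreserving Y P η) (p q : ℕ) (ℓ m : W →L[ℝ] ℝ) :
    ∫ ω, (hermitePoly (∫ y, ℓ y ^ 2 ∂η) p).eval (ℓ (X ω)) *
      (hermitePoly (∫ y, m y ^ 2 ∂η) q).eval (m (Y ω)) ∂P =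
      if p = q then q.factorial * (∫ ω, ℓ (X ω) * m (Y ω) ∂P) ^ q else 0 := by
  have hlaw : HasGaussianLaw (fun ω => (ℓ (X ω), m (Y ω))) P := by
    simpa using hXY.map_fun (ℓ.prodMap m)
  have hsq : ∀ {Z : S → W}, MeasurePreserving Z P η → ∀ ℓ : W →L[ℝ] ℝ,
      ∫ y, ℓ y ^ 2 ∂η = ∫ ω, ℓ (Z ω) ^ 2 ∂P := by
    intro Z hZ ℓ
    rw [← hZ.map_eq, integral_map hZ.measurable.aemeasurable
      (Continuous.aestronglyMeasurable (by fun_prop))]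
  have hmean : ∀ {Z : S → W}, MeasurePreserving Z P η → ∀ ℓ : W →L[ℝ] ℝ,
      ∫ ω, ℓ (Z ω) ∂P = 0 := by
    intro Z hZ ℓ
    rw [← h.centred ℓ, ← hZ.map_eq, integral_map hZ.measurable.aemeasurable
      (Continuous.aestronglyMeasurable (by fun_prop))]
  rw [hsq hX ℓ, hsq hY m]
  exact hlaw.integral_hermitePoly_mul (hmean hX ℓ) (hmean hY m) p q

/-- Chaoses of different orders are uncorrelated. -/
theorem integral_chaos_mul_of_ne (hXY : HasGaussianLaw (fun ω => (X ω, Y ω)) P)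
    (hX : MeasurePreserving X P η) (hY : MeasurePreserving Y P η) {p q : ℕ} (hpq : p ≠ q)
    {F : W [×p]→L[ℝ] ℝ} (hF : F ∈ powerSpan W p) {G : W [×q]→L[ℝ] ℝ} (hG : G ∈ powerSpan W q) :
    ∫ ω, formInner η F (hermiteForm η p (X ω)) * formInner η G (hermiteForm η q (Y ω)) ∂P =
      0 := by
  refine h.integral_formInner_hermiteForm_mul hX hY 0 (fun ℓ m => ?_) hF hG
  rw [h.integral_hermitePoly_mul hXY hX hY, if_neg hpq]
  simp

/-- The covariance of two elements of the same chaos. -/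
theorem integral_chaos_mul (hXY : HasGaussianLaw (fun ω => (X ω, Y ω)) P)
    (hX : MeasurePreserving X P η) (hY : MeasurePreserving Y P η) {q : ℕ}
    {F : W [×q]→L[ℝ] ℝ} (hF : F ∈ powerSpan W q) {G : W [×q]→L[ℝ] ℝ} (hG : G ∈ powerSpan W q) :
    ∫ ω, formInner η F (hermiteForm η q (X ω)) * formInner η G (hermiteForm η q (Y ω)) ∂P =
      q.factorial * ∫ ω : Fin q → S, F (fun k => X (ω k)) * G (fun k => Y (ω k))
        ∂(Measure.pi fun _ => P) := by
  have hP := hXY.isProbabilityMeasure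
  have mX : ∀ ℓ : W →L[ℝ] ℝ, MemLp (fun ω => ℓ (X ω)) 2 P := fun ℓ =>
    (h.memLp_two ℓ).comp_measurePreserving hX
  have mY : ∀ ℓ : W →L[ℝ] ℝ, MemLp (fun ω => ℓ (Y ω)) 2 P := fun ℓ =>
    (h.memLp_two ℓ).comp_measurePreserving hY
  let T : (W [×q]→L[ℝ] ℝ) →ₗ[ℝ] (W [×q]→L[ℝ] ℝ) →ₗ[ℝ] ℝ :=
    LinearMap.mk₂ ℝ (fun F G => ∫ ω : Fin q → S, F (fun k => X (ω k)) * G (fun k => Y (ω k))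
        ∂(Measure.pi fun _ => P))
    (fun F F' G => by
      simp only [add_apply, add_mul]
      exact integral_add (integrable_form_mul mX mY F G) (integrable_form_mul mX mY F' G))
    (fun c F G => by
      simp only [smul_apply, smul_eq_mul, mul_assoc]
      exact integral_const_mul c _)
    (fun F G G' => by
      simp only [add_apply, mul_add]
      exact integral_add (integrable_form_mul mX mY F G) (integrable_form_mul mX mY F G'))
    (fun c F G => by
      simp only [smul_apply, smul_eq_mul, mul_left_comm _ c]
      exact integral_const_mul c _)
  have h1 := h.integral_formInner_hermiteForm_mul hX hY ((q.factorial : ℝ) • T)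
    (fun ℓ m => ?_) hF hG
  · rw [h1]; simp [T]
  rw [h.integral_hermitePoly_mul hXY hX hY, if_pos rfl]
  simp only [LinearMap.smul_apply, T, LinearMap.mk₂_apply, smul_eq_mul]
  -- On powers, the moment over `q` independent copies is the `q`-th power of `E[ℓ(X) m(Y)]`, as in
  -- the Hermite covariance.
  rw [integral_tensorForm_mul]
  simp

theorem integral_chaosProj_mul (hXY : HasGaussianLaw (fun ω => (X ω, Y ω)) P)
    (hX : MeasurePreserving X P η) (hY : MeasurePreserving Y P η) (hf : MemLp f 2 η) (q : ℕ) :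
    ∫ ω, chaosProj η f q (X ω) * chaosProj η f q (Y ω) ∂P =
      (1 / (q.factorial : ℝ)) * ∫ ω : Fin q → S, chaosCoeff η f q (fun k => X (ω k)) *
        chaosCoeff η f q (fun k => Y (ω k)) ∂(Measure.pi fun _ => P) := by
  have h1 := h.integral_chaos_mul hXY hX hY (h.chaosCoeff_mem_powerSpan hf q)
    (h.chaosCoeff_mem_powerSpan hf q)
  simp only [chaosProj, mul_mul_mul_comm _ (formInner _ _ _)]
  rw [integral_const_mul, h1]
  field_simp

theorem integral_chaosProj_mul_of_ne (hXY : HasGaussianLaw (fun ω => (X ω, Y ω)) P)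
    (hX : MeasurePreserving X P η) (hY : MeasurePreserving Y P η) (hf : MemLp f 2 η) {p q : ℕ}
    (hpq : p ≠ q) : ∫ ω, chaosProj η f p (X ω) * chaosProj η f q (Y ω) ∂P = 0 := by
  have h1 := h.integral_chaos_mul_of_ne hXY hX hY hpq (h.chaosCoeff_mem_powerSpan hf p)
    (h.chaosCoeff_mem_powerSpan hf q)
  simp only [chaosProj, mul_mul_mul_comm _ (formInner _ _ _)]
  rw [integral_const_mul, h1, mul_zero]

end IsCentredGaussian

end Chaos

/-! ### The chaos expansion in `L²` -/

section ChaosExpansion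

theorem inner_toLp {α : Type*} [MeasurableSpace α] {μ : Measure α} {f g : α → ℝ}
    (hf : MemLp f 2 μ) (hg : MemLp g 2 μ) :
    inner ℝ (hf.toLp f) (hg.toLp g) = ∫ x, f x * g x ∂μ := by
  rw [L2.inner_def]
  refine integral_congr_ae ?_
  filter_upwards [hf.coeFn_toLp, hg.coeFn_toLp] with x h1 h2
  rw [h1, h2]
  simp [mul_comm]

/-- By `2|ab| ≤ a² + b²` and equality of the marginals. The bound does not depend on the joint law,
hence is uniform over pairs of points of the field. -/
theorem integral_abs_comp_mul_comp_le {α S : Type*} [MeasurableSpace α] [MeasurableSpace S]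
    {η : Measure α} {P : Measure S} {X Y : S → α} (hX : MeasurePreserving X P η)
    (hY : MeasurePreserving Y P η) {g : α → ℝ} (hg : MemLp g 2 η) :
    ∫ ω, |g (X ω) * g (Y ω)| ∂P ≤ ∫ x, g x * g x ∂η := by
  have hm : ∀ {Z : S → α}, MeasurePreserving Z P η → MemLp (fun ω => g (Z ω)) 2 P := fun hZ =>
    hg.comp_measurePreserving hZ
  have hsq : ∀ {Z : S → α}, MeasurePreserving Z P η →
      ∫ ω, g (Z ω) * g (Z ω) ∂P = ∫ x, g x * g x ∂η := by
    intro Z hZ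
    rw [← hZ.map_eq, integral_map hZ.measurable.aemeasurable]
    rw [hZ.map_eq]
    exact hg.aestronglyMeasurable.mul hg.aestronglyMeasurable
  have hi : ∀ {Z : S → α}, MeasurePreserving Z P η →
      Integrable (fun ω => g (Z ω) * g (Z ω)) P := fun hZ => (hm hZ).integrable_mul (hm hZ)
  have h1 : ∫ x, g x * g x ∂η =
      ∫ ω, (g (X ω) * g (X ω) + g (Y ω) * g (Y ω)) / 2 ∂P := by
    rw [integral_div, integral_add (hi hX) (hi hY), hsq hX, hsq hY]
    ring
  rw [h1]
  refine integral_mono ((hm hX).integrable_mul (hm hY)).abs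
    (((hi hX).add (hi hY)).div_const 2)
    fun ω => ?_
  simp only [abs_mul]
  nlinarith [sq_nonneg (|g (X ω)| - |g (Y ω)|), abs_mul_abs_self (g (X ω)),
    abs_mul_abs_self (g (Y ω))]

variable {W : Type*} [NormedAddCommGroup W] [NormedSpace ℝ W] [FiniteDimensional ℝ W]
  [MeasurableSpace W] [BorelSpace W]

namespace IsCentredGaussian

variable {η : Measure W} (h : IsCentredGaussian η) {f : W → ℝ}

include h

/-- Makes the two-point formulas available at `X = Y = id`, where they become orthogonality
relations in `L²(η)`. -/
theorem hasGaussianLaw_diag : HasGaussianLaw (fun x : W => (x, x)) η := by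
  have : SecondCountableTopology W := by
    have := FiniteDimensional.proper ℝ W
    infer_instance
  have h1 := h.gaussian
  have h2 : HasGaussianLaw (id : W → W) η := IsGaussian.hasGaussianLaw_id
  exact h2.map_fun ((ContinuousLinearMap.id ℝ W).prod (ContinuousLinearMap.id ℝ W))

omit h [FiniteDimensional ℝ W] [BorelSpace W] in
theorem formInner_comm {q : ℕ} (F G : W [×q]→L[ℝ] ℝ) : formInner η F G = formInner η G F := by
  simp only [formInner, mul_comm]

theorem integral_chaosProj_sq (hf : MemLp f 2 η) (q : ℕ) :
    ∫ x, chaosProj η f q x * chaosProj η f q x ∂η =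
      (1 / (q.factorial : ℝ)) * formInner η (chaosCoeff η f q) (chaosCoeff η f q) :=
  h.integral_chaosProj_mul h.hasGaussianLaw_diag (MeasurePreserving.id η)
    (MeasurePreserving.id η) hf q

theorem integral_mul_chaosProj (hf : MemLp f 2 η) (q : ℕ) :
    ∫ x, f x * chaosProj η f q x ∂η = ∫ x, chaosProj η f q x * chaosProj η f q x ∂η := by
  rw [h.integral_chaosProj_sq hf, h.formInner_chaosCoeff hf (h.chaosCoeff_mem_powerSpan hf q)]
  simp only [chaosProj, mul_left_comm (f _)]
  rw [integral_const_mul]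

theorem integral_chaosProj_mul_hermitePoly (hf : MemLp f 2 η) (p q : ℕ) (ℓ : W →L[ℝ] ℝ) :
    ∫ x, chaosProj η f p x * (hermitePoly (∫ y, ℓ y ^ 2 ∂η) q).eval (ℓ x) ∂η =
      if p = q then ∫ x, f x * (hermitePoly (∫ y, ℓ y ^ 2 ∂η) q).eval (ℓ x) ∂η else 0 := by
  simp only [← h.formInner_power_hermiteForm]
  split_ifs with hpq
  · subst hpq
    rw [← h.formInner_chaosCoeff hf (tensorForm_const_mem_powerSpan ℓ)]
    have h1 := h.integral_chaos_mul h.hasGaussianLaw_diag (MeasurePreserving.id η)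
      (MeasurePreserving.id η) (h.chaosCoeff_mem_powerSpan hf p)
      (tensorForm_const_mem_powerSpan (q := p) ℓ)
    simp only [chaosProj, mul_assoc]
    rw [integral_const_mul, h1, formInner_comm]
    simp only [formInner]
    field_simp
  · have h1 := h.integral_chaos_mul_of_ne h.hasGaussianLaw_diag (MeasurePreserving.id η)
      (MeasurePreserving.id η) hpq (h.chaosCoeff_mem_powerSpan hf p)
      (tensorForm_const_mem_powerSpan (q := q) ℓ)
    simp only [chaosProj, mul_assoc]
    rw [integral_const_mul, h1, mul_zero]

/-- Bessel's inequality: expand the non-negative square norm of `f` minus the partial sum of its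
mutually orthogonal projections. -/
theorem sum_integral_chaosProj_sq_le (hf : MemLp f 2 η) (s : Finset ℕ) :
    ∑ q ∈ s, ∫ x, chaosProj η f q x * chaosProj η f q x ∂η ≤ ∫ x, f x * f x ∂η := by
  set U : ℕ → Lp ℝ 2 η := fun q => (h.memLp_chaosProj hf q).toLp _ with hU
  set F := hf.toLp f with hF
  have h1 : inner ℝ F (∑ q ∈ s, U q) = ∑ q ∈ s, ∫ x, chaosProj η f q x * chaosProj η f q x ∂η := by
    rw [inner_sum]
    exact Finset.sum_congr rfl fun q _ => by
      rw [inner_toLp, h.integral_mul_chaosProj hf]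
  have h2 : inner ℝ (∑ q ∈ s, U q) (∑ q ∈ s, U q) =
      ∑ q ∈ s, ∫ x, chaosProj η f q x * chaosProj η f q x ∂η := by
    rw [inner_sum]
    refine Finset.sum_congr rfl fun q hq => ?_
    rw [sum_inner, Finset.sum_eq_single q, inner_toLp]
    · intro p _ hpq
      rw [inner_toLp]
      exact h.integral_chaosProj_mul_of_ne h.hasGaussianLaw_diag (MeasurePreserving.id η)
        (MeasurePreserving.id η) hf hpq
    · exact fun hn => absurd hq hn
  have h3 : 0 ≤ inner ℝ (F - ∑ q ∈ s, U q) (F - ∑ q ∈ s, U q) := real_inner_self_nonneg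
  rw [inner_sub_sub_self, h2, real_inner_comm F (∑ q ∈ s, U q), h1, hF, inner_toLp] at h3
  linarith

theorem summable_integral_chaosProj_sq (hf : MemLp f 2 η) :
    Summable fun q => ∫ x, chaosProj η f q x * chaosProj η f q x ∂η :=
  summable_of_sum_le (fun _ => integral_nonneg fun _ => mul_self_nonneg _)
    (h.sum_integral_chaosProj_sq_le hf)

/-- The chaos expansion of a square-integrable function. -/
theorem hasSum_chaosProj (hf : MemLp f 2 η) :
    HasSum (fun q => (h.memLp_chaosProj hf q).toLp (chaosProj η f q)) (hf.toLp f) := by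
  have hprob := h.isProbabilityMeasure
  set U : ℕ → Lp ℝ 2 η := fun q => (h.memLp_chaosProj hf q).toLp _ with hU
  have horth : OrthogonalFamily ℝ (fun q => (Submodule.span ℝ {U q} : Submodule ℝ (Lp ℝ 2 η)))
      fun q => (Submodule.span ℝ {U q}).subtypeₗᵢ := by
    refine OrthogonalFamily.of_pairwise fun p q hpq => ?_
    rw [Function.onFun, Submodule.isOrtho_span]
    rintro _ rfl _ rfl
    rw [inner_toLp]
    exact h.integral_chaosProj_mul_of_ne h.hasGaussianLaw_diag (MeasurePreserving.id η)
      (MeasurePreserving.id η) hf hpq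
  have hsummable : Summable U := by
    refine (horth.summable_iff_norm_sq_summable
      (fun q => ⟨U q, Submodule.mem_span_singleton_self _⟩)).2 ?_
    refine (h.summable_integral_chaosProj_sq hf).congr fun q => ?_
    rw [← inner_toLp (h.memLp_chaosProj hf q) (h.memLp_chaosProj hf q)]
    exact real_inner_self_eq_norm_sq _
  -- Against a Hermite polynomial of degree `q`, only the `q`-th projection contributes, with the
  -- same value as `f`. The remainder is thus orthogonal to all of them and vanishes by
  -- completeness.
  have hzero : hf.toLp f - ∑' q, U q = 0 := by
    rw [Lp.eq_zero_iff_ae_eq_zero]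
    refine h.ae_eq_zero_of_orthogonal_hermitePoly (Lp.memLp _) fun q ℓ => ?_
    have hm := memLp_two_polynomial_eval (h.memLp ℓ) (hermitePoly (∫ y, ℓ y ^ 2 ∂η) q)
    have h1 := inner_toLp (Lp.memLp (hf.toLp f - ∑' q, U q)) hm
    rw [Lp.toLp_coeFn] at h1
    rw [← h1, inner_sub_left, inner_toLp, sub_eq_zero]
    have h2 := hsummable.hasSum.mapL ((innerSL ℝ).flip (hm.toLp _))
    simp only [ContinuousLinearMap.flip_apply, innerSL_apply_apply, hU, inner_toLp,
      h.integral_chaosProj_mul_hermitePoly hf] at h2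
    have h3 := hasSum_ite_eq q (∫ x, f x * (hermitePoly (∫ y, ℓ y ^ 2 ∂η) q).eval (ℓ x) ∂η)
    exact h3.unique h2
  rw [sub_eq_zero] at hzero
  rw [hzero]
  exact hsummable.hasSum

variable {S : Type*} [MeasurableSpace S] {P : Measure S} {X Y : S → W}

/-- The covariance of a function of a Gaussian pair is the sum of those of its projections. -/
theorem hasSum_integral_chaosProj_mul (hXY : HasGaussianLaw (fun ω => (X ω, Y ω)) P)
    (hX : MeasurePreserving X P η) (hY : MeasurePreserving Y P η) (hf : MemLp f 2 η) :
    HasSum (fun q => ∫ ω, chaosProj η f q (X ω) * chaosProj η f q (Y ω) ∂P)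
      (∫ ω, f (X ω) * f (Y ω) ∂P) := by
  -- Composition with a measure preserving map is an isometry of `L²`, so the expansion transports
  -- to each point of the field.
  have hcomp : ∀ {Z : S → W} (hZ : MeasurePreserving Z P η),
      HasSum (fun q => ((h.memLp_chaosProj hf q).comp_measurePreserving hZ).toLp
        (chaosProj η f q ∘ Z)) ((hf.comp_measurePreserving hZ).toLp (f ∘ Z)) := by
    intro Z hZ
    have h1 := (h.hasSum_chaosProj hf).mapL
      (Lp.compMeasurePreservingₗᵢ ℝ Z hZ).toContinuousLinearMap
    exact h1
  have h2 := (hcomp hY).mapL (innerSL ℝ ((hf.comp_measurePreserving hX).toLp (f ∘ X)))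
  simp only [innerSL_apply_apply, inner_toLp] at h2
  refine h2.congr_fun fun q => ?_
  -- Expanding the other factor as well leaves only the term of equal order.
  have h3 := (hcomp hX).mapL ((innerSL ℝ).flip
    (((h.memLp_chaosProj hf q).comp_measurePreserving hY).toLp (chaosProj η f q ∘ Y)))
  simp only [ContinuousLinearMap.flip_apply, innerSL_apply_apply, inner_toLp,
    Function.comp_apply] at h3
  refine HasSum.unique ?_ h3
  refine hasSum_single q fun p hp => ?_
  exact h.integral_chaosProj_mul_of_ne hXY hX hY hf hp

/-- `0`-linear forms are scalars and the Hermite form of order `0` is `1`. The covariance of order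
`0` is then the squared mean, exactly what the variance subtracts. -/
theorem chaosProj_zero (hf : MemLp f 2 η) (x : W) : chaosProj η f 0 x = ∫ y, f y ∂η := by
  have h1 : ∀ F : W [×0]→L[ℝ] ℝ, F = F (fun _ => 0) • tensorForm fun _ => (0 : W →L[ℝ] ℝ) := by
    intro F
    ext w
    simp only [smul_apply, tensorForm_apply, Finset.univ_eq_empty, Finset.prod_empty, smul_eq_mul,
      mul_one]
    congr 1
    exact Subsingleton.elim _ _
  rw [chaosProj, h1 (chaosCoeff η f 0), ← h.formInnerBilin_apply, map_smul, LinearMap.smul_apply,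
    h.formInnerBilin_apply, h.formInner_power_hermiteForm, h.chaosCoeff_apply hf]
  have h2 : ∀ x, hermiteForm η 0 x (fun _ => 0) = 1 := by
    intro x
    have := h.hermiteForm_diagonal 0 x 0
    simp only [hermitePoly, Polynomial.eval_one] at this
    rw [← this]
    congr 1
    exact Subsingleton.elim _ _
  simp [h2, hermitePoly]

theorem integral_chaosProj_succ (hf : MemLp f 2 η) (q : ℕ) :
    ∫ x, chaosProj η f (q + 1) x ∂η = 0 := by
  have h1 := h.integral_chaosProj_mul_hermitePoly hf (q + 1) 0 0
  simpa [hermitePoly] using h1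

end IsCentredGaussian

end ChaosExpansion

/-! ### Integrals of second order random fields -/

section FieldIntegrals

theorem sq_integral_mul_le {S : Type*} [MeasurableSpace S] {Q : Measure S} {a b : S → ℝ}
    (ha : MemLp a 2 Q) (hb : MemLp b 2 Q) :
    (∫ ω, a ω * b ω ∂Q) ^ 2 ≤ (∫ ω, a ω ^ 2 ∂Q) * ∫ ω, b ω ^ 2 ∂Q := by
  have h := real_inner_mul_inner_self_le (ha.toLp a) (hb.toLp b)
  simpa only [inner_toLp, ← pow_two] using h

variable {V S 𝕜 : Type*} [MeasurableSpace V] [MeasurableSpace S] [RCLike 𝕜]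
  {ν : Measure V} [SFinite ν] {Q : Measure S} [IsProbabilityMeasure Q]

/-- A random field whose second moments are dominated by the square of an integrable function. -/
structure DominatedField (ν : Measure V) (Q : Measure S) (A : V → S → 𝕜) : Prop where
  aesm : AEStronglyMeasurable (fun p : V × S => A p.1 p.2) (ν.prod Q)
  memLp : ∀ u, MemLp (A u) 2 Q
  bound : ∃ m : V → ℝ, Integrable m ν ∧ (∀ u, 0 ≤ m u) ∧ ∀ u, ∫ ω, ‖A u ω‖ ^ 2 ∂Q ≤ m u ^ 2

namespace DominatedField

variable {A : V → S → 𝕜} (h : DominatedField ν Q A)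

include h

omit [SFinite ν] in
theorem integrable_prod : Integrable (fun p : V × S => A p.1 p.2) (ν.prod Q) := by
  obtain ⟨m, hm, hm0, hb⟩ := h.bound
  rw [integrable_prod_iff h.aesm]
  refine ⟨Filter.Eventually.of_forall fun u => (h.memLp u).integrable (by norm_num), ?_⟩
  refine hm.mono' h.aesm.norm.integral_prod_right' (Filter.Eventually.of_forall fun u => ?_)
  have h1 := sq_integral_mul_le (h.memLp u).norm (memLp_const (1 : ℝ))
  simp only [mul_one, one_pow, integral_const, probReal_univ, smul_eq_mul] at h1
  rw [Real.norm_of_nonneg (integral_nonneg fun _ => norm_nonneg _)]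
  exact abs_le_of_sq_le_sq' (h1.trans (hb u)) (hm0 u) |>.2

theorem ae_integrable : ∀ᵐ ω ∂Q, Integrable (fun u => A u ω) ν :=
  h.integrable_prod.prod_left_ae

/-- Cauchy-Schwarz bounds `E|A_u A_v|` by `m(u) m(v)`, integrable on the product. Every exchange of
expectation and double integral rests on this. -/
theorem integrable_triple : Integrable
    (fun p : (V × V) × S => A p.1.1 p.2 * (starRingEnd 𝕜) (A p.1.2 p.2)) ((ν.prod ν).prod Q) := by
  obtain ⟨m, hm, hm0, hb⟩ := h.bound
  have hmeas : AEStronglyMeasurable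
      (fun p : (V × V) × S => A p.1.1 p.2 * (starRingEnd 𝕜) (A p.1.2 p.2))
      ((ν.prod ν).prod Q) := by
    have q1 : Measure.QuasiMeasurePreserving (fun p : (V × V) × S => (p.1.1, p.2))
        ((ν.prod ν).prod Q) (ν.prod Q) :=
      MeasureTheory.QuasiMeasurePreserving.prodMap Measure.quasiMeasurePreserving_fst
        (Measure.QuasiMeasurePreserving.id Q)
    have q2 : Measure.QuasiMeasurePreserving (fun p : (V × V) × S => (p.1.2, p.2))
        ((ν.prod ν).prod Q) (ν.prod Q) :=
      MeasureTheory.QuasiMeasurePreserving.prodMap Measure.quasiMeasurePreserving_snd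
        (Measure.QuasiMeasurePreserving.id Q)
    exact (h.aesm.comp_quasiMeasurePreserving q1).mul
      (RCLike.continuous_conj.comp_aestronglyMeasurable (h.aesm.comp_quasiMeasurePreserving q2))
  rw [integrable_prod_iff hmeas]
  refine ⟨Filter.Eventually.of_forall fun p => (h.memLp p.1).integrable_mul (h.memLp p.2).star, ?_⟩
  refine (hm.mul_prod hm).mono' hmeas.norm.integral_prod_right'
    (Filter.Eventually.of_forall fun p => ?_)
  rw [Real.norm_of_nonneg (integral_nonneg fun _ => norm_nonneg _)]
  simp only [norm_mul, RCLike.norm_conj]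
  have h1 := sq_integral_mul_le (h.memLp p.1).norm (h.memLp p.2).norm
  refine abs_le_of_sq_le_sq' (h1.trans ?_) (mul_nonneg (hm0 _) (hm0 _)) |>.2
  rw [mul_pow]
  exact mul_le_mul (hb _) (hb _) (integral_nonneg fun _ => sq_nonneg _) (sq_nonneg _)

omit h [IsProbabilityMeasure Q] [MeasurableSpace S] in
theorem integral_mul_conj (ω : S) :
    ∫ p : V × V, A p.1 ω * (starRingEnd 𝕜) (A p.2 ω) ∂(ν.prod ν) =
      (∫ u, A u ω ∂ν) * (starRingEnd 𝕜) (∫ u, A u ω ∂ν) := by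
  rw [integral_prod_mul (fun u => A u ω) fun u => (starRingEnd 𝕜) (A u ω), integral_conj]

theorem aestronglyMeasurable_integral :
    AEStronglyMeasurable (fun ω => ∫ u, A u ω ∂ν) Q :=
  h.aesm.prod_swap.integral_prod_right'

/-- The square modulus of the integral is a partial integral of the function in `integrable_triple`.
-/
theorem memLp_integral : MemLp (fun ω => ∫ u, A u ω ∂ν) 2 Q := by
  rw [memLp_two_iff_integrable_sq_norm h.aestronglyMeasurable_integral]
  have h1 := h.integrable_triple.integral_prod_right.norm
  refine h1.congr (Filter.Eventually.of_forall fun ω => ?_)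
  simp only [integral_mul_conj, norm_mul, RCLike.norm_conj, pow_two]

theorem integral_integral : ∫ ω, ∫ u, A u ω ∂ν ∂Q = ∫ u, ∫ ω, A u ω ∂Q ∂ν :=
  (integral_integral_swap h.integrable_prod).symm

theorem integral_sq : ∫ ω, (∫ u, A u ω ∂ν) * (starRingEnd 𝕜) (∫ u, A u ω ∂ν) ∂Q =
    ∫ p : V × V, ∫ ω, A p.1 ω * (starRingEnd 𝕜) (A p.2 ω) ∂Q ∂(ν.prod ν) := by
  simp only [← integral_mul_conj]
  exact (integral_integral_swap h.integrable_triple).symm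

end DominatedField

end FieldIntegrals

/-! ### Scalar stationary fields -/

/-- `Y` is a jointly measurable square-integrable complex field such that
`E[Y u * conj (Y v)] = K (u - v)` with `K` continuous. -/
structure IsStationaryField {V S : Type*} [NormedAddCommGroup V] [MeasurableSpace V]
    [MeasurableSpace S] (Q : Measure S) (Y : V → S → ℂ) (K : V → ℂ) : Prop where
  measurable : Measurable fun p : V × S => Y p.1 p.2
  memLp : ∀ u, MemLp (Y u) 2 Q
  cov : ∀ u v, ∫ ω, Y u ω * (starRingEnd ℂ) (Y v ω) ∂Q = K (u - v)
  continuous : Continuous K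

namespace IsStationaryField

variable {V S : Type*} [NormedAddCommGroup V] [MeasurableSpace V] [MeasurableSpace S]
  {Q : Measure S} {Y : V → S → ℂ} {K : V → ℂ}

theorem integral_norm_sq (h : IsStationaryField Q Y K) (u : V) :
    ∫ ω, ‖Y u ω‖ ^ 2 ∂Q = (K 0).re := by
  have h1 := h.cov u u
  simp only [Complex.mul_conj, Complex.normSq_eq_norm_sq, sub_self] at h1
  rw [integral_complex_ofReal] at h1
  rw [← h1, Complex.ofReal_re]

theorem re_zero_nonneg (h : IsStationaryField Q Y K) : 0 ≤ (K 0).re := by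
  rw [← h.integral_norm_sq 0]; exact integral_nonneg fun _ => sq_nonneg _

theorem norm_le (h : IsStationaryField Q Y K) (v : V) : ‖K v‖ ≤ (K 0).re := by
  have h1 := h.cov v 0
  rw [sub_zero] at h1
  rw [← h1]
  have hsq : ∀ u, Integrable (fun ω => ‖Y u ω‖ ^ 2) Q := fun u =>
    (memLp_two_iff_integrable_sq_norm (h.memLp u).1).1 (h.memLp u)
  calc ‖∫ ω, Y v ω * (starRingEnd ℂ) (Y 0 ω) ∂Q‖
      ≤ ∫ ω, ‖Y v ω * (starRingEnd ℂ) (Y 0 ω)‖ ∂Q := norm_integral_le_integral_norm _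
    _ ≤ ∫ ω, ((‖Y v ω‖ ^ 2 + ‖Y 0 ω‖ ^ 2) / 2) ∂Q := by
        refine integral_mono_of_nonneg (Filter.Eventually.of_forall fun _ => norm_nonneg _)
          (((hsq v).add (hsq 0)).div_const 2) (Filter.Eventually.of_forall fun ω => ?_)
        simp only [norm_mul, RCLike.norm_conj]
        nlinarith [sq_nonneg (‖Y v ω‖ - ‖Y 0 ω‖)]
    _ = (K 0).re := by
        rw [integral_div, integral_add (hsq v) (hsq 0), h.integral_norm_sq, h.integral_norm_sq]
        ring

end IsStationaryField

/-- Fatou's lemma for integrability of an almost everywhere limit. -/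
theorem integrable_of_tendsto_ae {α : Type*} [MeasurableSpace α] {ν : Measure α}
    {G : ℕ → α → ℝ} {g : α → ℝ} (hG : ∀ n, AEStronglyMeasurable (G n) ν)
    (hlim : ∀ᵐ x ∂ν, Filter.Tendsto (fun n => G n x) Filter.atTop (nhds (g x)))
    (hfin : Filter.liminf (fun n => ∫⁻ x, ‖G n x‖ₑ ∂ν) Filter.atTop ≠ ⊤) : Integrable g ν := by
  refine ⟨aestronglyMeasurable_of_tendsto_ae _ hG hlim, lt_of_le_of_lt ?_ hfin.lt_top⟩
  refine le_trans (le_of_eq ?_) (lintegral_liminf_le' fun n => (hG n).enorm)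
  refine lintegral_congr_ae ?_
  filter_upwards [hlim] with x hx
  exact hx.enorm.liminf_eq.symm

/-! ### Positivity and integrability of the transform of a regularized covariance -/

section Bochner

open Filter Complex FourierTransform
open scoped Topology RealInnerProductSpace

variable {E : Type*} [NormedAddCommGroup E] [InnerProductSpace ℝ E] [FiniteDimensional ℝ E]
  [MeasurableSpace E] [BorelSpace E]

/-- The Gaussian regularization of a function. -/
def gaussReg (K : E → ℂ) (b : ℝ) (v : E) : ℂ := K v * (Real.exp (-b * ‖v‖ ^ 2) : ℂ)

theorem integrable_gaussian_norm {b : ℝ} (hb : 0 < b) :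
    Integrable (fun v : E => Real.exp (-b * ‖v‖ ^ 2)) := by
  have h1 := GaussianFourier.integrable_cexp_neg_mul_sq_norm_add (V := E)
    (b := (b : ℂ)) (by simpa using hb) 0 0
  refine h1.norm.congr (Eventually.of_forall fun v => ?_)
  simp only [zero_mul, add_zero, Complex.norm_exp]
  norm_cast

omit [InnerProductSpace ℝ E] [FiniteDimensional ℝ E] [MeasurableSpace E] [BorelSpace E] in
theorem continuous_gaussReg {K : E → ℂ} (hK : Continuous K) (b : ℝ) :
    Continuous (gaussReg K b) := by
  unfold gaussReg
  fun_prop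

theorem integrable_gaussReg {K : E → ℂ} (hK : Continuous K) {C : ℝ} (hC : ∀ v, ‖K v‖ ≤ C)
    {b : ℝ} (hb : 0 < b) : Integrable (gaussReg K b) := by
  refine ((integrable_gaussian_norm hb).const_mul C).mono'
    (continuous_gaussReg hK b).aestronglyMeasurable (Eventually.of_forall fun v => ?_)
  rw [gaussReg, norm_mul, Complex.norm_of_nonneg (Real.exp_pos _).le]
  exact mul_le_mul_of_nonneg_right (hC v) (Real.exp_pos _).le

/-- A composition of shears and a swap. In the new coordinates the difference of the two points and
their midpoint are independent variables. -/
theorem measurePreserving_midpoint_shear :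
    MeasurePreserving (fun p : E × E => (p.2 + (2 : ℝ)⁻¹ • p.1, p.2 - (2 : ℝ)⁻¹ • p.1))
      (volume.prod volume) (volume.prod volume) := by
  have h1 : MeasurePreserving (fun p : E × E => (p.1, p.2 - (2 : ℝ)⁻¹ • p.1))
      (volume.prod volume) (volume.prod volume) := by
    refine MeasurePreserving.skew_product (f := id) (g := fun x y => y - (2 : ℝ)⁻¹ • x)
      (MeasurePreserving.id _) (by fun_prop) (Eventually.of_forall fun x => ?_)
    exact map_sub_right_eq_self volume _
  have h2 := (Measure.measurePreserving_swap (μ := (volume : Measure E))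
    (ν := (volume : Measure E))).comp ((measurePreserving_prod_add_swap volume volume).comp h1)
  convert! h2 using 1
  funext p
  simp only [Function.comp_apply, Prod.swap_prod_mk, Prod.mk.injEq, and_true]
  module

/-- By the parallelogram law the two weights of rate `2b` become a weight of rate `b` in the
difference and one of rate `4b` in the midpoint. The characters depend on the difference only, so
the midpoint integrates out. -/
theorem fourier_gaussReg_eq {K : E → ℂ} (hK : Continuous K) {b : ℝ} (ξ : E) :
    ∫ p : E × E, K (p.1 - p.2) *
      (((Real.exp (-(2 * b) * ‖p.1‖ ^ 2) : ℂ) * cexp (-(2 * Real.pi * ⟪p.1, ξ⟫ : ℝ) * I)) *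
       (starRingEnd ℂ) ((Real.exp (-(2 * b) * ‖p.2‖ ^ 2) : ℂ) *
          cexp (-(2 * Real.pi * ⟪p.2, ξ⟫ : ℝ) * I))) ∂(volume.prod volume) =
      𝓕 (gaussReg K b) ξ * (∫ w : E, Real.exp (-(4 * b) * ‖w‖ ^ 2) : ℝ) := by
  rw [← measurePreserving_midpoint_shear.map_eq, integral_map
    measurePreserving_midpoint_shear.measurable.aemeasurable
    (Continuous.aestronglyMeasurable (by fun_prop)), ← integral_complex_ofReal, Real.fourier_eq',
    ← integral_prod_mul]
  refine integral_congr_ae (Eventually.of_forall fun p => ?_)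
  have h1 : p.2 + (2 : ℝ)⁻¹ • p.1 - (p.2 - (2 : ℝ)⁻¹ • p.1) = p.1 := by module
  have h2 : ‖p.2 + (2 : ℝ)⁻¹ • p.1‖ ^ 2 + ‖p.2 - (2 : ℝ)⁻¹ • p.1‖ ^ 2 =
      2 * ‖p.2‖ ^ 2 + 2⁻¹ * ‖p.1‖ ^ 2 := by
    have h3 := parallelogram_law_with_norm ℝ p.2 ((2 : ℝ)⁻¹ • p.1)
    rw [norm_smul, Real.norm_of_nonneg (by norm_num)] at h3
    nlinarith
  simp only [h1, gaussReg, map_mul, ← Complex.exp_conj, map_neg, Complex.conj_ofReal,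
    Complex.conj_I, smul_eq_mul, Complex.ofReal_exp]
  have h4 : ∀ a b c d e : ℂ, a * (cexp b * cexp c * (cexp d * cexp e)) =
      a * cexp (b + c + d + e) := by
    intro a b c d e; simp only [Complex.exp_add]; ring
  have h5 : ∀ a b c d : ℂ, cexp b * (a * cexp c) * cexp d = a * cexp (b + c + d) := by
    intro a b c d; simp only [Complex.exp_add]; ring
  rw [h4, h5]
  congr 2
  have h6 : ((-(2 * b) * ‖p.2 + (2 : ℝ)⁻¹ • p.1‖ ^ 2 : ℝ) : ℂ) +
      ((-(2 * b) * ‖p.2 - (2 : ℝ)⁻¹ • p.1‖ ^ 2 : ℝ) : ℂ) =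
      ((-b * ‖p.1‖ ^ 2 : ℝ) : ℂ) + ((-(4 * b) * ‖p.2‖ ^ 2 : ℝ) : ℂ) := by
    rw [← Complex.ofReal_add, ← Complex.ofReal_add]
    congr 1
    linear_combination (-(2 * b)) * h2
  have h7 : ⟪p.2 + (2 : ℝ)⁻¹ • p.1, ξ⟫ = ⟪p.2 - (2 : ℝ)⁻¹ • p.1, ξ⟫ + ⟪p.1, ξ⟫ := by
    rw [← inner_add_left]; congr 1; module
  rw [h7]
  linear_combination (norm := (push_cast; ring)) h6

/-- The Fourier transform of the regularized covariance of a stationary field is non-negative. -/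
theorem fourier_gaussReg_nonneg {S : Type*} [MeasurableSpace S] {Q : Measure S}
    [IsProbabilityMeasure Q] {Y : E → S → ℂ} {K : E → ℂ} (h : IsStationaryField Q Y K)
    {b : ℝ} (hb : 0 < b) (ξ : E) : ∃ r : ℝ, 0 ≤ r ∧ 𝓕 (gaussReg K b) ξ = r := by
  -- The second moment of `∫ Y_u g(u) du` is non-negative; with this test function it equals the
  -- Fourier transform at `ξ` times a positive Gaussian integral.
  set g : E → ℂ := fun u => (Real.exp (-(2 * b) * ‖u‖ ^ 2) : ℂ) *
    cexp (-(2 * Real.pi * ⟪u, ξ⟫ : ℝ) * I) with hg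
  have hgc : Continuous g := by fun_prop
  have hgn : ∀ u, ‖g u‖ = Real.exp (-(2 * b) * ‖u‖ ^ 2) := by
    intro u
    rw [hg, norm_mul, Complex.norm_of_nonneg (Real.exp_pos _).le, ← Complex.ofReal_neg,
      Complex.norm_exp_ofReal_mul_I, mul_one]
  have hfield : DominatedField volume Q fun u ω => Y u ω * g u := by
    refine ⟨(h.measurable.mul (hgc.measurable.comp measurable_fst)).aestronglyMeasurable,
      fun u => (h.memLp u).mul_const _, fun u => Real.sqrt (K 0).re * ‖g u‖, ?_, ?_, ?_⟩
    · simp only [hgn]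
      exact (integrable_gaussian_norm (by positivity)).const_mul _
    · intro u; positivity
    · intro u
      simp only [norm_mul, mul_pow]
      rw [integral_mul_const, h.integral_norm_sq, Real.sq_sqrt h.re_zero_nonneg]
  have h1 := hfield.integral_sq
  have h2 : ∀ p : E × E, ∫ ω, Y p.1 ω * g p.1 * (starRingEnd ℂ) (Y p.2 ω * g p.2) ∂Q =
      K (p.1 - p.2) * (g p.1 * (starRingEnd ℂ) (g p.2)) := by
    intro p
    rw [← h.cov, ← integral_mul_const]
    refine integral_congr_ae (Eventually.of_forall fun ω => ?_)
    simp only [map_mul]; ring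
  simp only [h2] at h1
  simp only [hg] at h1
  rw [fourier_gaussReg_eq h.continuous (b := b) ξ] at h1
  have hpos : 0 < ∫ w : E, Real.exp (-(4 * b) * ‖w‖ ^ 2) :=
    integral_exp_pos (integrable_gaussian_norm (by positivity))
  simp only [Complex.mul_conj] at h1
  rw [integral_complex_ofReal] at h1
  refine ⟨(∫ ω, normSq (∫ u, Y u ω * g u) ∂Q) / ∫ w : E, Real.exp (-(4 * b) * ‖w‖ ^ 2),
    div_nonneg (integral_nonneg fun ω => Complex.normSq_nonneg _) hpos.le, ?_⟩
  rw [Complex.ofReal_div, eq_div_iff (by exact_mod_cast hpos.ne'), ← h1]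

/-- A function which is continuous and integrable with non-negative Fourier transform has an
integrable Fourier transform. -/
theorem integrable_fourier_of_nonneg {F : E → ℂ} (hc : Continuous F) (hi : Integrable F)
    {p : E → ℝ} (hp : ∀ ξ, 0 ≤ p ξ) (hF : ∀ ξ, 𝓕 F ξ = p ξ) : Integrable (𝓕 F) := by
  -- Gaussian summation of the inversion formula at the origin, with the transform moved from the
  -- Gaussian kernel to `F`.
  have h1 : Tendsto (fun c : ℝ => ∫ w : E, cexp (-((c⁻¹ : ℝ) : ℂ) * ‖w‖ ^ 2) * 𝓕 F w) atTop (𝓝 (F 0)) := by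
    have h2 := Real.tendsto_integral_gaussian_smul' hi (v := 0) hc.continuousAt
    refine h2.congr' ?_
    filter_upwards [Ioi_mem_atTop 0] with c hc
    have hc' : 0 < c := hc
    have J : Integrable (fun w : E => cexp (-(c : ℂ)⁻¹ * ‖w‖ ^ 2)) := by
      have := GaussianFourier.integrable_cexp_neg_mul_sq_norm_add (V := E)
        (b := (c : ℂ)⁻¹) (by simpa using hc') 0 0
      simpa using this
    have h3 := VectorFourier.integral_fourierIntegral_smul_eq_flip (L := innerₗ E)
      Real.continuous_fourierChar continuous_inner J hi
    have h4 : ∫ w : E, 𝓕 (fun w : E => cexp (-(c : ℂ)⁻¹ * ‖w‖ ^ 2)) w • F w =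
        ∫ w : E, cexp (-(c : ℂ)⁻¹ * ‖w‖ ^ 2) • 𝓕 F w := by
      simpa using! h3
    simp only [smul_eq_mul] at h4
    simp only [Complex.ofReal_inv]
    rw [← h4]
    refine integral_congr_ae (Eventually.of_forall fun w => ?_)
    simp only
    rw [fourier_gaussian_innerProductSpace (by simpa using hc')]
    simp only [zero_sub, norm_neg, smul_eq_mul, div_inv_eq_mul]
    congr 3
    ring
  have hcF : Continuous (𝓕 F) :=
    VectorFourier.fourierIntegral_continuous Real.continuous_fourierChar continuous_inner hi
  have hbound : ∀ w, ‖𝓕 F w‖ ≤ ∫ v, ‖F v‖ := fun w =>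
    VectorFourier.norm_fourierIntegral_le_integral_norm _ _ _ _ _
  have hpF : p = fun w => (𝓕 F w).re := by funext w; rw [hF, Complex.ofReal_re]
  have hexp : ∀ (n : ℕ) (w : E), cexp (-(((((n : ℝ) + 1)⁻¹ : ℝ)) : ℂ) * ‖w‖ ^ 2) * 𝓕 F w =
      ((Real.exp (-((n : ℝ) + 1)⁻¹ * ‖w‖ ^ 2) * p w : ℝ) : ℂ) := by
    intro n w; rw [hF]; push_cast; rfl
  have hn : Tendsto (fun n : ℕ => (n : ℝ) + 1) atTop atTop :=
    tendsto_atTop_add_const_right _ _ tendsto_natCast_atTop_atTop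
  have h5 : Tendsto (fun n : ℕ => ∫ w : E, Real.exp (-((n : ℝ) + 1)⁻¹ * ‖w‖ ^ 2) * p w) atTop
      (𝓝 (F 0).re) := by
    have h6 := (Complex.continuous_re.tendsto _).comp (h1.comp hn)
    refine h6.congr fun n => ?_
    simp only [Function.comp_apply, hexp]
    rw [integral_complex_ofReal, Complex.ofReal_re]
  have hint : ∀ n : ℕ, Integrable fun w : E => Real.exp (-((n : ℝ) + 1)⁻¹ * ‖w‖ ^ 2) * p w := by
    intro n
    refine ((integrable_gaussian_norm (E := E) (b := ((n : ℝ) + 1)⁻¹)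
      (by positivity)).mul_const (∫ v, ‖F v‖)).mono' ?_ (Eventually.of_forall fun w => ?_)
    · rw [hpF]; exact Continuous.aestronglyMeasurable (by fun_prop)
    · rw [norm_mul, Real.norm_of_nonneg (Real.exp_pos _).le, Real.norm_of_nonneg (hp w)]
      refine mul_le_mul_of_nonneg_left ?_ (Real.exp_pos _).le
      have := hbound w
      rwa [hF, Complex.norm_of_nonneg (hp w)] at this
  -- Since `p ≥ 0`, the regularized integrals are `L¹` norms; they converge to the real part of `F
  -- 0`, and Fatou applies.
  have hpint : Integrable p := by
    refine integrable_of_tendsto_ae (G := fun n (w : E) => Real.exp (-((n : ℝ) + 1)⁻¹ * ‖w‖ ^ 2) * p w)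
      (fun n => (hint n).aestronglyMeasurable) (Eventually.of_forall fun w => ?_) ?_
    · have h7 : Tendsto (fun n : ℕ => Real.exp (-((n : ℝ) + 1)⁻¹ * ‖w‖ ^ 2)) atTop (𝓝 1) := by
        have h8 := ((tendsto_inv_atTop_zero.comp hn).neg.mul_const (‖w‖ ^ 2))
        rw [neg_zero, zero_mul] at h8
        have := (Real.continuous_exp.tendsto _).comp h8
        rwa [Real.exp_zero] at this
      simpa using h7.mul_const (p w)
    · have h9 : ∀ n : ℕ, ∫⁻ w : E, ‖Real.exp (-((n : ℝ) + 1)⁻¹ * ‖w‖ ^ 2) * p w‖ₑ =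
          ENNReal.ofReal (∫ w : E, Real.exp (-((n : ℝ) + 1)⁻¹ * ‖w‖ ^ 2) * p w) := by
        intro n
        rw [← ofReal_integral_norm_eq_lintegral_enorm (hint n)]
        congr 1
        refine integral_congr_ae (Eventually.of_forall fun w => ?_)
        exact Real.norm_of_nonneg (mul_nonneg (Real.exp_pos _).le (hp w))
      simp only [h9]
      have h10 := ((ENNReal.continuous_ofReal.tendsto _).comp h5).liminf_eq
      exact h10.trans_ne ENNReal.ofReal_ne_top
  have : 𝓕 F = fun w => (p w : ℂ) := funext hF
  rw [this]
  exact hpint.ofReal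

end Bochner

/-! ### Bochner's theorem on a Euclidean space -/

section BochnerMeasure

open Filter Complex FourierTransform
open scoped Topology RealInnerProductSpace

variable {E : Type*} [NormedAddCommGroup E] [InnerProductSpace ℝ E] [FiniteDimensional ℝ E]
  [MeasurableSpace E] [BorelSpace E]

/-- Fourier inversion for the regularized covariance of a stationary field. -/
theorem exists_measure_charFun_eq_gaussReg {S : Type*} [MeasurableSpace S] {Q : Measure S}
    [IsProbabilityMeasure Q] {Y : E → S → ℂ} {K : E → ℂ} (h : IsStationaryField Q Y K)
    {b : ℝ} (hb : 0 < b) : ∃ μ : Measure E, IsFiniteMeasure μ ∧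
      ∀ t, charFun μ t = gaussReg K b ((2 * Real.pi)⁻¹ • t) := by
  choose p hp hF using fun ξ => fourier_gaussReg_nonneg h hb ξ
  have hc := continuous_gaussReg h.continuous b
  have hi := integrable_gaussReg h.continuous h.norm_le hb
  have hFi := integrable_fourier_of_nonneg hc hi hp hF
  have hpF : p = fun w => (𝓕 (gaussReg K b) w).re := by funext w; rw [hF, Complex.ofReal_re]
  have hpi : Integrable p := by rw [hpF]; exact hFi.re
  have hpm : Measurable p := by
    have : Continuous (𝓕 (gaussReg K b)) :=
      VectorFourier.fourierIntegral_continuous Real.continuous_fourierChar continuous_inner hi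
    rw [hpF]; exact (Complex.continuous_re.comp this).measurable
  -- The non-negative transform is the density. The factor `2π` converts between the character
  -- `exp(i⟨x, t⟩)` of `charFun` and `exp(2iπ⟨x, t⟩)` of `𝓕`.
  refine ⟨volume.withDensity fun x => ENNReal.ofReal (p x),
    isFiniteMeasure_withDensity_ofReal hpi.2, fun t => ?_⟩
  rw [charFun_apply, integral_withDensity_eq_integral_toReal_smul
    (hpm.ennreal_ofReal) (Eventually.of_forall fun _ => ENNReal.ofReal_lt_top)]
  have hinv := congrFun (hc.fourierInv_fourier_eq hi hFi) ((2 * Real.pi)⁻¹ • t)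
  rw [← hinv, Real.fourierInv_eq']
  refine integral_congr_ae (Eventually.of_forall fun x => ?_)
  simp only [ENNReal.toReal_ofReal (hp x), hF, inner_smul_right, smul_eq_mul, Complex.real_smul]
  rw [mul_inv_cancel_left₀ (by positivity), mul_comm]

/-- A pointwise limit of characteristic functions of probability measures which is continuous at
the origin is a characteristic function. -/
theorem exists_charFun_eq_of_tendsto {μ : ℕ → ProbabilityMeasure E} {g : E → ℂ}
    (hg : ContinuousAt g 0)
    (h : ∀ t, Tendsto (fun n => charFun (μ n : Measure E) t) atTop (𝓝 (g t))) :
    ∃ ν : ProbabilityMeasure E, ∀ t, charFun (ν : Measure E) t = g t := by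
  have htight := isTightMeasureSet_of_tendsto_charFun (μ := fun n => (μ n : Measure E)) hg h
  have hcomp : IsCompact (closure {μ n | n}) :=
    isCompact_closure_of_isTightMeasureSet (by simpa [Set.range] using htight)
  -- Tightness gives relative compactness. A limit along a non-principal ultrafilter suffices, since
  -- the characteristic functions already converge.
  obtain ⟨ν, -, hν⟩ := hcomp.ultrafilter_le_nhds ((hyperfilter ℕ).map μ)
    (.trans (by simp) (monotone_principal subset_closure))
  have hν' : Tendsto μ (hyperfilter ℕ : Filter ℕ) (𝓝 ν) := hν
  refine ⟨ν, fun t => ?_⟩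
  rw [ProbabilityMeasure.tendsto_iff_forall_integral_rclike_tendsto ℂ] at hν'
  have h1 := hν' (BoundedContinuousFunction.innerProbChar t)
  simp_rw [← charFun_eq_integral_innerProbChar] at h1
  exact tendsto_nhds_unique h1 ((h t).mono_left Nat.hyperfilter_le_atTop)

omit [InnerProductSpace ℝ E] [FiniteDimensional ℝ E] [MeasurableSpace E] [BorelSpace E] in
theorem tendsto_gaussReg (K : E → ℂ) (v : E) :
    Tendsto (fun n : ℕ => gaussReg K (((n : ℝ) + 1)⁻¹) v) atTop (𝓝 (K v)) := by
  have hn : Tendsto (fun n : ℕ => (n : ℝ) + 1) atTop atTop :=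
    tendsto_atTop_add_const_right _ _ tendsto_natCast_atTop_atTop
  have h8 := ((tendsto_inv_atTop_zero.comp hn).neg.mul_const (‖v‖ ^ 2))
  rw [neg_zero, zero_mul] at h8
  have h9 := (Real.continuous_exp.tendsto _).comp h8
  rw [Real.exp_zero] at h9
  have h10 := ((Complex.continuous_ofReal.tendsto _).comp h9).const_mul (K v)
  rw [Complex.ofReal_one, mul_one] at h10
  exact h10

/-- **Bochner's theorem** for the covariance of a stationary field on a Euclidean space. -/
theorem exists_measure_charFun_eq {S : Type*} [MeasurableSpace S] {Q : Measure S}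
    [IsProbabilityMeasure Q] {Y : E → S → ℂ} {K : E → ℂ} (h : IsStationaryField Q Y K) :
    ∃ μ : Measure E, IsFiniteMeasure μ ∧ ∀ t, charFun μ t = K ((2 * Real.pi)⁻¹ • t) := by
  -- If the variance is zero then `K = 0`, and normalization to probability measures is impossible.
  rcases h.re_zero_nonneg.eq_or_lt with h0 | hpos
  · refine ⟨0, inferInstance, fun t => ?_⟩
    have := h.norm_le ((2 * Real.pi)⁻¹ • t)
    rw [← h0, norm_le_zero_iff] at this
    rw [this, charFun_apply, integral_zero_measure]
  choose μ hfin hμ using fun n : ℕ =>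
    exists_measure_charFun_eq_gaussReg h (b := ((n : ℝ) + 1)⁻¹) (by positivity)
  -- The Gaussian factor equals `1` at the origin, so all regularized measures share one mass.
  have hmass : ∀ n, (μ n).real Set.univ = (K 0).re := by
    intro n
    have h1 := hμ n 0
    rw [charFun_zero, smul_zero, gaussReg, norm_zero] at h1
    have h2 : (((μ n).real Set.univ : ℝ) : ℂ) = K 0 := by simpa using h1
    rw [← h2, Complex.ofReal_re]
  have hmass' : ∀ n, μ n Set.univ = ENNReal.ofReal (K 0).re := by
    intro n
    rw [← hmass n, ofReal_measureReal]
  have hprob : ∀ n, IsProbabilityMeasure ((ENNReal.ofReal (K 0).re)⁻¹ • μ n) := by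
    intro n
    refine ⟨?_⟩
    rw [Measure.smul_apply, hmass', smul_eq_mul]
    exact ENNReal.inv_mul_cancel (by simpa using hpos) ENNReal.ofReal_ne_top
  obtain ⟨ν, hν⟩ := exists_charFun_eq_of_tendsto (E := E)
    (μ := fun n => ⟨_, hprob n⟩) (g := fun t => ((K 0).re⁻¹ : ℝ) * K ((2 * Real.pi)⁻¹ • t))
    (Continuous.continuousAt (by have := h.continuous; fun_prop)) (fun t => by
      have h3 : ∀ n, charFun ((ENNReal.ofReal (K 0).re)⁻¹ • μ n) t =
          ((K 0).re⁻¹ : ℝ) * gaussReg K (((n : ℝ) + 1)⁻¹) ((2 * Real.pi)⁻¹ • t) := by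
        intro n
        rw [charFun_apply, integral_smul_measure, ← charFun_apply, hμ, ENNReal.toReal_inv,
          ENNReal.toReal_ofReal hpos.le, Complex.real_smul]
      simp only [ProbabilityMeasure.coe_mk, h3]
      exact (tendsto_gaussReg K _).const_mul _)
  refine ⟨ENNReal.ofReal (K 0).re • (ν : Measure E),
    Measure.smul_finite _ ENNReal.ofReal_ne_top, fun t => ?_⟩
  have h4 := hν t
  rw [charFun_apply] at h4
  rw [charFun_apply, integral_smul_measure, h4, ENNReal.toReal_ofReal hpos.le, Complex.real_smul,
    ← mul_assoc, ← Complex.ofReal_mul, mul_inv_cancel₀ hpos.ne', Complex.ofReal_one, one_mul]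

end BochnerMeasure

/-! ### Bochner's theorem and Fourier uniqueness on the dual space -/

section BochnerDual

variable {V : Type*} [NormedAddCommGroup V] [NormedSpace ℝ V] [FiniteDimensional ℝ V]

/-- **Bochner's theorem** for the covariance of a stationary field. -/
theorem IsStationaryField.exists_measure [MeasurableSpace V] [BorelSpace V]
    {S : Type*} [MeasurableSpace S] {Q : Measure S}
    [IsProbabilityMeasure Q] {Y : V → S → ℂ} {K : V → ℂ} (h : IsStationaryField Q Y K) :
    ∃ μ : Measure (V →L[ℝ] ℝ), IsFiniteMeasure μ ∧
      ∀ v, K v = ∫ ξ : V →L[ℝ] ℝ, Complex.exp (2 * Real.pi * Complex.I * (ξ v : ℝ)) ∂μ := by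
  have hdim : Module.finrank ℝ V = Module.finrank ℝ
      (EuclideanSpace ℝ (Fin (Module.finrank ℝ V))) := by simp
  let e : V ≃L[ℝ] EuclideanSpace ℝ (Fin (Module.finrank ℝ V)) :=
    ContinuousLinearEquiv.ofFinrankEq hdim
  have h' : IsStationaryField Q (fun x => Y (e.symm x)) (fun x => K (e.symm x)) := by
    refine ⟨?_, fun u => h.memLp _, fun u v => ?_, h.continuous.comp e.symm.continuous⟩
    · exact h.measurable.comp
        ((e.symm.continuous.measurable.comp measurable_fst).prodMk measurable_snd)
    · rw [h.cov, map_sub]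
  obtain ⟨μ, hfin, hμ⟩ := exists_measure_charFun_eq h'
  -- Linear coordinates `e` on `V` turn a Euclidean frequency `x` into the linear form `⟨x, e ·⟩`.
  let T : EuclideanSpace ℝ (Fin (Module.finrank ℝ V)) → (V →L[ℝ] ℝ) :=
    fun x => (innerSL ℝ x).comp (e : V →L[ℝ] EuclideanSpace ℝ (Fin (Module.finrank ℝ V)))
  have hT : Continuous T := by fun_prop
  refine ⟨μ.map T, inferInstance, fun v => ?_⟩
  have hexp : Continuous fun ξ : V →L[ℝ] ℝ =>
      Complex.exp (2 * Real.pi * Complex.I * (ξ v : ℝ)) := by fun_prop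
  rw [integral_map hT.measurable.aemeasurable hexp.aestronglyMeasurable]
  have h1 := hμ ((2 * Real.pi) • e v)
  rw [inv_smul_smul₀ (by positivity), e.symm_apply_apply] at h1
  rw [← h1, charFun_apply]
  refine integral_congr_ae (Filter.Eventually.of_forall fun x => ?_)
  simp only [T, inner_smul_right, ContinuousLinearMap.comp_apply, innerSL_apply_apply,
    ContinuousLinearEquiv.coe_coe]
  congr 1
  push_cast
  ring

/-- Finite measures on the dual are determined by their Fourier transforms. -/
theorem measure_dual_ext {μ ν : Measure (V →L[ℝ] ℝ)} [IsFiniteMeasure μ] [IsFiniteMeasure ν]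
    (h : ∀ v : V, ∫ ξ : V →L[ℝ] ℝ, Complex.exp (2 * Real.pi * Complex.I * (ξ v : ℝ)) ∂μ =
      ∫ ξ : V →L[ℝ] ℝ, Complex.exp (2 * Real.pi * Complex.I * (ξ v : ℝ)) ∂ν) : μ = ν := by
  refine Measure.ext_of_charFunDual (funext fun L => ?_)
  -- Reflexivity in finite dimension: each linear form on the dual is evaluation at a vector.
  obtain ⟨v, hv⟩ : ∃ v : V, ∀ ξ : V →L[ℝ] ℝ, L ξ = ξ v := by
    obtain ⟨v, hv⟩ := (Module.evalEquiv ℝ V).surjective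
      ((L : (V →L[ℝ] ℝ) →ₗ[ℝ] ℝ).comp (LinearMap.toContinuousLinearMap :
        (V →ₗ[ℝ] ℝ) ≃ₗ[ℝ] (V →L[ℝ] ℝ)).toLinearMap)
    refine ⟨v, fun ξ => ?_⟩
    have := LinearMap.congr_fun hv (ξ : V →ₗ[ℝ] ℝ)
    exact this.symm
  have h1 := h ((2 * Real.pi)⁻¹ • v)
  rw [charFunDual_apply, charFunDual_apply]
  have h2 : ∀ ξ : V →L[ℝ] ℝ, 2 * Real.pi * Complex.I * ((ξ ((2 * Real.pi)⁻¹ • v) : ℝ) : ℂ) =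
      L ξ * Complex.I := by
    intro ξ
    rw [hv, map_smul, smul_eq_mul]
    push_cast
    have : (Real.pi : ℂ) ≠ 0 := by exact_mod_cast Real.pi_ne_zero
    field_simp
  simpa only [h2] using h1

end BochnerDual

/-! ### Linear relations between Fourier transforms of measures -/

section FourierCombination

variable {V : Type*} [NormedAddCommGroup V] [NormedSpace ℝ V]

theorem integrable_exp_eval (μ : Measure (V →L[ℝ] ℝ)) [IsFiniteMeasure μ] (v : V) :
    Integrable (fun ξ : V →L[ℝ] ℝ => Complex.exp (2 * Real.pi * Complex.I * (ξ v : ℝ))) μ := by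
  refine (integrable_const (1 : ℝ)).mono'
    (Continuous.aestronglyMeasurable (by fun_prop)) (Filter.Eventually.of_forall fun ξ => ?_)
  have : 2 * Real.pi * Complex.I * ((ξ v : ℝ) : ℂ) = ((2 * Real.pi * ξ v : ℝ) : ℂ) * Complex.I := by
    push_cast; ring
  rw [this, Complex.norm_exp_ofReal_mul_I]

theorem conj_integral_exp_eval (μ : Measure (V →L[ℝ] ℝ)) (v : V) :
    (starRingEnd ℂ) (∫ ξ : V →L[ℝ] ℝ, Complex.exp (2 * Real.pi * Complex.I * (ξ v : ℝ)) ∂μ) =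
      ∫ ξ : V →L[ℝ] ℝ, Complex.exp (2 * Real.pi * Complex.I * (ξ (-v) : ℝ)) ∂μ := by
  rw [← integral_conj]
  refine integral_congr_ae (Filter.Eventually.of_forall fun ξ => ?_)
  simp only [← Complex.exp_conj, map_mul, Complex.conj_I, Complex.conj_ofReal, map_neg,
    Complex.ofReal_neg]
  congr 1
  rw [map_ofNat]
  ring

variable [FiniteDimensional ℝ V]

omit [FiniteDimensional ℝ V] in
theorem integral_smul_sum_measure {ι : Type*} (s : Finset ι) (μ : ι → Measure (V →L[ℝ] ℝ))
    (c : ι → NNReal) {g : (V →L[ℝ] ℝ) → ℂ}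
    (hg : ∀ i, Integrable g (μ i)) :
    ∫ ξ, g ξ ∂(∑ i ∈ s, c i • μ i) = ∑ i ∈ s, (c i : ℂ) * ∫ ξ, g ξ ∂(μ i) := by
  rw [integral_finsetSum_measure fun i _ => (hg i).smul_measure_nnreal]
  refine Finset.sum_congr rfl fun i _ => ?_
  rw [integral_smul_nnreal_measure]
  rfl

/-- Grouping positive and negative coefficients gives two finite measures with equal Fourier
transforms. -/
theorem sum_measureReal_eq_zero_of_real {ι : Type*} (s : Finset ι)
    (μ : ι → Measure (V →L[ℝ] ℝ)) (hμ : ∀ i, IsFiniteMeasure (μ i)) (a : ι → ℝ)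
    (h : ∀ v : V, ∑ i ∈ s, (a i : ℂ) *
      ∫ ξ : V →L[ℝ] ℝ, Complex.exp (2 * Real.pi * Complex.I * (ξ v : ℝ)) ∂(μ i) = 0)
    (B : Set (V →L[ℝ] ℝ)) : ∑ i ∈ s, a i * (μ i).real B = 0 := by
  have hfin : ∀ c : ι → NNReal, IsFiniteMeasure (∑ i ∈ s, c i • μ i) := by
    intro c
    infer_instance
  have hkey : ∑ i ∈ s, (a i).toNNReal • μ i = ∑ i ∈ s, (-a i).toNNReal • μ i := by
    have := hfin fun i => (a i).toNNReal
    have := hfin fun i => (-a i).toNNReal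
    refine measure_dual_ext fun v => ?_
    rw [integral_smul_sum_measure s μ _ fun i => integrable_exp_eval _ v,
      integral_smul_sum_measure s μ _ fun i => integrable_exp_eval _ v, ← sub_eq_zero,
      ← Finset.sum_sub_distrib, ← h v]
    refine Finset.sum_congr rfl fun i _ => ?_
    rw [← sub_mul]
    congr 1
    have h1 : (((a i).toNNReal : ℝ)) - ((-a i).toNNReal : ℝ) = a i := by
      rw [Real.coe_toNNReal', Real.coe_toNNReal']
      rcases le_total 0 (a i) with h | h
      · rw [max_eq_left h, max_eq_right (by linarith)]; ring
      · rw [max_eq_right h, max_eq_left (by linarith)]; ring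
    exact_mod_cast congrArg (fun x : ℝ => (x : ℂ)) h1
  have hreal : ∀ c : ι → NNReal, (∑ i ∈ s, c i • μ i).real B = ∑ i ∈ s, (c i : ℝ) * (μ i).real B := by
    intro c
    rw [measureReal_def, Measure.finsetSum_apply, ENNReal.toReal_sum]
    · refine Finset.sum_congr rfl fun i _ => ?_
      rw [Measure.smul_apply, ENNReal.smul_def, smul_eq_mul, ENNReal.toReal_mul]
      rfl
    · intro i _
      rw [Measure.smul_apply, ENNReal.smul_def, smul_eq_mul]
      exact ENNReal.mul_ne_top ENNReal.coe_ne_top (measure_ne_top _ _)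
  have h2 := congrArg (fun ν : Measure (V →L[ℝ] ℝ) => ν.real B) hkey
  simp only [hreal] at h2
  rw [← sub_eq_zero, ← Finset.sum_sub_distrib] at h2
  rw [← h2]
  refine Finset.sum_congr rfl fun i _ => ?_
  rw [← sub_mul]
  congr 1
  rw [Real.coe_toNNReal', Real.coe_toNNReal']
  rcases le_total 0 (a i) with h | h
  · rw [max_eq_left h, max_eq_right (by linarith)]; ring
  · rw [max_eq_right h, max_eq_left (by linarith)]; ring

/-- Conjugating the relation at `-v` yields the same relation with conjugate coefficients, so the
real and imaginary parts of the coefficients satisfy it separately. -/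
theorem sum_measureReal_eq_zero {ι : Type*} (s : Finset ι)
    (μ : ι → Measure (V →L[ℝ] ℝ)) (hμ : ∀ i, IsFiniteMeasure (μ i)) (c : ι → ℂ)
    (h : ∀ v : V, ∑ i ∈ s, c i *
      ∫ ξ : V →L[ℝ] ℝ, Complex.exp (2 * Real.pi * Complex.I * (ξ v : ℝ)) ∂(μ i) = 0)
    (B : Set (V →L[ℝ] ℝ)) : ∑ i ∈ s, c i * ((μ i).real B : ℂ) = 0 := by
  have hconj : ∀ v : V, ∑ i ∈ s, (starRingEnd ℂ) (c i) *
      ∫ ξ : V →L[ℝ] ℝ, Complex.exp (2 * Real.pi * Complex.I * (ξ v : ℝ)) ∂(μ i) = 0 := by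
    intro v
    have h1 := congrArg (starRingEnd ℂ) (h (-v))
    rw [map_sum, map_zero] at h1
    rw [← h1]
    refine Finset.sum_congr rfl fun i _ => ?_
    rw [map_mul, conj_integral_exp_eval, neg_neg]
  have hre := sum_measureReal_eq_zero_of_real s μ hμ (fun i => (c i).re) (fun v => by
    have h1 := congrArg (fun x : ℂ => x / 2) (congrArg₂ (· + ·) (h v) (hconj v))
    simp only [← Finset.sum_add_distrib, ← add_mul, Complex.add_conj, add_zero, zero_div,
      Finset.sum_div] at h1
    rw [← h1]
    refine Finset.sum_congr rfl fun i _ => ?_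
    push_cast; ring) B
  have him := sum_measureReal_eq_zero_of_real s μ hμ (fun i => (c i).im) (fun v => by
    have h1 := congrArg (fun x : ℂ => x / (2 * Complex.I)) (congrArg₂ (· - ·) (h v) (hconj v))
    simp only [← Finset.sum_sub_distrib, ← sub_mul, Complex.sub_conj, sub_zero, zero_div,
      Finset.sum_div] at h1
    rw [← h1]
    refine Finset.sum_congr rfl fun i _ => ?_
    have := Complex.I_ne_zero
    push_cast; field_simp) B
  apply Complex.ext
  · simpa [Complex.re_sum] using hre
  · simpa [Complex.im_sum] using him

end FourierCombination

/-! ### Evaluation functionals -/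

section Evaluation

variable {W : Type*} [NormedAddCommGroup W] [NormedSpace ℝ W]

/-- Evaluation of complex-valued linear forms at a vector. -/
def evalLinear (w : W) : (W →L[ℝ] ℂ) →ₗ[ℂ] ℂ where
  toFun ℓ := ℓ w
  map_add' _ _ := rfl
  map_smul' _ _ := rfl

/-- Evaluation of complex-valued multilinear forms at a family of vectors. -/
def evalForm {q : ℕ} (w : Fin q → W) : (W [×q]→L[ℝ] ℂ) →ₗ[ℂ] ℂ where
  toFun T := T w
  map_add' _ _ := rfl
  map_smul' _ _ := rfl

theorem evalForm_apply {q : ℕ} (w : Fin q → W) (T : W [×q]→L[ℝ] ℂ) : evalForm w T = T w := rfl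

end Evaluation

/-! ### Existence and uniqueness of positive Hermitian measures -/

namespace PosHermitianMeasure

section Ext

variable {E : Type*} [MeasurableSpace E] {U : Type*} [AddCommGroup U] [Module ℂ U]

theorem ext_diag {μ ν : PosHermitianMeasure E U} (h : ∀ u, μ.diag u = ν.diag u) : μ = ν := by
  obtain ⟨d, _, _⟩ := μ
  obtain ⟨d', _, _⟩ := ν
  obtain rfl : d = d' := funext h
  rfl

end Ext

section Existence

variable {V : Type*} [NormedAddCommGroup V] [NormedSpace ℝ V] [FiniteDimensional ℝ V]
variable {U : Type*} [AddCommGroup U] [Module ℂ U]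

/-- The polarization of a quadratic form at `(u, w)`, as a formal combination of vectors. -/
def polarization (u w : U) : U →₀ ℂ :=
  ∑ k ∈ Finset.range 4, Finsupp.single (u + Complex.I ^ k • w) (Complex.I ^ k / 4)

/-- The four-point polarization identity. Keeping it as a formal combination of vectors allows the
same coefficients to be applied to the kernels and to the measures. -/
theorem linearCombination_polarization (B : U →ₗ[ℂ] U →ₗ⋆[ℂ] ℂ) (u w : U) :
    Finsupp.linearCombination ℂ (fun u => B u u) (polarization u w) = B u w := by
  simp only [polarization, Finset.sum_range_succ, Finset.range_zero, Finset.sum_empty, map_add,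
    Finsupp.linearCombination_single, map_smul, map_smulₛₗ, smul_eq_mul, pow_zero, pow_one,
    LinearMap.add_apply, LinearMap.smul_apply, one_smul, map_pow, zero_add,
    Complex.conj_I]
  have h2 : Complex.I ^ 2 = -1 := Complex.I_sq
  have h3 : Complex.I ^ 3 = -Complex.I := Complex.I_pow_three
  have h4 : (-Complex.I) ^ 3 = Complex.I := by rw [Odd.neg_pow (by decide), h3, neg_neg]
  have h5 : (-Complex.I) ^ 2 = -1 := by rw [neg_sq, h2]
  simp only [h2, h3, h4, h5]
  linear_combination (-(1 : ℂ) / 2 * B u w  + (1 : ℂ) / 2 * B w u) * h2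

/-- A family of kernels, sesquilinear in a parameter and with non-negative spectral measures on
the diagonal, is represented by a positive Hermitian measure. -/
theorem exists_of_kernel (K : V → U →ₗ[ℂ] U →ₗ⋆[ℂ] ℂ)
    (h : ∀ u, ∃ μ : Measure (V →L[ℝ] ℝ), IsFiniteMeasure μ ∧ ∀ v,
      K v u u = ∫ ξ : V →L[ℝ] ℝ, Complex.exp (2 * Real.pi * Complex.I * (ξ v : ℝ)) ∂μ) :
    ∃ M : PosHermitianMeasure (V →L[ℝ] ℝ) U, ∀ u v, K v u u =
      ∫ ξ : V →L[ℝ] ℝ, Complex.exp (2 * Real.pi * Complex.I * (ξ v : ℝ)) ∂(M.diag u) := by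
  choose μ hfin hμ using h
  refine ⟨⟨μ, hfin, fun s _ => ?_⟩, hμ⟩
  set Λ : (U →₀ ℂ) →ₗ[ℂ] ℂ := Finsupp.linearCombination ℂ fun u => (((μ u).real s : ℝ) : ℂ) with hΛ
  -- A relation valid for the kernels at every `v` is one between Fourier transforms, hence holds
  -- for the measures of `s`. Each axiom of sesquilinearity is inherited this way.
  have hker : ∀ x y : U →₀ ℂ, (∀ v, Finsupp.linearCombination ℂ (fun u => K v u u) x =
      Finsupp.linearCombination ℂ (fun u => K v u u) y) → Λ x = Λ y := by
    intro x y hx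
    rw [← sub_eq_zero, ← map_sub, hΛ, Finsupp.linearCombination_apply, Finsupp.sum]
    refine sum_measureReal_eq_zero _ μ hfin (x - y) (fun v => ?_) s
    simp only [← hμ]
    have := hx v
    rw [← sub_eq_zero, ← map_sub, Finsupp.linearCombination_apply, Finsupp.sum] at this
    exact this
  refine ⟨LinearMap.mk₂'ₛₗ (RingHom.id ℂ) (starRingEnd ℂ) (fun u w => Λ (polarization u w))
    ?_ ?_ ?_ ?_, ?_⟩
  · intro u u' w
    rw [← map_add]
    refine hker _ _ fun v => ?_
    simp [linearCombination_polarization]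
  · intro c u w
    rw [RingHom.id_apply, ← map_smul]
    refine hker _ _ fun v => ?_
    simp [linearCombination_polarization]
  · intro u w w'
    rw [← map_add]
    refine hker _ _ fun v => ?_
    simp [linearCombination_polarization]
  · intro c u w
    rw [← map_smul]
    refine hker _ _ fun v => ?_
    simp [linearCombination_polarization]
  · intro u
    have : Λ (Finsupp.single u 1) = (((μ u).real s : ℝ) : ℂ) := by simp [hΛ]
    rw [← this]
    refine hker _ _ fun v => ?_
    simp [linearCombination_polarization]

/-- The positive Hermitian measure of a field with values in the linear forms on `U`. -/
theorem exists_of_field [MeasurableSpace V] [BorelSpace V] {S : Type*} [MeasurableSpace S]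
    {Q : Measure S} [IsProbabilityMeasure Q] (A : V → S → (U →ₗ[ℂ] ℂ))
    (h : ∀ u, ∃ K : V → ℂ, IsStationaryField Q (fun v ω => A v ω u) K) :
    ∃ M : PosHermitianMeasure (V →L[ℝ] ℝ) U, ∀ u v w,
      ∫ ω, A v ω u * (starRingEnd ℂ) (A w ω u) ∂Q =
      ∫ ξ : V →L[ℝ] ℝ, Complex.exp (2 * Real.pi * Complex.I * (ξ (v - w) : ℝ)) ∂(M.diag u) := by
  have hmem : ∀ v u, MemLp (fun ω => A v ω u) 2 Q := fun v u => by
    obtain ⟨K, hK⟩ := h u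
    exact hK.memLp v
  have hint : ∀ v u w, Integrable (fun ω => A v ω u * (starRingEnd ℂ) (A 0 ω w)) Q :=
    fun v u w => (hmem v u).integrable_mul (hmem 0 w).star
  let B : V → U →ₗ[ℂ] U →ₗ⋆[ℂ] ℂ := fun v =>
    LinearMap.mk₂'ₛₗ (RingHom.id ℂ) (starRingEnd ℂ)
      (fun u w => ∫ ω, A v ω u * (starRingEnd ℂ) (A 0 ω w) ∂Q)
      (fun u u' w => by
        simp only [map_add, add_mul]
        exact integral_add (hint _ _ _) (hint _ _ _))
      (fun c u w => by
        simp only [map_smul, smul_eq_mul, mul_assoc, RingHom.id_apply]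
        exact integral_const_mul _ _)
      (fun u w w' => by
        simp only [map_add, mul_add]
        exact integral_add (hint _ _ _) (hint _ _ _))
      (fun c u w => by
        simp only [map_smul, smul_eq_mul, map_mul, mul_left_comm _ ((starRingEnd ℂ) c)]
        exact integral_const_mul _ _)
  have hB : ∀ u K, IsStationaryField Q (fun v ω => A v ω u) K → ∀ v, B v u u = K v := by
    intro u K hK v
    have := hK.cov v 0
    rw [sub_zero] at this
    exact this
  obtain ⟨M, hM⟩ := exists_of_kernel B fun u => by
    obtain ⟨K, hK⟩ := h u
    obtain ⟨μ, hfin, hμ⟩ := hK.exists_measure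
    exact ⟨μ, hfin, fun v => (hB u K hK v).trans (hμ v)⟩
  refine ⟨M, fun u v w => ?_⟩
  obtain ⟨K, hK⟩ := h u
  rw [hK.cov v w, ← hB u K hK, hM]

end Existence

section TensorUniqueness

theorem sesquilin_eq_zero_of_diag {A : Type*} [AddCommGroup A] [Module ℂ A]
    (φ : A →ₗ[ℂ] A →ₗ⋆[ℂ] ℂ) (h : ∀ a, φ a a = 0) (a b : A) : φ a b = 0 := by
  rw [← linearCombination_polarization]
  simp [h, Finsupp.linearCombination_apply]

/-- A sesquilinear form vanishing on the diagonal of decomposable tensors vanishes on pairs of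
decomposable tensors. -/
theorem sesquilin_multilinear_eq_zero {A U : Type*} [AddCommGroup A] [Module ℂ A] [AddCommGroup U]
    [Module ℂ U] {q : ℕ} (t : MultilinearMap ℂ (fun _ : Fin q => A) U)
    (D : U →ₗ[ℂ] U →ₗ⋆[ℂ] ℂ) (h : ∀ ℓ, D (t ℓ) (t ℓ) = 0) (J : Finset (Fin q)) :
    ∀ ℓ m : Fin q → A, (∀ k ∉ J, ℓ k = m k) → D (t ℓ) (t m) = 0 := by
  induction J using Finset.induction_on with
  | empty =>
    intro ℓ m hlm
    obtain rfl : ℓ = m := funext fun k => hlm k (Finset.notMem_empty k)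
    exact h ℓ
  | insert k J hk ih =>
    intro ℓ m hlm
    -- Free slot `k` on both sides. With equal entries there, the arguments differ only inside `J`,
    -- so the induction hypothesis kills the diagonal, and polarization does the rest.
    let φ : A →ₗ[ℂ] A →ₗ⋆[ℂ] ℂ :=
      (D.comp (t.toLinearMap ℓ k)).compl₂ (t.toLinearMap m k)
    have hφ : ∀ a b, φ a b = D (t (Function.update ℓ k a)) (t (Function.update m k b)) :=
      fun a b => rfl
    have hdiag : ∀ a, φ a a = 0 := by
      intro a
      rw [hφ]
      refine ih _ _ fun j hj => ?_
      by_cases hjk : j = k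
      · subst hjk; simp
      · rw [Function.update_of_ne hjk, Function.update_of_ne hjk]
        exact hlm j (by simp [hjk, hj])
    have := sesquilin_eq_zero_of_diag φ hdiag (ℓ k) (m k)
    rwa [hφ, Function.update_eq_self, Function.update_eq_self] at this

variable {W : Type*} [NormedAddCommGroup W] [NormedSpace ℝ W]

/-- `tensorForm` for complex-valued linear forms, as a multilinear map. -/
def tensorFormComplex (W : Type*) [NormedAddCommGroup W] [NormedSpace ℝ W] (q : ℕ) :
    MultilinearMap ℂ (fun _ : Fin q => W →L[ℝ] ℂ) (W [×q]→L[ℝ] ℂ) where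
  toFun := tensorForm
  map_update_add' m i x y := by
    ext w
    simp only [tensorForm_apply, add_apply]
    simpa only [MultilinearMap.compLinearMap_apply, MultilinearMap.mkPiAlgebra_apply]
      using! MultilinearMap.map_update_add
        ((MultilinearMap.mkPiAlgebra ℂ (Fin q) ℂ).compLinearMap fun k => evalLinear (w k)) m i x y
  map_update_smul' m i c x := by
    ext w
    simp only [tensorForm_apply, smul_apply]
    simpa only [MultilinearMap.compLinearMap_apply, MultilinearMap.mkPiAlgebra_apply]
      using! MultilinearMap.map_update_smul
        ((MultilinearMap.mkPiAlgebra ℂ (Fin q) ℂ).compLinearMap fun k => evalLinear (w k)) m i c x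

theorem tensorFormComplex_apply {q : ℕ} (ℓ : Fin q → (W →L[ℝ] ℂ)) :
    tensorFormComplex W q ℓ = tensorForm ℓ := rfl

/-- A positive Hermitian measure over the `q`-linear forms is determined by its values on
decomposable tensors. -/
theorem ext_tensorForm [FiniteDimensional ℝ W] {E : Type*} [MeasurableSpace E] {q : ℕ}
    {M N : PosHermitianMeasure E (W [×q]→L[ℝ] ℂ)}
    (h : ∀ ℓ : Fin q → (W →L[ℝ] ℂ), M.diag (tensorForm ℓ) = N.diag (tensorForm ℓ)) : M = N := by
  refine ext_diag fun T => ?_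
  refine Measure.ext fun s hs => ?_
  obtain ⟨B, hB⟩ := M.sesq s hs
  obtain ⟨C, hC⟩ := N.sesq s hs
  have hzero : ∀ ℓ m : Fin q → (W →L[ℝ] ℂ), (B - C) (tensorForm ℓ) (tensorForm m) = 0 := by
    intro ℓ m
    refine sesquilin_multilinear_eq_zero (tensorFormComplex W q) (B - C) (fun ℓ => ?_)
      Finset.univ ℓ m (fun k hk => absurd (Finset.mem_univ k) hk)
    rw [tensorFormComplex_apply, LinearMap.sub_apply, LinearMap.sub_apply, hB, hC, h ℓ, sub_self]
  have hT : (B - C) T T = 0 := by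
    have h1 := complexForm_eq_sum_tensorForm (Module.finBasis ℝ W) T
    rw [h1]
    simp only [map_sum, map_smul, map_smulₛₗ, LinearMap.sum_apply, LinearMap.smul_apply, hzero,
      smul_zero, Finset.sum_const_zero]
  rw [LinearMap.sub_apply, LinearMap.sub_apply, hB, hC, sub_eq_zero] at hT
  have hfM := M.finite T
  have hfN := N.finite T
  have h2 : (M.diag T).real s = (N.diag T).real s := by exact_mod_cast hT
  exact (measureReal_eq_measureReal_iff).1 h2

end TensorUniqueness

end PosHermitianMeasure

/-! ### The spectral measure and its convolution powers -/

section SpectralMeasure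

variable {V W S : Type*} [NormedAddCommGroup V] [NormedSpace ℝ V] [FiniteDimensional ℝ V]
  [MeasurableSpace V] [BorelSpace V]
  [NormedAddCommGroup W] [NormedSpace ℝ W] [FiniteDimensional ℝ W]
  [MeasurableSpace W] [BorelSpace W] [MeasurableSpace S]

/-- A jointly measurable second order stationary vector field with continuous covariance. -/
structure IsSecondOrderStationary (P : Measure S) (X : V → S → W) : Prop where
  measurable : Measurable fun p : V × S => X p.1 p.2
  memLp : ∀ v (ℓ : W →L[ℝ] ℝ), MemLp (fun ω => ℓ (X v ω)) 2 P
  cov : ∀ (ℓ m : W →L[ℝ] ℝ) (u v : V),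
    ∫ ω, ℓ (X u ω) * m (X v ω) ∂P = ∫ ω, ℓ (X (u - v) ω) * m (X 0 ω) ∂P
  continuous : ∀ ℓ m : W →L[ℝ] ℝ, Continuous fun v : V => ∫ ω, ℓ (X v ω) * m (X 0 ω) ∂P

/-- The conjugate of a complex multilinear form. -/
def conjForm {q : ℕ} (T : W [×q]→L[ℝ] ℂ) : W [×q]→L[ℝ] ℂ :=
  (Complex.conjCLE : ℂ →L[ℝ] ℂ).compContinuousMultilinearMap T

omit [FiniteDimensional ℝ W] [MeasurableSpace W] [BorelSpace W] in
theorem conjForm_apply {q : ℕ} (T : W [×q]→L[ℝ] ℂ) (w : Fin q → W) :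
    conjForm T w = (starRingEnd ℂ) (T w) := rfl

omit [FiniteDimensional ℝ W] [MeasurableSpace W] [BorelSpace W] in
theorem conjForm_tensorForm {q : ℕ} (ℓ : Fin q → (W →L[ℝ] ℂ)) :
    conjForm (tensorForm ℓ) = tensorForm fun k => (Complex.conjCLE : ℂ →L[ℝ] ℂ) ∘L ℓ k := by
  ext w
  simp [conjForm_apply, tensorForm_apply]

namespace IsSecondOrderStationary

variable {P : Measure S} [IsProbabilityMeasure P] {X : V → S → W}

omit [NormedSpace ℝ V] [FiniteDimensional ℝ V] [BorelSpace V] in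
/-- The field obtained by evaluating a form on independent copies of a stationary field. -/
theorem isStationaryField_form (h : IsSecondOrderStationary P X) {q : ℕ} (T : W [×q]→L[ℝ] ℂ) :
    IsStationaryField (Measure.pi fun _ : Fin q => P) (fun v ω => T fun k => X v (ω k))
      (fun v => ∫ ω : Fin q → S, T (fun k => X v (ω k)) * (starRingEnd ℂ) (T fun k => X 0 (ω k))
        ∂(Measure.pi fun _ => P)) := by
  have hm : Measurable fun p : V × (Fin q → S) => T fun k => X p.1 (p.2 k) := by
    refine T.cont.measurable.comp (measurable_pi_lambda _ fun k => ?_)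
    exact h.measurable.comp
      (measurable_fst.prodMk ((measurable_pi_apply k).comp measurable_snd))
  refine ⟨hm, fun u => ?_, fun u v => ?_, ?_⟩
  · refine (memLp_two_iff_integrable_sq_norm
      (hm.comp measurable_prodMk_left).aestronglyMeasurable).2 ?_
    refine (integrable_form_mul (h.memLp u) (h.memLp u) T (conjForm T)).norm.congr
      (Filter.Eventually.of_forall fun ω => ?_)
    simp only [conjForm_apply, norm_mul, RCLike.norm_conj, pow_two]
    rfl
  · simp only [← conjForm_apply]
    rw [integral_form_mul (h.memLp u) (h.memLp v) (Module.finBasis ℝ W),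
      integral_form_mul (h.memLp (u - v)) (h.memLp 0) (Module.finBasis ℝ W)]
    simp only [h.cov _ _ u v]
  · simp only [← conjForm_apply, fun v =>
      integral_form_mul (h.memLp v) (h.memLp 0) (Module.finBasis ℝ W) T (conjForm T)]
    refine continuous_finsetSum _ fun i _ => continuous_finsetSum _ fun j _ => ?_
    exact (continuous_finsetProd _ fun k _ => h.continuous _ _).smul continuous_const

-- The case `q = 1` of `isStationaryField_form`, with the single copy identified with the original
-- space.
omit [NormedSpace ℝ V] [FiniteDimensional ℝ V] [BorelSpace V] in
theorem isStationaryField_linear (h : IsSecondOrderStationary P X) (ℓ : W →L[ℝ] ℂ) :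
    IsStationaryField P (fun v ω => ℓ (X v ω))
      (fun v => ∫ ω, ℓ (X v ω) * (starRingEnd ℂ) (ℓ (X 0 ω)) ∂P) := by
  have h1 := h.isStationaryField_form (tensorForm fun _ : Fin 1 => ℓ)
  have h2 : ∀ u v, ∫ ω : Fin 1 → S, tensorForm (fun _ : Fin 1 => ℓ) (fun k => X u (ω k)) *
      (starRingEnd ℂ) (tensorForm (fun _ : Fin 1 => ℓ) (fun k => X v (ω k)))
        ∂(Measure.pi fun _ => P) = ∫ ω, ℓ (X u ω) * (starRingEnd ℂ) (ℓ (X v ω)) ∂P := by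
    intro u v
    simp only [← conjForm_apply, conjForm_tensorForm]
    rw [integral_tensorForm_mul]
    simp
  refine ⟨ℓ.cont.measurable.comp h.measurable, fun u => ?_, fun u v => ?_, ?_⟩
  · have hre := (h.memLp u (Complex.reCLM ∘L ℓ)).ofReal (K := ℂ)
    have him := ((h.memLp u (Complex.imCLM ∘L ℓ)).ofReal (K := ℂ)).mul_const Complex.I
    refine (hre.add him).ae_eq (Filter.Eventually.of_forall fun ω => ?_)
    simp [Complex.re_add_im]
  · have := h1.cov u v
    rwa [h2, h2] at this
  · have := h1.continuous
    simpa only [h2] using this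

theorem existsUnique_isSpectralMeasure (h : IsSecondOrderStationary P X) :
    ∃! μ : PosHermitianMeasure (V →L[ℝ] ℝ) (W →L[ℝ] ℂ), IsSpectralMeasure P X μ := by
  obtain ⟨M, hM⟩ := PosHermitianMeasure.exists_of_field (Q := P)
    (fun (v : V) ω => evalLinear (X v ω))
    (fun ℓ => ⟨_, h.isStationaryField_linear ℓ⟩)
  refine ⟨M, fun ℓ u v => hM ℓ u v, fun N hN => PosHermitianMeasure.ext_diag fun ℓ => ?_⟩
  have := M.finite ℓ
  have := N.finite ℓ
  refine measure_dual_ext fun v => ?_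
  have h1 := hN ℓ v 0
  have h2 := hM ℓ v 0
  rw [sub_zero] at h1 h2
  exact h1.symm.trans h2

omit [MeasurableSpace V] [BorelSpace V] in
/-- The Fourier transform of a convolution is the product of the Fourier transforms. -/
theorem _root_.integral_exp_map_sum {q : ℕ} (μ : Fin q → Measure (V →L[ℝ] ℝ))
    (hμ : ∀ k, IsFiniteMeasure (μ k)) (v : V) :
    ∫ ξ : V →L[ℝ] ℝ, Complex.exp (2 * Real.pi * Complex.I * (ξ v : ℝ))
      ∂((Measure.pi μ).map fun ξ : Fin q → (V →L[ℝ] ℝ) => ∑ k, ξ k) =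
    ∏ k, ∫ ξ : V →L[ℝ] ℝ, Complex.exp (2 * Real.pi * Complex.I * (ξ v : ℝ)) ∂(μ k) := by
  have hexp : Continuous fun ξ : V →L[ℝ] ℝ =>
      Complex.exp (2 * Real.pi * Complex.I * (ξ v : ℝ)) := by fun_prop
  rw [integral_map (by fun_prop) hexp.aestronglyMeasurable, ← integral_fintype_prod_eq_prod]
  refine integral_congr_ae (Filter.Eventually.of_forall fun ξ => ?_)
  simp only [← Complex.exp_sum, sum_apply, Complex.ofReal_sum, Finset.mul_sum]

/-- The measure is built from the field `T(X¹_v, …, X^q_v)` on independent copies. For decomposable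
`T` the covariance is a product, which is the Fourier transform of the convolution. The second
conclusion retains the Fourier formula for every `T`, in particular for `f_q`. -/
theorem exists_isConvPow (h : IsSecondOrderStationary P X)
    {μ : PosHermitianMeasure (V →L[ℝ] ℝ) (W →L[ℝ] ℂ)} (hμ : IsSpectralMeasure P X μ) (q : ℕ) :
    ∃ M : PosHermitianMeasure (V →L[ℝ] ℝ) (W [×q]→L[ℝ] ℂ), IsConvPow q μ M ∧
      ∀ T u v, ∫ ω : Fin q → S, T (fun k => X u (ω k)) * (starRingEnd ℂ) (T fun k => X v (ω k))
        ∂(Measure.pi fun _ => P) =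
      ∫ ξ : V →L[ℝ] ℝ, Complex.exp (2 * Real.pi * Complex.I * (ξ (u - v) : ℝ)) ∂(M.diag T) := by
  obtain ⟨M, hM⟩ := PosHermitianMeasure.exists_of_field (Q := Measure.pi fun _ : Fin q => P)
    (fun (v : V) ω => evalForm fun k => X v (ω k))
    (fun T => ⟨_, h.isStationaryField_form T⟩)
  refine ⟨M, fun ℓ => ?_, fun T u v => hM T u v⟩
  have := M.finite (tensorForm ℓ)
  have hfin := fun k => μ.finite (ℓ k)
  refine measure_dual_ext fun v => ?_
  rw [integral_exp_map_sum _ hfin]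
  have h1 := hM (tensorForm ℓ) v 0
  rw [sub_zero] at h1
  rw [← h1]
  simp only [evalForm_apply, ← conjForm_apply, conjForm_tensorForm]
  rw [integral_tensorForm_mul]
  refine Finset.prod_congr rfl fun k _ => ?_
  have h2 := hμ (ℓ k) v 0
  rw [sub_zero] at h2
  exact h2

omit [FiniteDimensional ℝ V] [MeasurableSpace V] [BorelSpace V] [MeasurableSpace W]
  [BorelSpace W] in
theorem _root_.IsConvPow.unique {q : ℕ} {μ : PosHermitianMeasure (V →L[ℝ] ℝ) (W →L[ℝ] ℂ)}
    {M N : PosHermitianMeasure (V →L[ℝ] ℝ) (W [×q]→L[ℝ] ℂ)}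
    (hM : IsConvPow q μ M) (hN : IsConvPow q μ N) : M = N :=
  PosHermitianMeasure.ext_tensorForm fun ℓ => (hM ℓ).trans (hN ℓ).symm

end IsSecondOrderStationary

end SpectralMeasure

/-! ### Variance of a rescaled integral -/

section Variance

variable {V W S : Type*} [MeasurableSpace V] [MeasurableSpace W] [MeasurableSpace S]
    {vol : Measure V} {P : Measure S} [IsProbabilityMeasure P] {X : V → S → W} {η : Measure W}

/-- A weighted square-integrable function of a stationary field is a dominated field. -/
theorem dominatedField_comp (hmeas : Measurable fun p : V × S => X p.1 p.2)
    (hX : ∀ v, MeasurePreserving (X v) P η) {ψ : V → ℝ} (hψ : Integrable ψ vol) {g : W → ℝ}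
    (hg : MemLp g 2 η) : DominatedField vol P fun v ω => ψ v * g (X v ω) := by
  -- As each `X v` has law `η`, an `η`-null set has a null preimage under the joint map. This makes
  -- `g (X v ω)` jointly measurable up to null sets although `g` is only a.e. strongly measurable.
  have hq : Measure.QuasiMeasurePreserving (fun p : V × S => X p.1 p.2) (vol.prod P) η := by
    refine ⟨hmeas, Measure.AbsolutelyContinuous.mk fun s hs h0 => ?_⟩
    rw [Measure.map_apply hmeas hs, Measure.measure_prod_null (hmeas hs)]
    refine Filter.Eventually.of_forall fun v => ?_
    have := (hX v).measure_preimage hs.nullMeasurableSet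
    rw [h0] at this
    exact this
  have hint : ∀ v, ∫ ω, ‖g (X v ω)‖ ^ 2 ∂P = ∫ x, ‖g x‖ ^ 2 ∂η := fun v => by
    rw [← (hX v).map_eq, integral_map (hX v).measurable.aemeasurable]
    rw [(hX v).map_eq]
    exact (hg.1.norm.pow 2)
  refine ⟨?_, fun v => (hg.comp_measurePreserving (hX v)).const_mul _,
    fun v => |ψ v| * Real.sqrt (∫ x, ‖g x‖ ^ 2 ∂η), hψ.abs.mul_const _, fun v => by positivity,
    fun v => ?_⟩
  · exact (hψ.1.comp_fst).mul (hg.1.comp_quasiMeasurePreserving hq)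
  · simp only [norm_mul, mul_pow, Real.norm_eq_abs]
    rw [integral_const_mul, Real.sq_sqrt (integral_nonneg fun _ => by positivity)]
    simp only [← Real.norm_eq_abs, hint v, le_refl]

variable [NormedAddCommGroup V] [NormedSpace ℝ V] [FiniteDimensional ℝ V] [BorelSpace V]
    [vol.IsAddHaarMeasure]

theorem integrable_rescale {φ : V → ℝ} (hφ : Integrable φ vol) {lam : ℝ} (hlam : 0 < lam) :
    Integrable (fun v => φ (lam⁻¹ • v)) vol :=
  hφ.comp_smul (inv_ne_zero hlam.ne')

variable (hmeas : Measurable fun p : V × S => X p.1 p.2)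
  (hX : ∀ v, MeasurePreserving (X v) P η) {φ : V → ℝ} (hφ : Integrable φ vol)
  {lam : ℝ} (hlam : 0 < lam) {g : W → ℝ} (hg : MemLp g 2 η)

include hmeas hX hφ hlam hg

theorem ae_integrable_rescaled :
    ∀ᵐ ω ∂P, Integrable (fun v => φ (lam⁻¹ • v) * g (X v ω)) vol :=
  (dominatedField_comp hmeas hX (integrable_rescale hφ hlam) hg).ae_integrable

theorem memLp_rescaledIntegral : MemLp (rescaledIntegral vol X g φ lam) 2 P :=
  (dominatedField_comp hmeas hX (integrable_rescale hφ hlam) hg).memLp_integral.const_mul _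

theorem integrable_weighted_cov : Integrable (fun p : V × V =>
    φ (lam⁻¹ • p.1) * φ (lam⁻¹ • p.2) * ∫ ω, g (X p.1 ω) * g (X p.2 ω) ∂P) (vol.prod vol) := by
  refine (dominatedField_comp hmeas hX (integrable_rescale hφ hlam)
    hg).integrable_triple.integral_prod_left.congr (Filter.Eventually.of_forall fun p => ?_)
  simp only [conj_trivial]
  rw [← integral_const_mul]
  refine integral_congr_ae (Filter.Eventually.of_forall fun ω => ?_)
  simp only; ring

/-- The variance of a rescaled integral in terms of the covariance function. -/
theorem variance_rescaledIntegral :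
    Var[rescaledIntegral vol X g φ lam; P] = (1 / lam ^ ((Module.finrank ℝ V : ℝ) / 2)) ^ 2 *
      ∫ p : V × V, φ (lam⁻¹ • p.1) * φ (lam⁻¹ • p.2) *
        ((∫ ω, g (X p.1 ω) * g (X p.2 ω) ∂P) - (∫ x, g x ∂η) ^ 2) ∂(vol.prod vol) := by
  have hψ := integrable_rescale hφ hlam
  have hD := dominatedField_comp hmeas hX hψ hg
  have hmean : ∀ v, ∫ ω, g (X v ω) ∂P = ∫ x, g x ∂η := fun v => by
    rw [← (hX v).map_eq, integral_map (hX v).measurable.aemeasurable]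
    rw [(hX v).map_eq]
    exact hg.1
  have h1 : ∫ ω, rescaledIntegral vol X g φ lam ω ∂P =
      (1 / lam ^ ((Module.finrank ℝ V : ℝ) / 2)) *
        ((∫ v, φ (lam⁻¹ • v) ∂vol) * ∫ x, g x ∂η) := by
    simp only [rescaledIntegral]
    rw [integral_const_mul, hD.integral_integral, ← integral_mul_const]
    simp only [integral_const_mul, hmean]
  have h2 : ∫ ω, (rescaledIntegral vol X g φ lam ^ 2) ω ∂P =
      (1 / lam ^ ((Module.finrank ℝ V : ℝ) / 2)) ^ 2 *
        ∫ p : V × V, φ (lam⁻¹ • p.1) * φ (lam⁻¹ • p.2) *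
          ∫ ω, g (X p.1 ω) * g (X p.2 ω) ∂P ∂(vol.prod vol) := by
    have h3 := hD.integral_sq
    simp only [conj_trivial] at h3
    simp only [Pi.pow_apply, rescaledIntegral, mul_pow]
    rw [integral_const_mul]
    simp only [← pow_two] at h3
    rw [h3]
    congr 1
    refine integral_congr_ae (Filter.Eventually.of_forall fun p => ?_)
    simp only
    rw [← integral_const_mul]
    refine integral_congr_ae (Filter.Eventually.of_forall fun ω => ?_)
    simp only; ring
  rw [variance_eq_sub (memLp_rescaledIntegral hmeas hX hφ hlam hg), h1, h2]
  simp only [mul_sub]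
  rw [integral_sub (integrable_weighted_cov hmeas hX hφ hlam hg)
    ((hψ.mul_prod hψ).mul_const _), integral_mul_const,
    integral_prod_mul (fun v => φ (lam⁻¹ • v)) fun v => φ (lam⁻¹ • v)]
  ring

end Variance

/-! ### The weight `γ_λ` and the spectral integral -/

section Gamma

variable {V : Type*} [NormedAddCommGroup V] [NormedSpace ℝ V] [FiniteDimensional ℝ V]
    [MeasurableSpace V] [BorelSpace V] {vol : Measure V} [vol.IsAddHaarMeasure]
    {φ : V → ℝ} {lam : ℝ}

theorem integral_exp_rescale (hlam : 0 < lam) (ξ : V →L[ℝ] ℝ) :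
    ∫ v, Complex.exp (-(2 * Real.pi * Complex.I * (ξ v : ℝ))) * (φ (lam⁻¹ • v) : ℂ) ∂vol =
      ((lam ^ Module.finrank ℝ V : ℝ) : ℂ) *
      ∫ v, Complex.exp (-(2 * Real.pi * Complex.I * ((lam • ξ) v : ℝ))) * (φ v : ℂ) ∂vol := by
  have h := Measure.integral_comp_inv_smul vol (fun v =>
    Complex.exp (-(2 * Real.pi * Complex.I * ((lam • ξ) v : ℝ))) * (φ v : ℂ)) lam
  rw [abs_of_pos (by positivity), Complex.real_smul] at h
  rw [← h]
  refine integral_congr_ae (Filter.Eventually.of_forall fun v => ?_)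
  simp only [smul_apply, map_smul, smul_eq_mul]
  rw [inv_mul_cancel_left₀ hlam.ne']

/-- The double integral splits as the square modulus of the transform of `φ(·/λ)`, namely `λ^{2d}
γ(λξ)`. -/
theorem integral_prod_exp_rescale (hlam : 0 < lam) (ξ : V →L[ℝ] ℝ) :
    ∫ p : V × V, (φ (lam⁻¹ • p.1) * φ (lam⁻¹ • p.2) : ℂ) *
      Complex.exp (2 * Real.pi * Complex.I * (ξ (p.1 - p.2) : ℝ)) ∂(vol.prod vol) =
      ((lam ^ Module.finrank ℝ V * gammaScaled vol φ lam ξ : ℝ) : ℂ) := by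
  have h1 : ∀ p : V × V, (φ (lam⁻¹ • p.1) * φ (lam⁻¹ • p.2) : ℂ) *
      Complex.exp (2 * Real.pi * Complex.I * (ξ (p.1 - p.2) : ℝ)) =
      (starRingEnd ℂ) (Complex.exp (-(2 * Real.pi * Complex.I * (ξ p.1 : ℝ))) *
        (φ (lam⁻¹ • p.1) : ℂ)) *
      (Complex.exp (-(2 * Real.pi * Complex.I * (ξ p.2 : ℝ))) * (φ (lam⁻¹ • p.2) : ℂ)) := by
    intro p
    have h2 : Complex.exp (2 * Real.pi * Complex.I * (ξ (p.1 - p.2) : ℝ)) =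
        Complex.exp (2 * Real.pi * Complex.I * (ξ p.1 : ℝ)) *
          Complex.exp (-(2 * Real.pi * Complex.I * (ξ p.2 : ℝ))) := by
      rw [← Complex.exp_add, map_sub]
      congr 1
      push_cast; ring
    have h3 : (starRingEnd ℂ) (Complex.exp (-(2 * Real.pi * Complex.I * (ξ p.1 : ℝ)))) =
        Complex.exp (2 * Real.pi * Complex.I * (ξ p.1 : ℝ)) := by
      rw [← Complex.exp_conj]
      congr 1
      simp only [map_neg, map_mul, map_ofNat, Complex.conj_I, Complex.conj_ofReal]
      ring
    rw [h2, map_mul, h3, Complex.conj_ofReal]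
    ring
  simp only [h1]
  rw [integral_prod_mul (fun v => (starRingEnd ℂ) (Complex.exp
      (-(2 * Real.pi * Complex.I * (ξ v : ℝ))) * (φ (lam⁻¹ • v) : ℂ)))
    (fun v => Complex.exp (-(2 * Real.pi * Complex.I * (ξ v : ℝ))) * (φ (lam⁻¹ • v) : ℂ)),
    integral_conj, Complex.conj_mul', integral_exp_rescale hlam, norm_mul,
    Complex.norm_of_nonneg (by positivity), gammaScaled, gammaFun]
  push_cast
  ring

theorem integrable_exp_prod (ν : Measure (V →L[ℝ] ℝ)) [IsFiniteMeasure ν]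
    (hφ : Integrable φ vol) (hlam : 0 < lam) :
    Integrable (fun r : (V × V) × (V →L[ℝ] ℝ) => (φ (lam⁻¹ • r.1.1) * φ (lam⁻¹ • r.1.2) : ℂ) *
      Complex.exp (2 * Real.pi * Complex.I * (r.2 (r.1.1 - r.1.2) : ℝ)))
      ((vol.prod vol).prod ν) := by
  have hψ := (integrable_rescale hφ hlam).ofReal (𝕜 := ℂ)
  have h1 := (hψ.mul_prod hψ).mul_prod (integrable_const (1 : ℂ) (μ := ν))
  have hc : Continuous fun r : (V × V) × (V →L[ℝ] ℝ) =>
      Complex.exp (2 * Real.pi * Complex.I * (r.2 (r.1.1 - r.1.2) : ℝ)) := by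
    have : Continuous fun r : (V × V) × (V →L[ℝ] ℝ) => r.2 (r.1.1 - r.1.2) :=
      continuous_snd.clm_apply (by fun_prop)
    fun_prop
  refine h1.mono ((h1.1.mul hc.aestronglyMeasurable).congr ?_) ?_
  · exact Filter.Eventually.of_forall fun r => by simp
  · refine Filter.Eventually.of_forall fun r => ?_
    have : 2 * Real.pi * Complex.I * ((r.2 (r.1.1 - r.1.2) : ℝ) : ℂ) =
        ((2 * Real.pi * r.2 (r.1.1 - r.1.2) : ℝ) : ℂ) * Complex.I := by push_cast; ring
    rw [this, norm_mul, Complex.norm_exp_ofReal_mul_I]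
    simp

/-- Up to a constant, `γ_λ` is a partial integral of the function in `integrable_exp_prod`;
finiteness of `ν` and `φ ∈ L¹` are enough. -/
theorem integrable_gammaScaled (ν : Measure (V →L[ℝ] ℝ)) [IsFiniteMeasure ν]
    (hφ : Integrable φ vol) (hlam : 0 < lam) : Integrable (gammaScaled vol φ lam) ν := by
  have h1 := (integrable_exp_prod ν hφ hlam).integral_prod_right
  simp only [integral_prod_exp_rescale hlam] at h1
  have h2 := h1.re.const_mul (lam ^ Module.finrank ℝ V)⁻¹
  refine h2.congr (Filter.Eventually.of_forall fun ξ => ?_)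
  simp only [RCLike.re_to_complex, Complex.ofReal_re]
  rw [inv_mul_cancel_left₀ (by positivity)]

theorem integral_weighted_fourier (ν : Measure (V →L[ℝ] ℝ)) [IsFiniteMeasure ν]
    (hφ : Integrable φ vol) (hlam : 0 < lam) {R : V → V → ℝ}
    (hR : ∀ u v, ((R u v : ℝ) : ℂ) =
      ∫ ξ : V →L[ℝ] ℝ, Complex.exp (2 * Real.pi * Complex.I * (ξ (u - v) : ℝ)) ∂ν) :
    ∫ p : V × V, φ (lam⁻¹ • p.1) * φ (lam⁻¹ • p.2) * R p.1 p.2 ∂(vol.prod vol) =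
      lam ^ Module.finrank ℝ V * ∫ ξ, gammaScaled vol φ lam ξ ∂ν := by
  have h1 := integral_integral_swap (f := fun (p : V × V) (ξ : V →L[ℝ] ℝ) =>
    (φ (lam⁻¹ • p.1) * φ (lam⁻¹ • p.2) : ℂ) *
      Complex.exp (2 * Real.pi * Complex.I * (ξ (p.1 - p.2) : ℝ))) (integrable_exp_prod ν hφ hlam)
  simp only [integral_prod_exp_rescale hlam, integral_const_mul, ← hR] at h1
  rw [integral_complex_ofReal, integral_const_mul] at h1
  apply Complex.ofReal_injective
  rw [← h1, ← integral_complex_ofReal]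
  simp only [Complex.ofReal_mul]

theorem normalization_sq_mul (d : ℕ) (hlam : 0 < lam) (x : ℝ) :
    (1 / lam ^ ((d : ℝ) / 2)) ^ 2 * (lam ^ d * x) = x := by
  have h : (lam ^ ((d : ℝ) / 2)) ^ 2 = lam ^ d := by
    rw [← Real.rpow_natCast, ← Real.rpow_mul hlam.le, ← Real.rpow_natCast lam d]
    congr 1
    push_cast; ring
  rw [div_pow, one_pow, h]
  field_simp

end Gamma

/-! ### Chaos decomposition and spectral formula for the variance -/

section ChaosVariance

variable {V W S : Type*}
    [NormedAddCommGroup V] [NormedSpace ℝ V] [FiniteDimensional ℝ V]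
    [MeasurableSpace V] [BorelSpace V]
    [NormedAddCommGroup W] [NormedSpace ℝ W] [FiniteDimensional ℝ W]
    [MeasurableSpace W] [BorelSpace W] [MeasurableSpace S]
    {vol : Measure V} [vol.IsAddHaarMeasure]
    {P : Measure S} [IsProbabilityMeasure P] {X : V → S → W} {η : Measure W}
    (hη : IsCentredGaussian η) (hmeas : Measurable fun p : V × S => X p.1 p.2)
    (hgauss : IsGaussianProcess X P)
    (hX : ∀ v, MeasurePreserving (X v) P η) {φ : V → ℝ} (hφ : Integrable φ vol)
    {lam : ℝ} (hlam : 0 < lam) {f : W → ℝ} (hf : MemLp f 2 η)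

include hη hmeas hgauss hX hφ hlam hf

/-- The chaos decomposition of the variance of a rescaled integral. -/
theorem hasSum_variance_chaosProj :
    HasSum (fun q : ℕ => Var[rescaledIntegral vol X (chaosProj η f (q + 1)) φ lam; P])
      Var[rescaledIntegral vol X f φ lam; P] := by
  have hπ := fun q => hη.memLp_chaosProj hf q
  rw [variance_rescaledIntegral hmeas hX hφ hlam hf]
  simp only [fun q => variance_rescaledIntegral hmeas hX hφ hlam (hπ (q + 1)),
    hη.integral_chaosProj_succ hf, ne_eq, OfNat.ofNat_ne_zero, not_false_eq_true, zero_pow,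
    sub_zero]
  refine HasSum.mul_left _ ?_
  have hsum : ∀ p : V × V, HasSum (fun q => φ (lam⁻¹ • p.1) * φ (lam⁻¹ • p.2) *
      ∫ ω, chaosProj η f (q + 1) (X p.1 ω) * chaosProj η f (q + 1) (X p.2 ω) ∂P)
      (φ (lam⁻¹ • p.1) * φ (lam⁻¹ • p.2) *
        ((∫ ω, f (X p.1 ω) * f (X p.2 ω) ∂P) - (∫ x, f x ∂η) ^ 2)) := by
    intro p
    refine HasSum.mul_left _ ?_
    have h1 := hη.hasSum_integral_chaosProj_mul (hgauss.hasGaussianLaw_prodMk (s := p.1) (t := p.2))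
      (hX p.1) (hX p.2) hf
    -- Dropping the order `0` term removes the squared mean, so the series starts at order `1`.
    rw [← hasSum_nat_add_iff' 1] at h1
    simpa [hη.chaosProj_zero hf, pow_two] using h1
  have hψ := integrable_rescale hφ hlam
  have h2 := hasSum_integral_of_summable_integral_norm
    (fun q => integrable_weighted_cov hmeas hX hφ hlam (hπ (q + 1))) ?_
  · simpa only [(hsum _).tsum_eq] using h2
  -- Sum and integral commute because the `q`-th term has `L¹` norm at most that of the weight times
  -- `‖π_q f‖²`, which is summable by Bessel.
  · have hs := ((summable_nat_add_iff 1).2 (hη.summable_integral_chaosProj_sq hf)).mul_left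
      (∫ p : V × V, ‖φ (lam⁻¹ • p.1) * φ (lam⁻¹ • p.2)‖ ∂(vol.prod vol))
    refine Summable.of_nonneg_of_le (fun q => integral_nonneg fun _ => norm_nonneg _)
      (fun q => ?_) hs
    rw [← integral_mul_const]
    refine integral_mono_of_nonneg (Filter.Eventually.of_forall fun _ => norm_nonneg _)
      ((hψ.mul_prod hψ).norm.mul_const _) (Filter.Eventually.of_forall fun p => ?_)
    simp only [norm_mul _ (∫ ω, _ ∂P)]
    refine mul_le_mul_of_nonneg_left ?_ (norm_nonneg _)
    exact (norm_integral_le_integral_norm _).trans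
      (integral_abs_comp_mul_comp_le (hX p.1) (hX p.2) (hπ (q + 1)))

/-- The spectral formula for the variance of a chaotic component. -/
theorem variance_chaosProj_eq {q : ℕ} (hq : 1 ≤ q) (ν : Measure (V →L[ℝ] ℝ)) [IsFiniteMeasure ν]
    (hν : ∀ u v, ∫ ω : Fin q → S, complexify (chaosCoeff η f q) (fun k => X u (ω k)) *
        (starRingEnd ℂ) (complexify (chaosCoeff η f q) fun k => X v (ω k))
        ∂(Measure.pi fun _ => P) =
      ∫ ξ : V →L[ℝ] ℝ, Complex.exp (2 * Real.pi * Complex.I * (ξ (u - v) : ℝ)) ∂ν) :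
    Var[rescaledIntegral vol X (chaosProj η f q) φ lam; P] =
      (1 / (q.factorial : ℝ)) * ∫ ξ, gammaScaled vol φ lam ξ ∂ν := by
  -- A projection of positive order has mean zero, so no squared mean is subtracted.
  obtain ⟨n, rfl⟩ : ∃ n, q = n + 1 := ⟨q - 1, by omega⟩
  rw [variance_rescaledIntegral hmeas hX hφ hlam (hη.memLp_chaosProj hf _),
    hη.integral_chaosProj_succ hf]
  simp only [ne_eq, OfNat.ofNat_ne_zero, not_false_eq_true, zero_pow, sub_zero,
    fun p : V × V => hη.integral_chaosProj_mul
      (hgauss.hasGaussianLaw_prodMk (s := p.1) (t := p.2)) (hX p.1) (hX p.2) hf (n + 1),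
    mul_left_comm _ (1 / ((n + 1).factorial : ℝ))]
  rw [integral_const_mul, integral_weighted_fourier ν hφ hlam
    (R := fun u v => ∫ ω : Fin (n + 1) → S, chaosCoeff η f (n + 1) (fun k => X u (ω k)) *
      chaosCoeff η f (n + 1) (fun k => X v (ω k)) ∂(Measure.pi fun _ => P)) fun u v => ?_]
  · rw [mul_left_comm, normalization_sq_mul _ hlam]
  · rw [← hν, ← integral_complex_ofReal]
    refine integral_congr_ae (Filter.Eventually.of_forall fun ω => ?_)
    simp [complexify]

end ChaosVariance
end

/-! ### The main theorem -/

/-- `X` is a centred stationary Gaussian field with continuous non-degenerate covariance, `η` is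
the law of `X(0)`, `f ∈ L²(η)` and `φ ∈ L¹ ∩ L²` with `‖φ‖₂ = 1`. -/
theorem theorem1
    {V W S : Type*}
    [NormedAddCommGroup V] [NormedSpace ℝ V] [FiniteDimensional ℝ V]
    [MeasurableSpace V] [BorelSpace V]
    [NormedAddCommGroup W] [NormedSpace ℝ W] [FiniteDimensional ℝ W]
    [MeasurableSpace W] [BorelSpace W]
    [MeasurableSpace S]
    (vol : Measure V) [vol.IsAddHaarMeasure]
    (P : Measure S) [IsProbabilityMeasure P]
    (X : V → S → W)
    (hmeas : Measurable fun p : V × S => X p.1 p.2)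
    (hgauss : IsGaussianProcess X P)
    (hcentred : ∀ v, ∫ ω, X v ω ∂P = 0)
    (hstat : ∀ h : V,
      IdentDistrib (fun ω (v : V) => X (v + h) ω) (fun ω (v : V) => X v ω) P P)
    (hcont : ∀ ℓ m : W →L[ℝ] ℝ, Continuous fun v : V => ∫ ω, ℓ (X v ω) * m (X 0 ω) ∂P)
    (hnondeg : ∀ ℓ : W →L[ℝ] ℝ, ℓ ≠ 0 → 0 < ∫ ω, ℓ (X 0 ω) ^ 2 ∂P)
    (η : Measure W) (hη : η = P.map (X 0))
    (f : W → ℝ) (hf : MemLp f 2 η)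
    (φ : V → ℝ) (hφ1 : MemLp φ 1 vol) (hφ2 : MemLp φ 2 vol) (hφnorm : eLpNorm φ 2 vol = 1) :
    -- `Z_λ(φ)` and its chaotic projections are well-defined and square-integrable
    (∀ lam : ℝ, 0 < lam →
      (∀ᵐ ω ∂P, Integrable (fun v => φ (lam⁻¹ • v) * f (X v ω)) vol) ∧
      MemLp (rescaledIntegral vol X f φ lam) 2 P ∧
      ∀ q : ℕ,
        (∀ᵐ ω ∂P, Integrable (fun v => φ (lam⁻¹ • v) * chaosProj η f q (X v ω)) vol) ∧
        MemLp (rescaledIntegral vol X (chaosProj η f q) φ lam) 2 P) ∧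
    -- `Var(Z_λ(φ)) = ∑_{q ≥ 1} Var(Z_λ^{(q)}(φ))`
    (∀ lam : ℝ, 0 < lam →
      HasSum (fun q : ℕ => Var[rescaledIntegral vol X (chaosProj η f (q + 1)) φ lam; P])
        Var[rescaledIntegral vol X f φ lam; P]) ∧
    -- the spectral measure `μ` and its convolution powers `μ^{*q}` exist and are unique
    (∃! μ : PosHermitianMeasure (V →L[ℝ] ℝ) (W →L[ℝ] ℂ), IsSpectralMeasure P X μ) ∧
    (∀ μ : PosHermitianMeasure (V →L[ℝ] ℝ) (W →L[ℝ] ℂ), IsSpectralMeasure P X μ →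
      ∀ q : ℕ, 1 ≤ q →
        (∃! M : PosHermitianMeasure (V →L[ℝ] ℝ) (W [×q]→L[ℝ] ℂ), IsConvPow q μ M) ∧
        ∀ M : PosHermitianMeasure (V →L[ℝ] ℝ) (W [×q]→L[ℝ] ℂ), IsConvPow q μ M →
          -- `Var(Z_λ^{(q)}(φ)) = (1/q!) ∫ γ_λ dμ^{*q}(f_q)`
          ∀ lam : ℝ, 0 < lam →
            Integrable (gammaScaled vol φ lam) (M.diag (complexify (chaosCoeff η f q))) ∧
            Var[rescaledIntegral vol X (chaosProj η f q) φ lam; P] =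
              (1 / (q.factorial : ℝ)) *
                ∫ ξ, gammaScaled vol φ lam ξ ∂(M.diag (complexify (chaosCoeff η f q)))) := by
  have hXm : ∀ v, Measurable (X v) := fun v => hmeas.comp measurable_prodMk_left
  have hX : ∀ v, MeasurePreserving (X v) P η := by
    intro v
    refine ⟨hXm v, ?_⟩
    have h1 := ((hstat v).comp (measurable_pi_apply (0 : V))).map_eq
    simp only [Function.comp_def, zero_add] at h1
    rw [hη]
    exact h1
  have hint : ∀ {g : W → ℝ}, Continuous g → ∫ x, g x ∂η = ∫ ω, g (X 0 ω) ∂P := by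
    intro g hg
    rw [hη, integral_map (hXm 0).aemeasurable hg.aestronglyMeasurable]
  have hGη : IsGaussian η := by rw [hη]; exact (hgauss.hasGaussianLaw_eval 0).isGaussian_map
  have hC : IsCentredGaussian η := by
    refine ⟨hGη, fun ℓ => ?_, fun ℓ hℓ => ?_⟩
    · have hi : Integrable (X 0) P := (hX 0).integrable_comp_of_integrable
        IsGaussian.integrable_id
      rw [hint ℓ.continuous, ℓ.integral_comp_comm hi, hcentred, map_zero]
    · rw [hint (g := fun x => ℓ x ^ 2) (ℓ.continuous.pow 2)]
      exact hnondeg ℓ hℓ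
  have hS : IsSecondOrderStationary P X := by
    refine ⟨hmeas, fun v ℓ => (hC.memLp_two ℓ).comp_measurePreserving (hX v),
      fun ℓ m u v => ?_, hcont⟩
    -- The shift by `v` carries the pair of points `(u - v, 0)` to `(u, v)`.
    have h1 := (hstat v).comp (u := fun x : V → W => ℓ (x (u - v)) * m (x 0)) (by fun_prop)
    have h2 := h1.integral_eq
    simpa only [Function.comp_def, sub_add_cancel, zero_add] using h2
  have hφ : Integrable φ vol := memLp_one_iff_integrable.1 hφ1
  have hπ := fun q => hC.memLp_chaosProj hf q
  refine ⟨fun lam hlam => ⟨ae_integrable_rescaled hmeas hX hφ hlam hf,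
      memLp_rescaledIntegral hmeas hX hφ hlam hf, fun q =>
      ⟨ae_integrable_rescaled hmeas hX hφ hlam (hπ q),
        memLp_rescaledIntegral hmeas hX hφ hlam (hπ q)⟩⟩,
    fun lam hlam => hasSum_variance_chaosProj hC hmeas hgauss hX hφ hlam hf,
    hS.existsUnique_isSpectralMeasure, fun μ hμ q hq => ?_⟩
  obtain ⟨M, hM, hMfourier⟩ := hS.exists_isConvPow hμ q
  refine ⟨⟨M, hM, fun N hN => hN.unique hM⟩, fun N hN lam hlam => ?_⟩
  -- By uniqueness any convolution power is the constructed one, for which the Fourier formula at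
  -- `f_q` is known.
  obtain rfl : N = M := hN.unique hM
  have hfin := N.finite (complexify (chaosCoeff η f q))
  exact ⟨integrable_gammaScaled _ hφ hlam,
    variance_chaosProj_eq hC hmeas hgauss hX hφ hlam hf hq _ (hMfourier _)⟩
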